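/- Let $F$ be a nonarchimedean local field of residual characteristic greater than $3$ containing a primitive cube root of unity $\rho$. Let $\mathcal O$ be its ring of integers, $\varpi$ a uniformizer, $q$ the cardinality of the residue field, $|\cdot|$ the absolute value with $|\varpi|=q^{-1}$, and $\psi$ an additive character of $F$ with conductor $\mathcal O$. Let $G=\mathrm{PGL}_3(F)$, $K=\mathrm{GL}_3(\mathcal O)$, $Z$ the center of $\mathrm{GL}_3(F)$, and $N$ the group of upper triangular unipotent matrices $u=\begin{pmatrix}1&x&z\\&1&y\\&&1\end{pmatrix}$. Let $H=\mathrm{SL}_2(F)\times N$ act on the right on $F^8=(F^2)^4$ by $$\xi\cdot(g,u)=(\xi_1g,\ (\xi_2+x\xi_1)g,\ (\xi_3-y\xi_1)g,\ (\xi_4+x\xi_3+y\rho^2\xi_2-(yx+\rho z)\xi_1)g),$$ and put $\theta(g,u)=\psi(x+y)$ and $\mathfrak c(\xi,(g,u))=\psi\big(2\sum_{1\le i<j\le4}a_{ij}(u)\,\xi_i\begin{pmatrix}0&1\\-1&0\end{pmatrix}{}^t\xi_j\big)$, where $a_{12}=(z-xy)y\rho^2$, $a_{13}=\rho xz$, $a_{14}=-(xy+z\rho^2)$,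 $a_{23}=-(xy\rho^2+z)$, $a_{24}=\rho y$, $a_{34}=x$. Let $\omega$ be the Weil representation of $G$ on the Schwartz–Bruhat space $\mathcal S(F^8)$ obtained from the adjoint action of $G$ on $\mathfrak{sl}_3(F)$, in the model in which $\omega(u)\phi(\xi)=\mathfrak c(\xi,(1,u))\,\phi(\xi\cdot(1,u))$ for $u\in N$. Explicitly, identify $\mathfrak{sl}_3(F)$ with $F^4\times F^4$ through $p=(X_{31},X_{32},X_{21},\tfrac{\rho-1}3(X_{11}+\rho^2X_{22}+\rho X_{33}))$ and $v=(X_{13},X_{23},X_{12},\tfrac1{\rho-1}(X_{11}+\rho X_{22}+\rho^2X_{33}))$; then $\omega(g)$ is the transport of $\Phi(X)\mapsto\Phi(g^{-1}Xg)$ on $\mathcal S(\mathfrak{sl}_3(F))$ by the partial Fourier transform $\Phi\mapsto\phi$, $\phi(\xi)=\int_{F^4}\Phi(p,v)\,\psi(-2\sum_i q_iv_i)\,dv$, $\xi_i=(p_i,q_i)$. Let $\omega(f)\phi=\int_G f(g)\,\omega(g)\phi\,dg$, with $KZ/Z$ of volume one. Let $\phi_\circ$ be the characteristic function of $\mathcal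 O^8$ and, for integers $m,n\ge0$, let $f_{m,n}$ be the characteristic function of $K\,\mathrm{diag}(\varpi^{-m-n},\varpi^{-n},1)\,KZ/Z$. For $a\in F^*$ let $\xi_1(a)=(0,1,0,a,-\tfrac12\rho^2a^{-2},0,0,0)\in F^8$. It is relevant, i.e. $\mathfrak c(\xi,h)\theta(h)=1$ for $\xi=\xi_1(a)$ and all $h$ in the stabilizer $H_\xi$. For $\phi\in\mathcal S(F^8)$ let $$\mathcal O(\xi,\phi)=\int_{H_\xi\backslash H}\phi(\xi\cdot h)\,\mathfrak c(\xi,h)\,\theta(h)\,dh,$$ where the measure is the quotient of the Haar measure on $H$ giving $\mathrm{SL}_2(\mathcal O)\times(N\cap K)$ volume one by the Haar measure on $H_\xi$ giving $\{(g,u)\in H_\xi:g\in\mathrm{SL}_2(\mathcal O)\}$ volume one. Write $a_k=\varpi^ka$. Then for all integers $m,n\ge0$ with $m+n\ge1$ and all $a\in F^*$ the integral defining $\mathcal O(\xi_1(a),\omega(f_{m,n})\phi_\circ)$ converges absolutely, and $$\mathcal O(\xi_1(a),\omega(f_{m,n})\phi_\circ)=\begin{cases}1&|a_{-n}|=1,\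 m=0\\ 3&|a_{-n}|=q,\ m=0\\ 1+\psi(-a)+\psi(\rho^2a)&|a_{-1}|=q^2,\ m=0,\ n=1\\ 1&|a_{-n}|=q^2,\ m=0,\ n>1\\ 2&|a_{-n}|=1,\ m=1\\ 2&|a_{-n}|=q,\ m=1,\ n>0\\ 1+\psi(-a)+\psi(\rho^2a)&|a_{-(2m+n)}|\ge q^3,\ m+n=1\\ 0&\text{otherwise.}\end{cases}$$ In particular it vanishes for $m\ge2$. -/

import Mathlib

open MeasureTheory Matrix
open scoped MatrixGroups ENNReal

namespace PGL3Orbital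

noncomputable section

/-! ### The local field -/

section LocalField

variable (F : Type*) [NontriviallyNormedField F] [IsUltrametricDist F]

/-- The ring of integers `{x | ‖x‖ ≤ 1}`. -/
abbrev ringOfIntegers : ValuationSubring F :=
  (NormedField.valuation (K := F)).valuationSubring

/-- The residue field. -/
abbrev residueField : Type _ := IsLocalRing.ResidueField (ringOfIntegers F)

/-- The cardinality `q` of the residue field. -/
def residueCard : ℕ := Nat.card (residueField F)

end LocalField

/-- `ϖ` generates the maximal ideal `{x | ‖x‖ < 1}` of the ring of integers. -/
def IsUniformizer {F : Type*} [NontriviallyNormedField F] (ϖ : F) : Prop :=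
  ‖ϖ‖ < 1 ∧ ∀ x : F, ‖x‖ < 1 → ‖x‖ ≤ ‖ϖ‖

/-- The additive character `ψ` has conductor the ring of integers: a ball
`{x | ‖x‖ ≤ ‖y‖}` is contained in its kernel exactly when `‖y‖ ≤ 1`. -/
def HasConductorIntegers {F : Type*} [NontriviallyNormedField F] (ψ : AddChar F Circle) : Prop :=
  ∀ y : F, (∀ x : F, ‖x‖ ≤ ‖y‖ → ψ x = 1) ↔ ‖y‖ ≤ 1

/-- The Haar measure on `F` giving the ring of integers volume one. -/
def haarF (F : Type*) [NontriviallyNormedField F] [ProperSpace F] [MeasurableSpace F]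
    [BorelSpace F] : Measure F :=
  Measure.addHaarMeasure
    ⟨⟨Metric.closedBall 0 1, isCompact_closedBall 0 1⟩,
      ⟨0, Metric.ball_subset_interior_closedBall (Metric.mem_ball_self one_pos)⟩⟩

/-! ### The groups -/

section Groups

variable (F : Type*) [NontriviallyNormedField F]

instance : TopologicalSpace PGL(3, F) :=
  inferInstanceAs (TopologicalSpace (GL (Fin 3) F ⧸ Subgroup.center (GL (Fin 3) F)))

instance : MeasurableSpace PGL(3, F) := borel _

instance : BorelSpace PGL(3, F) := ⟨rfl⟩

/-- `K = GL₃(𝒪)`: integral entries and unit determinant. -/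
def integralGL : Set (GL (Fin 3) F) :=
  {g | (∀ i j, ‖g i j‖ ≤ 1) ∧ ‖(g : Matrix (Fin 3) (Fin 3) F).det‖ = 1}

/-- `K_* = KZ/Z`, the image of `GL₃(𝒪)` in `PGL₃(F)`. -/
def integralPGL : Set PGL(3, F) := ProjGenLinGroup.mk '' integralGL F

variable {F}

/-- The unipotent matrix with coordinates `x, y, z`. -/
def unipMat (x y z : F) : Matrix (Fin 3) (Fin 3) F := !![1, x, z; 0, 1, y; 0, 0, 1]

lemma unipMat_mul (x y z x' y' z' : F) :
    unipMat x y z * unipMat x' y' z' = unipMat (x + x') (y + y') (z + z' + x * y') := by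
  ext i j
  fin_cases i <;> fin_cases j <;> simp [unipMat, Matrix.mul_apply, Fin.sum_univ_three] <;> ring

variable (F) in
/-- `N`, the group of upper triangular unipotent matrices in `GL₃(F)`. -/
def unip : Subgroup (GL (Fin 3) F) where
  carrier := {g | ∃ x y z : F, (g : Matrix (Fin 3) (Fin 3) F) = unipMat x y z}
  mul_mem' := by
    rintro g g' ⟨x, y, z, h⟩ ⟨x', y', z', h'⟩
    exact ⟨_, _, _, by rw [Units.val_mul, h, h', unipMat_mul]⟩
  one_mem' := ⟨0, 0, 0, by
    ext i j; fin_cases i <;> fin_cases j <;> simp [unipMat]⟩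
  inv_mem' := by
    rintro g ⟨x, y, z, h⟩
    refine ⟨-x, -y, x * y - z, ?_⟩
    have h1 : (g : Matrix (Fin 3) (Fin 3) F) * unipMat (-x) (-y) (x * y - z) = 1 := by
      rw [h, unipMat_mul]
      ext i j; fin_cases i <;> fin_cases j <;> simp [unipMat]
    rw [← Units.inv_mul_cancel_left g (unipMat (-x) (-y) (x * y - z)), h1, mul_one]

/-- The coordinate `x` of `u = (1 x z; 0 1 y; 0 0 1)`. -/
def ux (u : unip F) : F := (u : GL (Fin 3) F) 0 1

/-- The coordinate `y` of `u = (1 x z; 0 1 y; 0 0 1)`. -/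
def uy (u : unip F) : F := (u : GL (Fin 3) F) 1 2

/-- The coordinate `z` of `u = (1 x z; 0 1 y; 0 0 1)`. -/
def uz (u : unip F) : F := (u : GL (Fin 3) F) 0 2

lemma unip_val (u : unip F) :
    ((u : GL (Fin 3) F) : Matrix (Fin 3) (Fin 3) F) = unipMat (ux u) (uy u) (uz u) := by
  obtain ⟨g, x, y, z, h⟩ := u
  simp [ux, uy, uz, h, unipMat]

lemma unip_mul_val (u v : unip F) :
    (((u * v : unip F) : GL (Fin 3) F) : Matrix (Fin 3) (Fin 3) F) =
      unipMat (ux u + ux v) (uy u + uy v) (uz u + uz v + ux u * uy v) := by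
  rw [← unipMat_mul, ← unip_val, ← unip_val]; rfl

@[simp] lemma ux_mul (u v : unip F) : ux (u * v) = ux u + ux v := by
  rw [ux, unip_mul_val]; simp [unipMat]

@[simp] lemma uy_mul (u v : unip F) : uy (u * v) = uy u + uy v := by
  rw [uy, unip_mul_val]; simp [unipMat]

@[simp] lemma uz_mul (u v : unip F) : uz (u * v) = uz u + uz v + ux u * uy v := by
  rw [uz, unip_mul_val]; simp [unipMat]

@[simp] lemma ux_one : ux (1 : unip F) = 0 := by simp [ux]

@[simp] lemma uy_one : uy (1 : unip F) = 0 := by simp [uy]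

@[simp] lemma uz_one : uz (1 : unip F) = 0 := by simp [uz]

variable (F) in
/-- `H = SL₂(F) × N`. -/
def HGroup : Type _ := SL(2, F) × unip F

instance : Group (HGroup F) := inferInstanceAs (Group (SL(2, F) × unip F))

instance : TopologicalSpace (HGroup F) := inferInstanceAs (TopologicalSpace (SL(2, F) × unip F))

instance : MeasurableSpace (HGroup F) := borel _

instance : BorelSpace (HGroup F) := ⟨rfl⟩

@[simp] lemma HGroup.fst_mul (h k : HGroup F) : (h * k).1 = h.1 * k.1 := rfl

@[simp] lemma HGroup.snd_mul (h k : HGroup F) : (h * k).2 = h.2 * k.2 := rfl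

@[simp] lemma HGroup.fst_one : (1 : HGroup F).1 = 1 := rfl

@[simp] lemma HGroup.snd_one : (1 : HGroup F).2 = 1 := rfl

variable (F) in
/-- `SL₂(𝒪)`. -/
def integralSL2 : Set SL(2, F) := {g | ∀ i j, ‖g i j‖ ≤ 1}

variable (F) in
/-- `SL₂(𝒪) × (N ∩ K)`. -/
def integralH : Set (HGroup F) := {h | h.1 ∈ integralSL2 F ∧ (h.2 : GL (Fin 3) F) ∈ integralGL F}

end Groups

/-! ### The action of `H` on `F⁸`, the cocycle, relevant elements -/

section Action

variable {F : Type*} [NontriviallyNormedField F]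

/-- `F⁸`, written as quadruples `(ξ₁, ξ₂, ξ₃, ξ₄)` of row vectors in `F²`. -/
abbrev F8 (F : Type*) : Type _ := Fin 4 → Fin 2 → F

/-- The right action of `H` on `F⁸`: for `h = (g, u)` it is
`(ξ₁ g, (ξ₂ + x ξ₁) g, (ξ₃ - y ξ₁) g, (ξ₄ + x ξ₃ + y ρ² ξ₂ - (y x + ρ z) ξ₁) g)`. -/
def act (ρ : F) (ξ : F8 F) (h : HGroup F) : F8 F :=
  ![ξ 0 ᵥ* h.1.1,
    (ξ 1 + ux h.2 • ξ 0) ᵥ* h.1.1,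
    (ξ 2 - uy h.2 • ξ 0) ᵥ* h.1.1,
    (ξ 3 + ux h.2 • ξ 2 + (uy h.2 * ρ ^ 2) • ξ 1 - (uy h.2 * ux h.2 + ρ * uz h.2) • ξ 0) ᵥ* h.1.1]

/-- The symmetric matrix `(a_{ij}(u))`, in terms of the coordinates `x, y, z` of `u`. -/
def aMat (ρ x y z : F) : Matrix (Fin 4) (Fin 4) F :=
  !![0, (z - x * y) * y * ρ ^ 2, ρ * x * z, -(x * y + z * ρ ^ 2);
     (z - x * y) * y * ρ ^ 2, 0, -(x * y * ρ ^ 2 + z), ρ * y;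
     ρ * x * z, -(x * y * ρ ^ 2 + z), 0, x;
     -(x * y + z * ρ ^ 2), ρ * y, x, 0]

/-- The symplectic form `v (0 1; -1 0) ᵗw` on `F²`. -/
def sympl (v w : Fin 2 → F) : F := v ⬝ᵥ (!![0, 1; -1, 0] *ᵥ w)

/-- `2 ∑_{i<j} a_{ij}(u) ξ_i (0 1; -1 0) ᵗξ_j`. -/
def phase (ρ : F) (ξ : F8 F) (h : HGroup F) : F :=
  2 * ∑ i, ∑ j ∈ Finset.Ioi i, aMat ρ (ux h.2) (uy h.2) (uz h.2) i j * sympl (ξ i) (ξ j)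

/-- The cocycle `𝔠(ξ, h)`. -/
def cocycle (ψ : AddChar F Circle) (ρ : F) (ξ : F8 F) (h : HGroup F) : Circle :=
  ψ (phase ρ ξ h)

/-- The character `θ(g, u) = ψ(x + y)` of `H`. -/
def theta (ψ : AddChar F Circle) (h : HGroup F) : Circle := ψ (ux h.2 + uy h.2)

lemma sympl_apply (v w : Fin 2 → F) : sympl v w = v 0 * w 1 - v 1 * w 0 := by
  simp [sympl, dotProduct, Matrix.mulVec, Fin.sum_univ_two]; ring

lemma sympl_vecMul (v w : Fin 2 → F) (g : SL(2, F)) :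
    sympl (v ᵥ* g.1) (w ᵥ* g.1) = sympl v w := by
  have hg := g.2
  rw [Matrix.det_fin_two] at hg
  simp only [sympl_apply, Matrix.vecMul, dotProduct, Fin.sum_univ_two]
  linear_combination (v 0 * w 1 - v 1 * w 0) * hg

lemma phase_eq (ρ : F) (ξ : F8 F) (h : HGroup F) :
    phase ρ ξ h = 2 *
      ((uz h.2 - ux h.2 * uy h.2) * uy h.2 * ρ ^ 2 * sympl (ξ 0) (ξ 1)
        + ρ * ux h.2 * uz h.2 * sympl (ξ 0) (ξ 2)
        - (ux h.2 * uy h.2 + uz h.2 * ρ ^ 2) * sympl (ξ 0) (ξ 3)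
        - (ux h.2 * uy h.2 * ρ ^ 2 + uz h.2) * sympl (ξ 1) (ξ 2)
        + ρ * uy h.2 * sympl (ξ 1) (ξ 3) + ux h.2 * sympl (ξ 2) (ξ 3)) := by
  have h0 : Finset.Ioi (0 : Fin 4) = {1, 2, 3} := by decide
  have h1 : Finset.Ioi (1 : Fin 4) = {2, 3} := by decide
  have h2 : Finset.Ioi (2 : Fin 4) = {3} := by decide
  have h3 : Finset.Ioi (3 : Fin 4) = ∅ := by decide
  simp only [phase, Fin.sum_univ_four, h0, h1, h2, h3]
  simp [aMat]
  left
  ring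

lemma cube_root_sum {ρ : F} (hρ : IsPrimitiveRoot ρ 3) : ρ ^ 2 = -1 - ρ := by
  have h := hρ.geom_sum_eq_zero (by norm_num)
  simp only [Finset.sum_range_succ, Finset.sum_range_zero] at h
  linear_combination h

lemma act_one (ρ : F) (ξ : F8 F) : act ρ ξ 1 = ξ := by
  ext i j
  fin_cases i <;> simp [act]

lemma act_mul {ρ : F} (hρ : IsPrimitiveRoot ρ 3) (ξ : F8 F) (h k : HGroup F) :
    act ρ ξ (h * k) = act ρ (act ρ ξ h) k := by
  have hr := cube_root_sum hρ
  ext i j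
  fin_cases i <;> fin_cases j <;>
    simp [act, Matrix.vecMul, dotProduct, Fin.sum_univ_two, Matrix.mul_apply] <;> grind

/-- The stabilizer `H_ξ`. -/
def stab {ρ : F} (hρ : IsPrimitiveRoot ρ 3) (ξ : F8 F) : Subgroup (HGroup F) where
  carrier := {h | act ρ ξ h = ξ}
  mul_mem' := by
    intro h k hh hk
    simp only [Set.mem_ofPred_eq] at *
    rw [act_mul hρ, hh, hk]
  one_mem' := act_one ρ ξ
  inv_mem' := by
    intro h hh
    simp only [Set.mem_ofPred_eq] at *
    conv_lhs => rw [← hh]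
    rw [← act_mul hρ, mul_inv_cancel, act_one]

/-- The space `H_ξ \ H` of right cosets `H_ξ h`. -/
abbrev StabQuot {ρ : F} (hρ : IsPrimitiveRoot ρ 3) (ξ : F8 F) : Type _ :=
  Quotient (QuotientGroup.rightRel (stab hρ ξ))

/-- `ξ` is relevant if `𝔠(ξ, h) θ(h) = 1` for all `h ∈ H_ξ`. -/
def IsRelevant (ψ : AddChar F Circle) {ρ : F} (hρ : IsPrimitiveRoot ρ 3) (ξ : F8 F) : Prop :=
  ∀ h ∈ stab hρ ξ, cocycle ψ ρ ξ h * theta ψ h = 1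

lemma theta_mul (ψ : AddChar F Circle) (h k : HGroup F) :
    theta ψ (h * k) = theta ψ h * theta ψ k := by
  rw [theta, theta, theta, ← AddChar.map_add_eq_mul]
  congr 1
  simp; ring

lemma phase_mul {ρ : F} (hρ : IsPrimitiveRoot ρ 3) (ξ : F8 F) (h k : HGroup F) :
    phase ρ ξ (h * k) = phase ρ ξ h + phase ρ (act ρ ξ h) k := by
  have hr := cube_root_sum hρ
  simp only [phase_eq]
  simp only [act, Matrix.cons_val, sympl_vecMul]
  simp only [sympl_apply, HGroup.snd_mul, ux_mul, uy_mul, uz_mul, Pi.add_apply, Pi.sub_apply,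
    Pi.smul_apply, smul_eq_mul]
  generalize ux h.2 = x, uy h.2 = y, uz h.2 = z, ux k.2 = x', uy k.2 = y', uz k.2 = z'
  grind

lemma cocycle_mul (ψ : AddChar F Circle) {ρ : F} (hρ : IsPrimitiveRoot ρ 3) (ξ : F8 F)
    (h k : HGroup F) :
    cocycle ψ ρ ξ (h * k) = cocycle ψ ρ ξ h * cocycle ψ ρ (act ρ ξ h) k := by
  rw [cocycle, cocycle, cocycle, ← AddChar.map_add_eq_mul, phase_mul hρ]

/-- For relevant `ξ`, the function `H_ξ h ↦ φ(ξ·h) 𝔠(ξ,h) θ(h)` on `H_ξ \ H`. -/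
def orbitalIntegrand (ψ : AddChar F Circle) {ρ : F} (hρ : IsPrimitiveRoot ρ 3) {ξ : F8 F}
    (hξ : IsRelevant ψ hρ ξ) (φ : F8 F → ℂ) : StabQuot hρ ξ → ℂ :=
  Quotient.lift (fun h => φ (act ρ ξ h) * (cocycle ψ ρ ξ h : ℂ) * (theta ψ h : ℂ)) (by
    intro h k hk
    have hs : k * h⁻¹ ∈ stab hρ ξ := QuotientGroup.rightRel_apply.mp hk
    obtain ⟨s, rfl⟩ : ∃ s, k = s * h := ⟨k * h⁻¹, by group⟩
    rw [mul_inv_cancel_right] at hs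
    have h1 : act ρ ξ s = ξ := hs
    have h2 := hξ s hs
    have h3 : cocycle ψ ρ ξ (s * h) * theta ψ (s * h) = cocycle ψ ρ ξ h * theta ψ h := by
      rw [cocycle_mul ψ hρ, theta_mul, h1, mul_mul_mul_comm, h2, one_mul]
    simp only [mul_assoc, ← Circle.coe_mul]
    rw [h3, act_mul hρ, h1])

/-- `ν` is the quotient of the measure `μ` on `H` by the measure `μ'` on `H_ξ`:
`∫_H f dμ = ∫_{H_ξ\H} (∫_{H_ξ} f(s h) dμ'(s)) dν(H_ξ h)` for all measurable `f ≥ 0`.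
Here `φ` is the inner integral as a function on `H_ξ \ H`. -/
def IsQuotientMeasure {ρ : F} (hρ : IsPrimitiveRoot ρ 3) (ξ : F8 F)
    (μ : Measure (HGroup F)) (μ' : Measure (stab hρ ξ)) (ν : Measure (StabQuot hρ ξ)) : Prop :=
  ∀ f : HGroup F → ℝ≥0∞, Measurable f → ∀ φ : StabQuot hρ ξ → ℝ≥0∞,
    (∀ h : HGroup F, φ (Quotient.mk _ h) = ∫⁻ s, f (s.1 * h) ∂μ') →
      ∫⁻ h, f h ∂μ = ∫⁻ c, φ c ∂ν

/-- The relative orbital integral `∫_{H_ξ\H} φ(ξ·h) 𝔠(ξ,h) θ(h) dh` of a relevant `ξ`. -/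
def orbitalIntegral (ψ : AddChar F Circle) {ρ : F} (hρ : IsPrimitiveRoot ρ 3) {ξ : F8 F}
    (hξ : IsRelevant ψ hρ ξ) (ν : Measure (StabQuot hρ ξ)) (φ : F8 F → ℂ) : ℂ :=
  ∫ c, orbitalIntegrand ψ hρ hξ φ c ∂ν

/-- `ξ₁(a) = (0, 1, 0, a, -½ρ²a⁻², 0, 0, 0)`. -/
def xiOne (ρ a : F) : F8 F := ![![0, 1], ![0, a], ![-(1 / 2) * ρ ^ 2 * (a ^ 2)⁻¹, 0], ![0, 0]]

lemma two_ne_zero_of_residueChar [IsUltrametricDist F] (hF : 3 < ringChar (residueField F)) :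
    (2 : F) ≠ 0 := by
  intro h
  have h1 : ((2 : ℕ) : ringOfIntegers F) = 0 := Subtype.ext (by push_cast; exact h)
  have h2 : ((2 : ℕ) : residueField F) = 0 := by
    rw [← map_natCast (IsLocalRing.residue (ringOfIntegers F)), h1, map_zero]
  exact absurd (Nat.le_of_dvd (by norm_num) (ringChar.dvd h2)) (by omega)

lemma xiOne_relevant [IsUltrametricDist F] (hF : 3 < ringChar (residueField F))
    (ψ : AddChar F Circle) {ρ : F} (hρ : IsPrimitiveRoot ρ 3) {a : F} (ha : a ≠ 0) :
    IsRelevant ψ hρ (xiOne ρ a) := by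
  intro h hh
  have h2 := two_ne_zero_of_residueChar hF
  have hr := cube_root_sum hρ
  have hh' : act ρ (xiOne ρ a) h = xiOne ρ a := hh
  have e (i : Fin 4) (j : Fin 2) := congrFun (congrFun hh' i) j
  have e01 := e 0 1
  have e11 := e 1 1
  have e31 := e 3 1
  simp [act, xiOne, Matrix.vecMul, dotProduct, Fin.sum_univ_two] at e01 e11 e31
  have hx : ux h.2 = 0 := by rw [e01] at e11; linear_combination e11
  rw [hx, e01] at e31
  have hph : phase ρ (xiOne ρ a) h = -uy h.2 := by
    rw [phase_eq, hx]
    simp only [sympl_apply, xiOne, Matrix.cons_val]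
    have h0 : ρ ≠ 0 := hρ.ne_zero (by norm_num)
    have hz : uz h.2 = ρ * uy h.2 * a := by
      apply mul_left_cancel₀ h0
      linear_combination -e31
    have h3 : ρ ^ 3 = 1 := hρ.pow_eq_one
    rw [hz]
    field_simp
    linear_combination (-uy h.2 * a ^ 2) * h3
  rw [cocycle, theta, ← AddChar.map_add_eq_mul, hph, hx]
  simp

end Action

/-! ### The Weil representation of `PGL₃(F)` on `S(F⁸)` -/

section Weil

variable {F : Type*} [NontriviallyNormedField F]

/-- For `X ∈ 𝔰𝔩₃`, the coordinates `p = (X₃₁, X₃₂, X₂₁, (ρ-1)/3 (X₁₁ + ρ² X₂₂ + ρ X₃₃))` on a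
Lagrangian subspace of the quadratic space `(𝔰𝔩₃, ½ tr X²)`. -/
def slP (ρ : F) (X : Matrix (Fin 3) (Fin 3) F) : Fin 4 → F :=
  ![X 2 0, X 2 1, X 1 0, (ρ - 1) / 3 * (X 0 0 + ρ ^ 2 * X 1 1 + ρ * X 2 2)]

/-- For `X ∈ 𝔰𝔩₃`, the dual coordinates
`v = (X₁₃, X₂₃, X₁₂, (ρ-1)⁻¹ (X₁₁ + ρ X₂₂ + ρ² X₃₃))`, so that `½ tr X² = ∑ p_i v_i`. -/
def slV (ρ : F) (X : Matrix (Fin 3) (Fin 3) F) : Fin 4 → F :=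
  ![X 0 2, X 1 2, X 0 1, (ρ - 1)⁻¹ * (X 0 0 + ρ * X 1 1 + ρ ^ 2 * X 2 2)]

/-- The element of `𝔰𝔩₃` with coordinates `p` and `v`. -/
def slMk (ρ : F) (p v : Fin 4 → F) : Matrix (Fin 3) (Fin 3) F :=
  !![(ρ - 1)⁻¹ * p 3 + (ρ - 1) / 3 * v 3, v 2, v 0;
     p 2, ρ * (ρ - 1)⁻¹ * p 3 + ρ ^ 2 * (ρ - 1) / 3 * v 3, v 1;
     p 0, p 1, ρ ^ 2 * (ρ - 1)⁻¹ * p 3 + ρ * (ρ - 1) / 3 * v 3]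

variable [ProperSpace F] [MeasurableSpace F] [BorelSpace F]

/-- The partial Fourier transform from functions on `𝔰𝔩₃` to functions on `F⁸`:
with `ξ_i = (p_i, q_i)`, it is `∫ Φ(p, v) ψ(-2 ∑ q_i v_i) dv`. -/
def toMixed (ψ : AddChar F Circle) (ρ : F) (Φ : Matrix (Fin 3) (Fin 3) F → ℂ) (ξ : F8 F) : ℂ :=
  ∫ v : Fin 4 → F, Φ (slMk ρ (fun i => ξ i 0) v) * (ψ (-2 * ∑ i, ξ i 1 * v i) : ℂ)
    ∂Measure.pi fun _ => haarF F

/-- The inverse partial Fourier transform, from functions on `F⁸` to functions on `𝔰𝔩₃`. -/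
def fromMixed (ψ : AddChar F Circle) (ρ : F) (φ : F8 F → ℂ) (X : Matrix (Fin 3) (Fin 3) F) : ℂ :=
  ∫ q : Fin 4 → F, φ (fun i => ![slP ρ X i, q i]) * (ψ (2 * ∑ i, q i * slV ρ X i) : ℂ)
    ∂Measure.pi fun _ => haarF F

/-- The Weil representation restricted to `GL₃(F)`, acting through `Ad` on the quadratic space
`𝔰𝔩₃`. In the model `S(𝔰𝔩₃)` an element `g` acts by `Φ ↦ Φ(g⁻¹ X g)`; the model `S(F⁸)` is
obtained from it by the partial Fourier transform. In this model `u ∈ N` acts by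
`φ ↦ 𝔠(ξ, u) φ(ξ·u)` and `t = diag(t₁, t₂, t₃)` by
`φ ↦ |t₁/t₃|² φ((t₁/t₃) ξ₁, (t₂/t₃) ξ₂, (t₁/t₂) ξ₃, ξ₄)`. -/
def weilGL (ψ : AddChar F Circle) (ρ : F) (g : GL (Fin 3) F) (φ : F8 F → ℂ) : F8 F → ℂ :=
  toMixed ψ ρ fun X => fromMixed ψ ρ φ ((g⁻¹ : GL (Fin 3) F).1 * X * g.1)

lemma weilGL_mul_center (ψ : AddChar F Circle) (ρ : F) (g z : GL (Fin 3) F)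
    (hz : z ∈ Subgroup.center (GL (Fin 3) F)) : weilGL ψ ρ (g * z) = weilGL ψ ρ g := by
  obtain ⟨c, hc⟩ := GeneralLinearGroup.mem_center_iff_val_mem_range_scalar.mp hz
  have hcomm : ∀ Y : Matrix (Fin 3) (Fin 3) F, Y * z.1 = z.1 * Y := fun Y => by
    rw [← hc]; exact ((Matrix.scalar_commute c (fun r => mul_comm c r) Y).eq).symm
  funext φ
  unfold weilGL
  congr 1
  funext X
  congr 1
  calc ((g * z)⁻¹ : GL (Fin 3) F).1 * X * (g * z : GL (Fin 3) F).1
      = ((z⁻¹ : GL (Fin 3) F).1 * (g⁻¹ : GL (Fin 3) F).1 * X * g.1) * z.1 := by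
        rw [_root_.mul_inv_rev, Units.val_mul, Units.val_mul]; simp only [mul_assoc]
    _ = z.1 * ((z⁻¹ : GL (Fin 3) F).1 * (g⁻¹ : GL (Fin 3) F).1 * X * g.1) := hcomm _
    _ = (g⁻¹ : GL (Fin 3) F).1 * X * g.1 := by
        simp only [mul_assoc]; rw [Units.mul_inv_cancel_left]

/-- The Weil representation restricted to `PGL₃(F)`. -/
def weil (ψ : AddChar F Circle) (ρ : F) (g : PGL(3, F)) : (F8 F → ℂ) → F8 F → ℂ :=
  Quotient.lift (fun g : GL (Fin 3) F => weilGL ψ ρ g) (by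
    intro g h hgh
    have hz := QuotientGroup.leftRel_apply.mp hgh
    have := weilGL_mul_center ψ ρ g _ hz
    rw [mul_inv_cancel_left] at this
    exact this.symm) g

/-- The action `ω(f)φ(ξ) = ∫_G f(g) (ω(g)φ)(ξ) dg` of a function `f` on `G = PGL₃(F)`. -/
def weilConv (ψ : AddChar F Circle) (ρ : F) (μ : Measure PGL(3, F)) (f : PGL(3, F) → ℂ)
    (φ : F8 F → ℂ) (ξ : F8 F) : ℂ :=
  ∫ g, f g * weil ψ ρ g φ ξ ∂μ

end Weil

/-! ### The test functions -/

section TestFunctions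

variable {F : Type*} [NontriviallyNormedField F]

variable (F) in
/-- `φ_∘`, the characteristic function of `𝒪⁸`. -/
def phiCirc : F8 F → ℂ := Set.indicator {ξ | ∀ i j, ‖ξ i j‖ ≤ 1} 1

/-- The matrix `d_{m,n} = diag(ϖ^{-m-n}, ϖ^{-n}, 1)`. -/
def dMat (ϖ : F) (m n : ℕ) : Matrix (Fin 3) (Fin 3) F :=
  Matrix.diagonal ![ϖ ^ (-(m : ℤ) - n), ϖ ^ (-(n : ℤ)), 1]

/-- `f_{m,n}`, the characteristic function of `K d_{m,n} K Z / Z`. -/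
def heckeFun (ϖ : F) (m n : ℕ) : PGL(3, F) → ℂ :=
  Set.indicator (ProjGenLinGroup.mk '' {g : GL (Fin 3) F | ∃ k ∈ integralGL F,
    ∃ k' ∈ integralGL F, g.1 = k.1 * dMat ϖ m n * k'.1}) 1

end TestFunctions

end

end PGL3Orbital

open PGL3Orbital

set_option linter.unusedSectionVars false

namespace PGL3Orbital

noncomputable section

/-! ### Volumes of balls and integrals of additive characters -/

section FieldBasics

variable {F : Type*} [NontriviallyNormedField F] [IsUltrametricDist F] [ProperSpace F]
  [MeasurableSpace F] [BorelSpace F]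

/-! The operator `ω(f_{m,n})` is expanded over left cosets of `K`. The orbital integral of each
translate of `φ_∘` is computed, and the results are summed against Whittaker coefficients of the
double coset.

In the model `S(𝔰𝔩₃)` the vector `φ_∘` is the characteristic function of the integral matrices,
because 2, 3 and `ρ - 1` are units. It is therefore fixed by `K`. By the Iwasawa decomposition,
`ω(f_{m,n})φ_∘` is a finite sum of vectors `ω(ut)φ_∘` with `u ∈ N` and `t = diag(ϖ^(i+j), ϖ^j, 1)`
(`exists_isHeckeReps`).

The orbital integral transforms under `N` by `θ⁻¹`, so `ut` contributes `θ(u)⁻¹` times the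
contribution of `t`. The latter equals `q^(-2(i+j)) L(i, j)` with `L` the function `levelSum`
(`integral_orbitalIntegrand_toGL`). Indeed `H_ξ \ H` is swept out by the torus of `SL₂`, by `SL₂(𝒪)`
and by `N`. On each torus coset the coordinates `y` and `z` enter through additive characters, whose
integrals turn into conditions on `x`, and one integral over `x` is left. The same equivariance
forces `L(i, j) = 0` unless `i, j ≥ 0` (`levelSum_eq_zero_of_neg`).

By the Cartan decomposition, whether `ut` lies in the double coset is read off from its largest
entry `q^r` and its largest `2 × 2` minor `q^(l-j)`. The sum of `θ(u)⁻¹` for fixed `t` is thus an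
integral of `ψ(-x-y)` over a cell of `N` (`IsHeckeReps.sum_theta_inv`). On the dominant chamber it
vanishes unless `r, l ≤ 2`, and it is explicit (`cellIntegral_eq_torusCoeff`).

Finally `L(i, j) = q L(i-1, j-1) + D(i, j)` with an elementary `D` (`levelSum_eq`): the step down
removes the extreme levels and leaves the middle ones unchanged. The coefficients proportional to
`q` cancel against this recursion. What remains is `D(n, m) - D(n-2, m+1) - D(n+1, m-2)` plus a
multiple of `D(n-1, m-1)`, and `levelDiffExt_combination` evaluates it to the table. -/

instance : (haarF F).IsAddHaarMeasure := by unfold haarF; infer_instance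

lemma haarF_closedBall_one : haarF F (Metric.closedBall 0 1) = 1 :=
  Measure.addHaarMeasure_self
    (K₀ := ⟨⟨Metric.closedBall 0 1, isCompact_closedBall 0 1⟩,
      ⟨0, Metric.ball_subset_interior_closedBall (Metric.mem_ball_self one_pos)⟩⟩)

/-- A translation invariant measure on `F` giving the integers volume one is `haarF F`. -/
lemma eq_haarF_of_isAddLeftInvariant (μ : Measure F) [μ.IsAddLeftInvariant]
    (h : μ (Metric.closedBall 0 1) = 1) : μ = haarF F := by
  have hb : μ (Metric.ball 0 1) ≠ ∞ :=
    ((measure_mono Metric.ball_subset_closedBall).trans_lt (h ▸ ENNReal.one_lt_top)).ne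
  -- Finitely many translates of the open unit ball cover a compact set, so finiteness on that ball
  -- suffices.
  have : IsFiniteMeasureOnCompacts μ :=
    ⟨fun K hK => measure_lt_top_of_isCompact_of_isAddLeftInvariant _ Metric.isOpen_ball
      ⟨0, Metric.mem_ball_self one_pos⟩ hb hK⟩
  have := Measure.addHaarMeasure_unique μ
    ⟨⟨Metric.closedBall 0 1, isCompact_closedBall (0 : F) 1⟩,
      ⟨0, Metric.ball_subset_interior_closedBall (Metric.mem_ball_self one_pos)⟩⟩
  rw [this]
  change μ (Metric.closedBall 0 1) • haarF F = haarF F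
  rw [h, one_smul]

/-- `ϖ` is a uniformizer, `‖ϖ‖ = q⁻¹`, and `q` is the module of `F`. -/
structure IsNormalizedUniformizer (ϖ : F) (q : ℝ) : Prop where
  one_lt : 1 < q
  norm_eq : ‖ϖ‖ = q⁻¹
  exists_zpow : ∀ x : F, x ≠ 0 → ∃ k : ℤ, ‖x‖ = q ^ k
  haarF_closedBall_zero : ∀ k : ℤ, haarF F (Metric.closedBall 0 (q ^ k)) = ENNReal.ofReal (q ^ k)

lemma mem_ringOfIntegers {x : F} : x ∈ ringOfIntegers F ↔ ‖x‖ ≤ 1 := by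
  rw [Valuation.mem_valuationSubring_iff]
  exact Iff.rfl

lemma residue_eq_zero_iff (x : ringOfIntegers F) :
    IsLocalRing.residue (ringOfIntegers F) x = 0 ↔ ‖(x : F)‖ < 1 := by
  rw [IsLocalRing.residue_eq_zero_iff, IsLocalRing.mem_maximalIdeal, mem_nonunits_iff]
  have hx := mem_ringOfIntegers.mp x.2
  constructor
  · intro hu
    refine lt_of_le_of_ne hx fun h1 => hu ?_
    have h0 : (x : F) ≠ 0 := norm_ne_zero_iff.mp (by rw [h1]; exact one_ne_zero)
    refine IsUnit.of_mul_eq_one ⟨(x : F)⁻¹, mem_ringOfIntegers.mpr (by rw [norm_inv, h1, inv_one])⟩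
      (Subtype.ext ?_)
    exact mul_inv_cancel₀ h0
  · rintro hlt ⟨u, rfl⟩
    have h1 : ((u : ringOfIntegers F) : F) * ((u⁻¹ : (ringOfIntegers F)ˣ) : ringOfIntegers F) = 1 := by
      exact_mod_cast congrArg Subtype.val u.mul_inv
    have h2 := mem_ringOfIntegers.mp ((u⁻¹ : (ringOfIntegers F)ˣ) : ringOfIntegers F).2
    have h3 := congrArg norm h1
    rw [norm_mul, norm_one] at h3
    nlinarith [norm_nonneg ((u : ringOfIntegers F) : F)]

lemma isNormalizedUniformizer {ϖ : F} (hϖ : IsUniformizer ϖ)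
    (hnorm : ‖ϖ‖ = (residueCard F : ℝ)⁻¹) : IsNormalizedUniformizer ϖ (residueCard F : ℝ) := by
  have h0 : ϖ ≠ 0 := by
    rintro rfl
    obtain ⟨x, hx0, hx⟩ := NormedField.exists_norm_lt_one F
    have := hϖ.2 x hx
    rw [norm_zero] at this
    linarith
  have hpos : 0 < ‖ϖ‖ := norm_pos_iff.mpr h0
  have hq0 : 0 < (residueCard F : ℝ) := inv_pos.mp (hnorm ▸ hpos)
  have hq1 : 1 < (residueCard F : ℝ) := by
    have := hϖ.1
    rw [hnorm] at this
    exact (inv_lt_one₀ hq0).mp this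
  have hex : ∀ x : F, x ≠ 0 → ∃ k : ℤ, ‖x‖ = (residueCard F : ℝ) ^ k := by
    intro x hx
    obtain ⟨k, hk1, hk2⟩ := exists_mem_Ioc_zpow (norm_pos_iff.mpr hx) hq1
    -- Here `q ^ k < ‖x‖ ≤ q ^ (k + 1)`. If the upper bound were strict, `x ϖ^(k+1)` would lie in
    -- the maximal ideal and so have norm at most `q⁻¹`, which contradicts the lower bound.
    refine ⟨k + 1, le_antisymm hk2 ?_⟩
    by_contra! hlt
    have hn : ‖x * ϖ ^ (k + 1)‖ < 1 := by
      rw [norm_mul, norm_zpow, hnorm, _root_.inv_zpow]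
      exact (mul_inv_lt_iff₀ (by positivity)).mpr (by simpa using hlt)
    have h2 := hϖ.2 _ hn
    rw [norm_mul, norm_zpow, hnorm, _root_.inv_zpow, mul_inv_le_iff₀ (by positivity),
      zpow_add₀ hq0.ne', zpow_one, mul_comm ((residueCard F : ℝ) ^ k), inv_mul_cancel_left₀ hq0.ne'] at h2
    linarith
  -- `Nat.card` is zero on infinite types, so `q > 0` makes the residue field finite.
  have hfin : Finite (residueField F) := by
    refine Nat.finite_of_card_ne_zero ?_
    exact_mod_cast hq0.ne'
  -- The residue classes are `q` disjoint translates of the open unit ball that fill the integers.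
  have hball : haarF F (Metric.ball 0 1) = (residueCard F : ℝ≥0∞)⁻¹ := by
    have := Fintype.ofFinite (residueField F)
    choose lift hlift using IsLocalRing.residue_surjective (R := ringOfIntegers F)
    have hU : Metric.closedBall (0 : F) 1 =
        ⋃ r : residueField F, (fun x => -(lift r : F) + x) ⁻¹' Metric.ball 0 1 := by
      ext x
      simp only [Metric.mem_closedBall, dist_zero_right, Set.mem_iUnion, Set.mem_preimage,
        Metric.mem_ball]
      constructor
      · intro hx
        refine ⟨IsLocalRing.residue (ringOfIntegers F) ⟨x, mem_ringOfIntegers.mpr hx⟩, ?_⟩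
        have := (residue_eq_zero_iff (-(lift (IsLocalRing.residue (ringOfIntegers F)
          ⟨x, mem_ringOfIntegers.mpr hx⟩)) + ⟨x, mem_ringOfIntegers.mpr hx⟩)).mp (by
            rw [map_add, map_neg, hlift]; simp)
        exact this
      · rintro ⟨r, hr⟩
        have h1 := mem_ringOfIntegers.mp (lift r).2
        have : x = lift r + (-(lift r : F) + x) := by ring
        rw [this]
        exact (IsUltrametricDist.norm_add_le_max _ _).trans (max_le h1 hr.le)
    have hd : Pairwise (Function.onFun Disjoint
        fun r : residueField F => (fun x => -(lift r : F) + x) ⁻¹' Metric.ball 0 1) := by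
      intro r s hrs
      rw [Function.onFun, Set.disjoint_left]
      intro x hr hs
      simp only [Set.mem_preimage, Metric.mem_ball, dist_zero_right] at hr hs
      apply hrs
      have h3 : ‖((lift r - lift s : ringOfIntegers F) : F)‖ < 1 := by
        have : ((lift r - lift s : ringOfIntegers F) : F)
          = (-(lift s : F) + x) - (-(lift r : F) + x) := by push_cast; ring
        rw [this, sub_eq_add_neg]
        refine (IsUltrametricDist.norm_add_le_max _ _).trans_lt (max_lt hs (by rwa [norm_neg]))
      have := (residue_eq_zero_iff _).mpr h3
      rw [map_sub, hlift, hlift, sub_eq_zero] at this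
      exact this
    have hm := measure_iUnion (μ := haarF F) hd fun r =>
      (measurable_const_add _) Metric.isOpen_ball.measurableSet
    rw [← hU, haarF_closedBall_one] at hm
    simp only [measure_preimage_add, tsum_fintype, Finset.sum_const, Finset.card_univ,
      nsmul_eq_mul] at hm
    rw [← Nat.card_eq_fintype_card] at hm
    exact ENNReal.eq_inv_of_mul_eq_one_left (by rw [mul_comm]; exact hm.symm)
  have hbc : Metric.ball (0 : F) 1 = Metric.closedBall 0 (residueCard F : ℝ)⁻¹ := by
    ext x
    simp only [Metric.mem_ball, Metric.mem_closedBall, dist_zero_right, ← hnorm]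
    exact ⟨hϖ.2 x, fun h => h.trans_lt hϖ.1⟩
  -- multiplication by `ϖ` divides volumes by `q`
  have hscale : ∀ r : ℝ, (residueCard F : ℝ≥0∞) * haarF F (Metric.closedBall 0 (r * (residueCard F : ℝ)⁻¹)) =
      haarF F (Metric.closedBall 0 r) := by
    let f : F → F := fun x => ϖ⁻¹ * x
    have hf : Measurable f := measurable_const_mul _
    -- This measure is translation invariant. It gives the integers mass one, since their preimage
    -- under `f` is the open unit ball of volume `q⁻¹`. Uniqueness of Haar measure then gives the
    -- scaling law.
    let ν : Measure F := (residueCard F : ℝ≥0∞) • (haarF F).map f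
    have hν : ∀ s, MeasurableSet s → ν s = (residueCard F : ℝ≥0∞) * haarF F (f ⁻¹' s) := by
      intro s hs
      simp [ν, Measure.map_apply hf hs]
    have hpre : ∀ r : ℝ, f ⁻¹' Metric.closedBall 0 r =
        Metric.closedBall 0 (r * (residueCard F : ℝ)⁻¹) := by
      intro r
      ext x
      simp only [f, Set.mem_preimage, Metric.mem_closedBall, dist_zero_right, norm_mul, norm_inv,
        hnorm]
      rw [inv_inv, le_mul_inv_iff₀ hq0, mul_comm]
    have : ν.IsAddLeftInvariant := by
      refine ⟨fun g => ?_⟩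
      ext s hs
      rw [Measure.map_apply (measurable_const_add g) hs, hν _ hs, hν _ (measurable_const_add g hs)]
      congr 1
      have : f ⁻¹' ((fun x => g + x) ⁻¹' s) = (fun x => ϖ * g + x) ⁻¹' (f ⁻¹' s) := by
        ext x
        simp [f, mul_add, h0]
      rw [this, measure_preimage_add]
    have hνh : ν = haarF F := by
      refine eq_haarF_of_isAddLeftInvariant ν ?_
      rw [hν _ Metric.isClosed_closedBall.measurableSet, hpre, one_mul, ← hbc, hball]
      exact ENNReal.mul_inv_cancel (by exact_mod_cast hq0.ne') (ENNReal.natCast_ne_top _)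
    intro r
    rw [← hpre, ← hν _ Metric.isClosed_closedBall.measurableSet, hνh]
  refine ⟨hq1, hnorm, hex, fun k => ?_⟩
  have hcast : (residueCard F : ℝ≥0∞) = ENNReal.ofReal (residueCard F : ℝ) := by simp
  induction k using Int.induction_on with
  | zero => simpa using haarF_closedBall_one
  | succ n ih =>
    rw [← hscale, zpow_add_one₀ hq0.ne', mul_inv_cancel_right₀ hq0.ne', ih, hcast,
      ← ENNReal.ofReal_mul hq0.le, mul_comm]
  | pred n ih =>
    rw [← hscale, ← zpow_sub_one₀ hq0.ne', hcast] at ih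
    rw [zpow_sub_one₀ hq0.ne'] at ih ⊢
    have h1 : ENNReal.ofReal ((residueCard F : ℝ) ^ (-(n : ℤ))) = ENNReal.ofReal (residueCard F : ℝ) *
        ENNReal.ofReal ((residueCard F : ℝ) ^ (-(n : ℤ)) * (residueCard F : ℝ)⁻¹) := by
      rw [← ENNReal.ofReal_mul hq0.le]
      congr 1
      field_simp
    rw [h1] at ih
    exact (ENNReal.mul_right_inj (by simpa using hq0.ne') ENNReal.ofReal_ne_top).mp ih

end FieldBasics

/-! ### Ultrametric estimates and integrals of additive characters over balls. -/

section Characters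

variable {F : Type*} [NontriviallyNormedField F] [IsUltrametricDist F] [ProperSpace F]
  [MeasurableSpace F] [BorelSpace F] {ϖ : F} {q : ℝ} {ψ : AddChar F Circle}

namespace IsNormalizedUniformizer

variable (h : IsNormalizedUniformizer ϖ q)

include h

lemma pos : 0 < q := one_pos.trans h.one_lt

lemma norm_zpow (k : ℤ) : ‖ϖ ^ k‖ = q ^ (-k) := by
  rw [_root_.norm_zpow, h.norm_eq, _root_.inv_zpow']

lemma ne_zero : ϖ ≠ 0 := norm_pos_iff.mp (h.norm_eq ▸ inv_pos.mpr h.pos)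

lemma zpow_le_zpow_iff {k l : ℤ} : q ^ k ≤ q ^ l ↔ k ≤ l := zpow_le_zpow_iff_right₀ h.one_lt

lemma zpow_inj {k l : ℤ} : q ^ k = q ^ l ↔ k = l := zpow_right_inj₀ h.pos h.one_lt.ne'

lemma haarF_real_closedBall (c : F) (k : ℤ) :
    (haarF F).real (Metric.closedBall c (q ^ k)) = q ^ k := by
  rw [measureReal_def, Measure.addHaar_closedBall_center, h.haarF_closedBall_zero,
    ENNReal.toReal_ofReal (zpow_nonneg h.pos.le _)]

end IsNormalizedUniformizer

lemma norm_add_le_iff_of_norm_le {x y : F} {r : ℝ} (hy : ‖y‖ ≤ r) : ‖x + y‖ ≤ r ↔ ‖x‖ ≤ r := by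
  constructor
  · intro hx
    have : x = (x + y) + -y := by ring
    rw [this]
    exact (IsUltrametricDist.norm_add_le_max _ _).trans (max_le hx (by rwa [norm_neg]))
  · exact fun hx => (IsUltrametricDist.norm_add_le_max _ _).trans (max_le hx hy)

lemma norm_sub_le_of_le {x y : F} {r : ℝ} (hx : ‖x‖ ≤ r) (hy : ‖y‖ ≤ r) : ‖x - y‖ ≤ r := by
  rw [sub_eq_add_neg]
  exact (IsUltrametricDist.norm_add_le_max _ _).trans (max_le hx (by rwa [norm_neg]))

lemma norm_add_le_of_le {x y : F} {r : ℝ} (hx : ‖x‖ ≤ r) (hy : ‖y‖ ≤ r) : ‖x + y‖ ≤ r :=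
  (IsUltrametricDist.norm_add_le_max _ _).trans (max_le hx hy)

lemma norm_add_eq_of_lt {x y : F} (hxy : ‖y‖ < ‖x‖) : ‖x + y‖ = ‖x‖ := by
  rw [IsUltrametricDist.norm_add_eq_max_of_norm_ne_norm hxy.ne', max_eq_left hxy.le]

lemma HasConductorIntegers.eq_one (hψc : HasConductorIntegers ψ) {x : F} (hx : ‖x‖ ≤ 1) :
    ψ x = 1 :=
  (hψc 1).mpr (by simp) x (by simpa using hx)

lemma HasConductorIntegers.exists_ne_one (hψc : HasConductorIntegers ψ) {y : F} (hy : 1 < ‖y‖) :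
    ∃ x : F, ‖x‖ ≤ ‖y‖ ∧ ψ x ≠ 1 := by
  have := mt (hψc y).mp (not_le.mpr hy)
  push Not at this
  exact this

/-- A function which a translation multiplies by a constant other than `1` has integral zero. -/
lemma integral_eq_zero_of_translate {G : Type*} [AddGroup G] [MeasurableSpace G] [MeasurableAdd G]
    (μ : Measure G) [μ.IsAddRightInvariant] {f : G → ℂ} {w : ℂ} (hw : w ≠ 1) (y : G)
    (hf : ∀ x, f (x + y) = w * f x) : ∫ x, f x ∂μ = 0 := by
  have h1 : ∫ x, f (x + y) ∂μ = ∫ x, f x ∂μ := integral_add_right_eq_self f y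
  simp only [hf, integral_const_mul] at h1
  have : (w - 1) * ∫ x, f x ∂μ = 0 := by rw [sub_mul, h1, one_mul, sub_self]
  exact (mul_eq_zero.mp this).resolve_left (sub_ne_zero.mpr hw)

lemma integral_ite_closedBall (h : IsNormalizedUniformizer ϖ q) (c : F) (k : ℤ) (w : ℂ) :
    ∫ x, (if ‖x - c‖ ≤ q ^ k then w else 0) ∂haarF F = q ^ k * w := by
  have : (fun x => if ‖x - c‖ ≤ q ^ k then w else 0) =
      (Metric.closedBall c (q ^ k)).indicator fun _ => w := by
    funext x
    classical
    simp only [Set.indicator_apply, Metric.mem_closedBall, dist_eq_norm]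
  rw [this, integral_indicator_const _ Metric.isClosed_closedBall.measurableSet,
    h.haarF_real_closedBall]
  simp

/-- The integral of `x ↦ ψ(l x)` over a ball. -/
lemma integral_ite_addChar (h : IsNormalizedUniformizer ϖ q) (hψc : HasConductorIntegers ψ)
    (c : F) (k : ℤ) (l : F) :
    ∫ x, (if ‖x - c‖ ≤ q ^ k then (ψ (l * x) : ℂ) else 0) ∂haarF F =
      if ‖l‖ ≤ q ^ (-k) then q ^ k * (ψ (l * c) : ℂ) else 0 := by
  split_ifs with hl
  · rw [← integral_ite_closedBall h c k (ψ (l * c) : ℂ)]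
    congr 1
    funext x
    split_ifs with hx
    · have : ψ (l * x) = ψ (l * (x - c)) * ψ (l * c) := by
        rw [← AddChar.map_add_eq_mul]; congr 1; ring
      rw [this, hψc.eq_one, one_mul]
      rw [norm_mul]
      calc ‖l‖ * ‖x - c‖ ≤ q ^ (-k) * q ^ k := by
            gcongr
            exact zpow_nonneg h.pos.le _
        _ = 1 := by rw [← zpow_add₀ h.pos.ne']; simp
    · rfl
  · have hl0 : l ≠ 0 := by
      rintro rfl
      exact hl (by rw [norm_zero]; exact zpow_nonneg h.pos.le _)
    have hy : 1 < ‖l * ϖ ^ (-k)‖ := by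
      rw [norm_mul, h.norm_zpow, neg_neg]
      rw [not_le, _root_.zpow_neg] at hl
      exact (inv_lt_iff_one_lt_mul₀ (zpow_pos h.pos _)).mp hl
    -- The translation by `l⁻¹ x` preserves the ball and multiplies the integrand by `ψ x ≠ 1`.
    obtain ⟨x, hx, hx1⟩ := hψc.exists_ne_one hy
    have hb : ‖l⁻¹ * x‖ ≤ q ^ k := by
      rw [norm_mul, norm_inv, inv_mul_le_iff₀ (norm_pos_iff.mpr hl0)]
      rwa [norm_mul, h.norm_zpow, neg_neg] at hx
    refine integral_eq_zero_of_translate _ (w := (ψ x : ℂ)) (by rwa [Ne, Circle.coe_eq_one]) (l⁻¹ * x)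
      fun z => ?_
    have h1 : z + l⁻¹ * x - c = z - c + l⁻¹ * x := by ring
    have h2 : ψ (l * (z + l⁻¹ * x)) = ψ x * ψ (l * z) := by
      rw [← AddChar.map_add_eq_mul]; congr 1; field_simp; ring
    simp only [h1, h2, norm_add_le_iff_of_norm_le hb]
    split_ifs <;> simp

lemma integral_ite_addChar_zero (h : IsNormalizedUniformizer ϖ q) (hψc : HasConductorIntegers ψ)
    (k : ℤ) (l : F) :
    ∫ x, (if ‖x‖ ≤ q ^ k then (ψ (l * x) : ℂ) else 0) ∂haarF F =
      if ‖l‖ ≤ q ^ (-k) then (q : ℂ) ^ k else 0 := by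
  simpa using integral_ite_addChar h hψc 0 k l

end Characters

/-! ### The sums `L(i, j)` and their recursion -/

section LevelSums

variable {F : Type*} [NontriviallyNormedField F] [IsUltrametricDist F] [ProperSpace F]
  [MeasurableSpace F] [BorelSpace F] {ϖ : F} {q : ℝ} {ψ : AddChar F Circle} {ρ a : F}

/-- The conditions on the coordinate `x` in the orbital integral of `ω(t)φ_∘` at level `κ`. -/
def LevelCond (q : ℝ) (ρ a : F) (e i j κ : ℤ) (x : F) : Prop :=
  ‖x‖ ≤ q ^ (κ + i) ∧ ‖a‖ ≤ q ^ (κ + i) ∧ ‖x‖ * ‖x - ρ ^ 2 * a‖ ≤ q ^ κ ∧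
    ‖x + a‖ ≤ q ^ (2 * e + j - i - κ)

open scoped Classical in
/-- The contribution of level `κ` to the orbital integral of `ω(t)φ_∘`. -/
def levelIntegral (q : ℝ) (ψ : AddChar F Circle) (ρ a : F) (e i j κ : ℤ) : ℂ :=
  ∫ x, (if LevelCond q ρ a e i j κ x then (ψ x : ℂ) else 0) ∂haarF F

/-- The normalized orbital integral of `ω(t)φ_∘` for `t = diag(ϖ^(i+j), ϖ^j, 1)`. -/
def levelSum (q : ℝ) (ψ : AddChar F Circle) (ρ a : F) (e i j : ℤ) : ℂ :=
  q ^ i * ∑ κ ∈ Finset.Icc (-2 * i) (2 * e + j), levelIntegral q ψ ρ a e i j κ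

/-- The difference `L(i, j) - q L(i - 1, j - 1)`. -/
def levelDiff (ψ : AddChar F Circle) (ρ a : F) (e i j : ℤ) : ℂ :=
  if 1 ≤ i + e then 1 + (ψ (-a) : ℂ) + (ψ (ρ ^ 2 * a) : ℂ)
  else ((max 0 (min 3 (2 * (i + e) + j + 1)) : ℤ) : ℂ)

variable (h : IsNormalizedUniformizer ϖ q) (hψc : HasConductorIntegers ψ)
  (hρ : IsPrimitiveRoot ρ 3) {e : ℤ} (he : ‖a‖ = q ^ e)

include hρ in
lemma norm_rho : ‖ρ‖ = 1 := by
  have := congrArg norm hρ.pow_eq_one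
  rw [norm_pow, norm_one] at this
  exact (pow_eq_one_iff_of_nonneg (norm_nonneg _) (by norm_num)).mp this

include hρ he in
lemma norm_rho_sq_mul : ‖ρ ^ 2 * a‖ = q ^ e := by
  rw [norm_mul, norm_pow, norm_rho hρ, he]; simp

include h hρ he in
lemma norm_sub_rho_sq_mul_of_lt {x : F} {t : ℤ} (hx : ‖x‖ = q ^ t) (ht : e < t) :
    ‖x - ρ ^ 2 * a‖ = q ^ t := by
  rw [sub_eq_add_neg, norm_add_eq_of_lt, hx]
  rw [norm_neg, norm_rho_sq_mul hρ he, hx]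
  exact zpow_lt_zpow_right₀ h.one_lt ht

include h hρ he in
lemma levelCond_pred {i j κ : ℤ} (h1 : -2 * i + 2 ≤ κ) (h2 : κ ≠ e - i) (x : F) :
    LevelCond q ρ a e i j κ x ↔ LevelCond q ρ a e (i - 1) (j - 1) κ x := by
  have hr : 2 * e + (j - 1) - (i - 1) - κ = 2 * e + j - i - κ := by ring
  simp only [LevelCond, hr, he, h.zpow_le_zpow_iff]
  constructor
  · rintro ⟨hx, ha, hp, hy⟩
    refine ⟨?_, by omega, hp, hy⟩
    by_cases hx0 : x = 0
    · rw [hx0, norm_zero]; exact zpow_nonneg h.pos.le _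
    obtain ⟨t, ht⟩ := h.exists_zpow x hx0
    rw [ht] at hx hp ⊢
    rw [h.zpow_le_zpow_iff] at hx ⊢
    by_contra hlt
    rw [norm_sub_rho_sq_mul_of_lt h hρ he ht (by omega), ← zpow_add₀ h.pos.ne',
      h.zpow_le_zpow_iff] at hp
    omega
  · rintro ⟨hx, ha, hp, hy⟩
    exact ⟨hx.trans ((h.zpow_le_zpow_iff).mpr (by omega)), by omega, hp, hy⟩

include h hρ he in
lemma levelIntegral_pred {i j κ : ℤ} (h1 : -2 * i + 2 ≤ κ) (h2 : κ ≠ e - i) :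
    levelIntegral q ψ ρ a e i j κ = levelIntegral q ψ ρ a e (i - 1) (j - 1) κ := by
  unfold levelIntegral
  congr! 3
  exact levelCond_pred h hρ he h1 h2 _

include h he in
lemma levelIntegral_of_lt {i j κ : ℤ} (hκ : κ < e - i) : levelIntegral q ψ ρ a e i j κ = 0 := by
  have : ∀ x, ¬ LevelCond q ρ a e i j κ x := by
    rintro x ⟨-, ha, -⟩
    rw [he, h.zpow_le_zpow_iff] at ha
    omega
  simp [levelIntegral, this]

include h hψc in
lemma integral_ite_ball_addChar (c : F) {k : ℤ} (hk : k ≤ 0) :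
    ∫ x, (if ‖x - c‖ ≤ q ^ k then (ψ x : ℂ) else 0) ∂haarF F = q ^ k * (ψ c : ℂ) := by
  have := integral_ite_addChar h hψc c k 1
  simp only [one_mul, norm_one] at this
  rw [this, if_pos]
  exact one_le_zpow₀ h.one_lt.le (by omega)

include h hψc hρ he in
-- At these levels the conditions cut out exactly the ball of radius `q ^ (-i)`, on which `ψ` is
-- trivial. At the two lowest levels the product condition forces this: a norm `q ^ t` with `t > -i`
-- would give `2 * t ≤ -2 * i + 1`. At the top level the bound on `x + a` forces it.
lemma levelIntegral_of_le {i j κ : ℤ} (hi : 0 ≤ i) (hei : e ≤ -i) (h1 : -2 * i ≤ κ)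
    (h2 : κ ≤ 2 * e + j) (h3 : κ ≤ -2 * i + 1 ∨ κ = 2 * e + j) :
    levelIntegral q ψ ρ a e i j κ = q ^ (-i) := by
  have ha : ‖a‖ ≤ q ^ (-i) := by rwa [he, h.zpow_le_zpow_iff]
  have hc : ∀ x, LevelCond q ρ a e i j κ x ↔ ‖x - 0‖ ≤ q ^ (-i) := by
    intro x
    rw [sub_zero]
    constructor
    · rintro ⟨-, -, hp, hy⟩
      rcases h3 with h3 | h3
      · by_cases hx0 : x = 0
        · rw [hx0, norm_zero]; exact zpow_nonneg h.pos.le _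
        obtain ⟨t, ht⟩ := h.exists_zpow x hx0
        rw [ht, h.zpow_le_zpow_iff]
        by_contra hlt
        rw [norm_sub_rho_sq_mul_of_lt h hρ he ht (by omega), ht, ← zpow_add₀ h.pos.ne',
          h.zpow_le_zpow_iff] at hp
        omega
      · rw [show 2 * e + j - i - κ = -i by omega] at hy
        exact (norm_add_le_iff_of_norm_le ha).mp hy
    · intro hx
      have hr : ‖ρ ^ 2 * a‖ ≤ q ^ (-i) := by rwa [norm_rho_sq_mul hρ he, h.zpow_le_zpow_iff]
      refine ⟨hx.trans (h.zpow_le_zpow_iff.mpr (by omega)),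
        ha.trans (h.zpow_le_zpow_iff.mpr (by omega)), ?_,
        (norm_add_le_of_le hx ha).trans (h.zpow_le_zpow_iff.mpr (by omega))⟩
      calc ‖x‖ * ‖x - ρ ^ 2 * a‖ ≤ q ^ (-i) * q ^ (-i) := by
            gcongr
            · exact zpow_nonneg h.pos.le _
            · exact norm_sub_le_of_le hx hr
        _ ≤ q ^ κ := by
            rw [← zpow_add₀ h.pos.ne', h.zpow_le_zpow_iff]; omega
  simp only [levelIntegral, hc]
  have := integral_ite_ball_addChar h hψc 0 (k := -i) (by omega)
  rw [AddChar.map_zero_eq_one, Circle.coe_one, mul_one] at this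
  rw [← this]

include h hψc hρ he in
open scoped Classical in
-- Both `x` and `x - ρ ^ 2 * a` have norm at most `q ^ e`, and one of them attains it. The product
-- condition then puts the other in the ball of radius `q ^ (-i)`. The domain is the union of two
-- disjoint balls, around `0` and around `ρ ^ 2 * a`.
lemma levelIntegral_bottom {i j : ℤ} (hi : 0 ≤ i) (hj : 0 ≤ j) (hei : 1 ≤ i + e) :
    levelIntegral q ψ ρ a e i j (e - i) = q ^ (-i) * (1 + (ψ (ρ ^ 2 * a) : ℂ)) := by
  have hlt : q ^ (-i) < q ^ e := zpow_lt_zpow_right₀ h.one_lt (by omega)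
  have hr := norm_rho_sq_mul hρ he
  have hx1 : ∀ x : F, ‖x‖ < q ^ e → ‖x - ρ ^ 2 * a‖ = q ^ e := by
    intro x hx
    rw [← norm_neg, neg_sub, sub_eq_add_neg, norm_add_eq_of_lt, hr]
    rwa [norm_neg, hr]
  have hx2 : ∀ x : F, ‖x - ρ ^ 2 * a‖ < q ^ e → ‖x‖ = q ^ e := by
    intro x hx
    have : x = ρ ^ 2 * a + (x - ρ ^ 2 * a) := by ring
    rw [this, norm_add_eq_of_lt, hr]
    rwa [hr]
  have hqe : 0 < q ^ e := zpow_pos h.pos _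
  have hpow : q ^ (e - i) = q ^ e * q ^ (-i) := by rw [← zpow_add₀ h.pos.ne']; rfl
  have hc : ∀ x, (if LevelCond q ρ a e i j (e - i) x then (ψ x : ℂ) else 0) =
      (if ‖x - 0‖ ≤ q ^ (-i) then (ψ x : ℂ) else 0) +
        (if ‖x - ρ ^ 2 * a‖ ≤ q ^ (-i) then (ψ x : ℂ) else 0) := by
    intro x
    rw [sub_zero]
    have hy : ‖x‖ ≤ q ^ e → ‖x + a‖ ≤ q ^ (2 * e + j - i - (e - i)) := fun hx =>
      (norm_add_le_of_le hx he.le).trans (h.zpow_le_zpow_iff.mpr (by omega))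
    by_cases c1 : ‖x‖ ≤ q ^ (-i)
    · have c3 := hx1 x (c1.trans_lt hlt)
      rw [if_pos c1, if_neg (show ¬‖x - ρ ^ 2 * a‖ ≤ q ^ (-i) by rw [c3]; exact not_le.mpr hlt), add_zero, if_pos]
      refine ⟨by simpa using c1.trans hlt.le, by simpa using he.le, ?_, hy (c1.trans hlt.le)⟩
      rw [c3, hpow, mul_comm]
      gcongr
    · rw [if_neg c1, zero_add]
      by_cases c2 : ‖x - ρ ^ 2 * a‖ ≤ q ^ (-i)
      · have c3 := hx2 x (c2.trans_lt hlt)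
        rw [if_pos c2, if_pos]
        refine ⟨by simpa using c3.le, by simpa using he.le, ?_, hy c3.le⟩
        rw [c3, hpow]
        gcongr
      · rw [if_neg c2, if_neg]
        rintro ⟨hx, -, hp, -⟩
        rw [sub_add_cancel] at hx
        rcases hx.lt_or_eq with hx | hx
        · rw [hx1 x hx, hpow, mul_comm] at hp
          exact c1 (le_of_mul_le_mul_left hp hqe)
        · rw [hx, hpow] at hp
          exact c2 (le_of_mul_le_mul_left hp hqe)
  -- A non-integrable function would have integral zero by convention, whereas the computed value is
  -- nonzero.
  have hint : ∀ c : F, Integrable (fun x => if ‖x - c‖ ≤ q ^ (-i) then (ψ x : ℂ) else 0)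
      (haarF F) := by
    intro c
    by_contra hn
    have h1 := integral_ite_ball_addChar h hψc c (k := -i) (by omega)
    rw [integral_undef hn] at h1
    exact (mul_ne_zero (zpow_ne_zero _ (by exact_mod_cast h.pos.ne')) (Circle.coe_ne_zero _)) h1.symm
  have hc' := funext hc
  rw [levelIntegral]
  refine (congrArg (fun f => ∫ x, f x ∂haarF F) (Eq.trans ?_ hc')).trans ?_
  · funext x; congr!
  · change ∫ x, _ + _ ∂haarF F = _
    rw [integral_add (hint 0) (hint _), integral_ite_ball_addChar h hψc _ (by omega),
      integral_ite_ball_addChar h hψc _ (by omega)]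
    simp
    ring

include h hψc hρ he in
-- The last condition confines `x` to the ball of radius `q ^ (-i)` around `-a`, and there the other
-- conditions hold automatically.
lemma levelIntegral_top {i j : ℤ} (hi : 0 ≤ i) (hj : 0 ≤ j) (hei : 1 ≤ i + e) :
    levelIntegral q ψ ρ a e i j (2 * e + j) = q ^ (-i) * (ψ (-a) : ℂ) := by
  have hlt : q ^ (-i) < q ^ e := zpow_lt_zpow_right₀ h.one_lt (by omega)
  have hc : ∀ x, LevelCond q ρ a e i j (2 * e + j) x ↔ ‖x - -a‖ ≤ q ^ (-i) := by
    intro x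
    rw [sub_neg_eq_add]
    constructor
    · rintro ⟨-, -, -, hy⟩
      rwa [show 2 * e + j - i - (2 * e + j) = -i by omega] at hy
    · intro hx
      have hxe : ‖x‖ ≤ q ^ e := (norm_add_le_iff_of_norm_le he.le).mp (hx.trans hlt.le)
      refine ⟨hxe.trans (h.zpow_le_zpow_iff.mpr (by omega)),
        he.le.trans (h.zpow_le_zpow_iff.mpr (by omega)), ?_, ?_⟩
      · calc ‖x‖ * ‖x - ρ ^ 2 * a‖ ≤ q ^ e * q ^ e := by
              refine mul_le_mul hxe ?_ (norm_nonneg _) (zpow_nonneg h.pos.le _)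
              exact norm_sub_le_of_le hxe (norm_rho_sq_mul hρ he).le
          _ ≤ q ^ (2 * e + j) := by rw [← zpow_add₀ h.pos.ne', h.zpow_le_zpow_iff]; omega
      · rwa [show 2 * e + j - i - (2 * e + j) = -i by omega]
  simp only [levelIntegral, hc]
  rw [← integral_ite_ball_addChar h hψc (-a) (k := -i) (by omega)]

include h hψc hρ he in
-- Passing to `(i - 1, j - 1)` drops the levels `-2i`, `-2i + 1` and `2e + j`. The remaining levels
-- are unchanged by `levelIntegral_pred`, apart from `κ = e - i`. When `i + e ≥ 1` the levels below
-- `e - i` vanish, so the difference comes from the levels `e - i` and `2e + j`. When `i + e ≤ 0`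
-- each dropped level contributes one after normalization, and `levelDiff` counts them.
lemma levelSum_eq {i j : ℤ} (hi : 0 ≤ i) (hj : 0 ≤ j) :
    levelSum q ψ ρ a e i j =
      q * levelSum q ψ ρ a e (i - 1) (j - 1) + levelDiff ψ ρ a e i j := by
  have hq0 : (q : ℂ) ≠ 0 := by exact_mod_cast h.pos.ne'
  have hqi : (q : ℂ) ^ i * q ^ (-i) = 1 := by rw [← zpow_add₀ hq0]; simp
  have hqq : (q : ℂ) * q ^ (i - 1) = q ^ i := by
    rw [mul_comm, ← zpow_add_one₀ hq0, sub_add_cancel]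
  have e1 : Finset.Icc (-2 * (i - 1)) (2 * e + (j - 1)) =
      Finset.Icc (-2 * i + 2) (2 * e + j - 1) := by congr 1 <;> ring
  simp only [levelSum, levelDiff]
  rw [← mul_assoc, hqq, e1]
  split_ifs with hei
  · have s1 : ∑ κ ∈ Finset.Icc (-2 * i) (2 * e + j), levelIntegral q ψ ρ a e i j κ =
        ∑ κ ∈ Finset.Icc (e - i) (2 * e + j), levelIntegral q ψ ρ a e i j κ := by
      symm
      apply Finset.sum_subset
      · intro κ; simp only [Finset.mem_Icc]; omega
      · intro κ; simp only [Finset.mem_Icc]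
        exact fun _ _ => levelIntegral_of_lt h he (by omega)
    have s2 : ∑ κ ∈ Finset.Icc (-2 * i + 2) (2 * e + j - 1),
          levelIntegral q ψ ρ a e (i - 1) (j - 1) κ =
        ∑ κ ∈ Finset.Icc (e - i + 1) (2 * e + j - 1), levelIntegral q ψ ρ a e i j κ := by
      trans ∑ κ ∈ Finset.Icc (e - i + 1) (2 * e + j - 1),
          levelIntegral q ψ ρ a e (i - 1) (j - 1) κ
      · symm
        apply Finset.sum_subset
        · intro κ; simp only [Finset.mem_Icc]; omega
        · intro κ; simp only [Finset.mem_Icc]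
          exact fun _ _ => levelIntegral_of_lt h he (by omega)
      · refine Finset.sum_congr rfl fun κ hκ => (levelIntegral_pred h hρ he ?_ ?_).symm <;>
          · simp only [Finset.mem_Icc] at hκ; omega
    have s3 : Finset.Icc (e - i) (2 * e + j) =
        insert (e - i) (insert (2 * e + j) (Finset.Icc (e - i + 1) (2 * e + j - 1))) := by
      ext κ; simp only [Finset.mem_Icc, Finset.mem_insert]; omega
    rw [s1, s2, s3, Finset.sum_insert (by simp only [Finset.mem_Icc, Finset.mem_insert]; omega),
      Finset.sum_insert (by simp only [Finset.mem_Icc]; omega),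
      levelIntegral_bottom h hψc hρ he hi hj hei, levelIntegral_top h hψc hρ he hi hj hei]
    linear_combination (1 + (ψ (-a) : ℂ) + (ψ (ρ ^ 2 * a) : ℂ)) * hqi
  · have hv : ∀ κ, -2 * i ≤ κ → κ ≤ 2 * e + j → (κ ≤ -2 * i + 1 ∨ κ = 2 * e + j) →
        levelIntegral q ψ ρ a e i j κ = q ^ (-i) := fun κ h1 h2 h3 =>
      levelIntegral_of_le h hψc hρ he hi (by omega) h1 h2 h3
    -- The interval of levels may contain none, one, two, or at least three elements. Only in the
    -- last case are the three extreme levels distinct.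
    rcases lt_or_ge (2 * e + j) (-2 * i) with c | c
    · rw [Finset.Icc_eq_empty (by omega), Finset.Icc_eq_empty (by omega),
        show max 0 (min 3 (2 * (i + e) + j + 1)) = 0 by omega]
      simp
    rcases eq_or_lt_of_le c with c | c
    · rw [← c, Finset.Icc_self, Finset.Icc_eq_empty (by omega), Finset.sum_singleton,
        hv _ (by omega) (by omega) (by omega),
        show max 0 (min 3 (2 * (i + e) + j + 1)) = 1 by omega, hqi]
      simp
    rcases eq_or_lt_of_le (show -2 * i + 1 ≤ 2 * e + j by omega) with c' | c'
    · rw [show Finset.Icc (-2 * i) (2 * e + j) = {-2 * i, -2 * i + 1} by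
          ext κ; simp only [Finset.mem_Icc, Finset.mem_insert, Finset.mem_singleton]; omega,
        Finset.Icc_eq_empty (by omega), Finset.sum_pair (by omega),
        hv _ (by omega) (by omega) (by omega), hv _ (by omega) (by omega) (by omega),
        show max 0 (min 3 (2 * (i + e) + j + 1)) = 2 by omega, mul_add, hqi]
      norm_num
    · have s2 : ∑ κ ∈ Finset.Icc (-2 * i + 2) (2 * e + j - 1),
            levelIntegral q ψ ρ a e (i - 1) (j - 1) κ =
          ∑ κ ∈ Finset.Icc (-2 * i + 2) (2 * e + j - 1), levelIntegral q ψ ρ a e i j κ := by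
        refine Finset.sum_congr rfl fun κ hκ => (levelIntegral_pred h hρ he ?_ ?_).symm <;>
          · simp only [Finset.mem_Icc] at hκ; omega
      have s3 : Finset.Icc (-2 * i) (2 * e + j) = insert (-2 * i) (insert (-2 * i + 1)
          (insert (2 * e + j) (Finset.Icc (-2 * i + 2) (2 * e + j - 1)))) := by
        ext κ; simp only [Finset.mem_Icc, Finset.mem_insert]; omega
      rw [s2, s3, Finset.sum_insert (by simp only [Finset.mem_Icc, Finset.mem_insert]; omega),
        Finset.sum_insert (by simp only [Finset.mem_Icc, Finset.mem_insert]; omega),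
        Finset.sum_insert (by simp only [Finset.mem_Icc]; omega),
        hv _ (by omega) (by omega) (by omega), hv _ (by omega) (by omega) (by omega),
        hv _ (by omega) (by omega) (by omega),
        show max 0 (min 3 (2 * (i + e) + j + 1)) = 3 by omega]
      push_cast
      linear_combination 3 * hqi

end LevelSums

/-! ### Whittaker coefficients of double cosets -/

section Whittaker

variable {F : Type*} [NontriviallyNormedField F] [IsUltrametricDist F] [ProperSpace F]
  [MeasurableSpace F] [BorelSpace F] {ϖ : F} {q : ℝ} {ψ : AddChar F Circle}

variable (F) in
/-- The product measure on `F³`. -/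
def haarF3 : Measure (F × F × F) := (haarF F).prod ((haarF F).prod (haarF F))

instance : IsFiniteMeasureOnCompacts (haarF3 F) := by unfold haarF3; infer_instance

open scoped Classical in
lemma integrable_ite_of_bounded {X : Type*} [NormedAddCommGroup X] [ProperSpace X]
    [MeasurableSpace X] [BorelSpace X] (μ : Measure X) [IsFiniteMeasureOnCompacts μ] {P : X → Prop}
    (hP : MeasurableSet {x | P x}) {R : ℝ} (hR : ∀ x, P x → ‖x‖ ≤ R) {f : X → ℂ}
    (hf : Continuous f) : Integrable (fun x => if P x then f x else 0) μ := by
  have h1 : IntegrableOn f {x | P x} μ :=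
    (hf.continuousOn.integrableOn_compact (isCompact_closedBall (0 : X) R)).mono_set
      fun x hx => by simpa using hR x hx
  have h2 := (integrable_indicator_iff hP).mpr h1
  refine h2.congr (Filter.Eventually.of_forall fun x => ?_)
  simp [Set.indicator_apply]

lemma integral_haarF3 {f : F × F × F → ℂ} (hf : Integrable f (haarF3 F)) :
    ∫ p, f p ∂haarF3 F = ∫ x, ∫ y, ∫ z, f (x, y, z) ∂haarF F ∂haarF F ∂haarF F := by
  rw [haarF3] at hf ⊢
  rw [integral_prod _ hf]
  refine integral_congr_ae ?_
  filter_upwards [hf.prod_right_ae] with x hx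
  exact integral_prod _ hx

/-- The conditions bounding the entries and the `2 × 2` minors of `u diag(ϖ^(i+j), ϖ^j, 1)`. -/
def CellBound (q : ℝ) (i j r l : ℤ) (p : F × F × F) : Prop :=
  max 1 (max (q ^ (-j) * ‖p.1‖) (max ‖p.2.1‖ ‖p.2.2‖)) ≤ q ^ r ∧
    max 1 (max ‖p.1‖ (max (q ^ (-i) * ‖p.2.1‖) ‖p.1 * p.2.1 - p.2.2‖)) ≤ q ^ l

lemma measurableSet_cellBound (i j r l : ℤ) :
    MeasurableSet {p : F × F × F | CellBound q i j r l p} := by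
  have c1 : Continuous fun p : F × F × F =>
    max 1 (max (q ^ (-j) * ‖p.1‖) (max ‖p.2.1‖ ‖p.2.2‖)) := by fun_prop
  have c2 : Continuous fun p : F × F × F =>
    max 1 (max ‖p.1‖ (max (q ^ (-i) * ‖p.2.1‖) ‖p.1 * p.2.1 - p.2.2‖)) := by fun_prop
  exact ((isClosed_le c1 continuous_const).inter (isClosed_le c2 continuous_const)).measurableSet

lemma CellBound.norm_le {i j r l : ℤ} {p : F × F × F} (hp : CellBound q i j r l p) :
    ‖p‖ ≤ max (q ^ r) (q ^ l) := by
  simp only [CellBound, max_le_iff] at hp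
  rw [Prod.norm_def, Prod.norm_def]
  exact max_le (hp.2.2.1.trans (le_max_right _ _))
    (max_le (hp.1.2.2.1.trans (le_max_left _ _)) (hp.1.2.2.2.trans (le_max_left _ _)))

open scoped Classical in
/-- The integral of `ψ(-x-y)` over the points of `N` with bounded entries and minors. -/
def cellBoundIntegral (q : ℝ) (ψ : AddChar F Circle) (i j r l : ℤ) : ℂ :=
  ∫ p : F × F × F, (if CellBound q i j r l p then (ψ (-p.1 - p.2.1) : ℂ) else 0) ∂haarF3 F

variable (h : IsNormalizedUniformizer ϖ q) (hψ : Continuous ψ) (hψc : HasConductorIntegers ψ)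

include hψ in
open scoped Classical in
lemma integrable_cellBound (i j r l : ℤ) : Integrable (fun p : F × F × F =>
    if CellBound q i j r l p then (ψ (-p.1 - p.2.1) : ℂ) else 0) (haarF3 F) :=
  integrable_ite_of_bounded _ (measurableSet_cellBound i j r l) (fun _ hp => hp.norm_le)
    (by fun_prop)

include h in
lemma cellBoundIntegral_of_neg {i j r l : ℤ} (hrl : r < 0 ∨ l < 0) :
    cellBoundIntegral q ψ i j r l = 0 := by
  have : ∀ p : F × F × F, ¬ CellBound q i j r l p := by
    rintro p ⟨h1, h2⟩
    have h1 := (le_max_left _ _).trans h1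
    have h2 := (le_max_left _ _).trans h2
    rw [← zpow_zero q, h.zpow_le_zpow_iff] at h1 h2
    omega
  simp [cellBoundIntegral, this]

include h in
-- The variable `z` must lie in a ball around `0` and in a ball around `x * y`. Ultrametric balls
-- are nested or disjoint: these meet exactly when `‖x * y‖` is at most the larger radius, and their
-- intersection is then the smaller ball.
lemma cellBound_iff {i j r l : ℤ} (hr : 0 ≤ r) (hl : 0 ≤ l) (x y z : F) :
    CellBound q i j r l (x, y, z) ↔ (‖x‖ ≤ q ^ min l (r + j) ∧
      (‖y‖ ≤ q ^ min r (l + i) ∧ ‖x‖ * ‖y‖ ≤ q ^ max r l) ∧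
        ‖z - (if r ≤ l then 0 else x * y)‖ ≤ q ^ min r l) := by
  have hm : ∀ (t : ℝ) (k k' : ℤ), t ≤ q ^ min k k' ↔ t ≤ q ^ k ∧ t ≤ q ^ k' := by
    intro t k k'
    rcases le_total k k' with hk | hk
    · rw [min_eq_left hk]
      exact ⟨fun ht => ⟨ht, ht.trans (h.zpow_le_zpow_iff.mpr hk)⟩, And.left⟩
    · rw [min_eq_right hk]
      exact ⟨fun ht => ⟨ht.trans (h.zpow_le_zpow_iff.mpr hk), ht⟩, And.right⟩
  have hs : ∀ (t : ℝ) (k k' : ℤ), q ^ (-k) * t ≤ q ^ k' ↔ t ≤ q ^ (k' + k) := by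
    intro t k k'
    rw [_root_.zpow_neg, inv_mul_le_iff₀ (zpow_pos h.pos _), ← zpow_add₀ h.pos.ne', add_comm]
  have h1r : 1 ≤ q ^ r := one_le_zpow₀ h.one_lt.le hr
  have h1l : 1 ≤ q ^ l := one_le_zpow₀ h.one_lt.le hl
  simp only [CellBound, max_le_iff, hm, hs, h1r, h1l, true_and, ← norm_mul]
  have key : (‖z‖ ≤ q ^ r ∧ ‖x * y - z‖ ≤ q ^ l) ↔ (‖x * y‖ ≤ q ^ max r l ∧
      ‖z - (if r ≤ l then 0 else x * y)‖ ≤ q ^ r ∧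
        ‖z - (if r ≤ l then 0 else x * y)‖ ≤ q ^ l) := by
    split_ifs with hrl
    · rw [sub_zero, max_eq_right hrl]
      have hrl' : q ^ r ≤ q ^ l := h.zpow_le_zpow_iff.mpr hrl
      constructor
      · rintro ⟨h1, h2⟩
        refine ⟨?_, h1, h1.trans hrl'⟩
        have := norm_add_le_of_le h2 (h1.trans hrl')
        rwa [sub_add_cancel] at this
      · rintro ⟨h1, h2, h3⟩
        exact ⟨h2, norm_sub_le_of_le h1 h3⟩
    · rw [max_eq_left (not_le.mp hrl).le]
      have hrl' : q ^ l ≤ q ^ r := h.zpow_le_zpow_iff.mpr (not_le.mp hrl).le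
      rw [norm_sub_rev z]
      constructor
      · rintro ⟨h1, h2⟩
        refine ⟨?_, h2.trans hrl', h2⟩
        have := norm_add_le_of_le (h2.trans hrl') h1
        rwa [sub_add_cancel] at this
      · rintro ⟨h1, h2, h3⟩
        refine ⟨?_, h3⟩
        have := norm_sub_le_of_le h1 h2
        rwa [sub_sub_cancel] at this
  constructor
  · rintro ⟨⟨a1, a2, a3⟩, a4, a5, a6⟩
    have := key.mp ⟨a3, a6⟩
    tauto
  · rintro ⟨⟨a1, a2⟩, ⟨⟨a3, a4⟩, a5⟩, a6⟩
    have := key.mpr ⟨a5, a6⟩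
    tauto

include h hψ in
/-- The integration over `z`. -/
lemma cellBoundIntegral_eq_double {i j r l : ℤ} (hr : 0 ≤ r) (hl : 0 ≤ l) :
    cellBoundIntegral q ψ i j r l = q ^ min r l *
      ∫ x, (if ‖x‖ ≤ q ^ min l (r + j) then (ψ (-1 * x) : ℂ) * ∫ y,
        (if ‖y‖ ≤ q ^ min r (l + i) ∧ ‖x‖ * ‖y‖ ≤ q ^ max r l then (ψ (-1 * y) : ℂ) else 0)
          ∂haarF F else 0) ∂haarF F := by
  rw [cellBoundIntegral, integral_haarF3 (integrable_cellBound hψ i j r l), ← integral_const_mul]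
  congr 1
  funext x
  simp only [cellBound_iff h hr hl]
  by_cases hx : ‖x‖ ≤ q ^ min l (r + j)
  · rw [if_pos hx, ← mul_assoc, ← integral_const_mul]
    congr 1
    funext y
    by_cases hy : ‖y‖ ≤ q ^ min r (l + i) ∧ ‖x‖ * ‖y‖ ≤ q ^ max r l
    · have := integral_ite_closedBall h (if r ≤ l then 0 else x * y) (min r l)
        (ψ (-x - y) : ℂ)
      simp only [hx, hy, true_and]
      refine Eq.trans ?_ (this.trans ?_)
      · congr! 2
      · simp only [if_true]
        have h2 : ψ (-x - y) = ψ (-1 * x) * ψ (-1 * y) := by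
          rw [← AddChar.map_add_eq_mul]; congr 1; ring
        rw [h2, Circle.coe_mul]
        ring
    · simp [hy]
  · simp [hx]

include h hψ hψc in
-- Here `y` is integral and the bound on `‖x‖ * ‖y‖` is automatic. The integral over `y` is one, and
-- a character integral over a ball in `x` is left.
lemma cellBoundIntegral_of_min_eq_zero {i j r l : ℤ} (hr : 0 ≤ r) (hl : 0 ≤ l) (hj : 0 ≤ j)
    (hi : 0 ≤ i) (h0 : min r (l + i) = 0) :
    cellBoundIntegral q ψ i j r l = if min l (r + j) = 0 then 1 else 0 := by
  have hy : ∀ x : F, ‖x‖ ≤ q ^ min l (r + j) → ∫ y, (if ‖y‖ ≤ q ^ min r (l + i) ∧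
      ‖x‖ * ‖y‖ ≤ q ^ max r l then (ψ (-1 * y) : ℂ) else 0) ∂haarF F = 1 := by
    intro x hx
    have : ∀ y : F, (‖y‖ ≤ q ^ min r (l + i) ∧ ‖x‖ * ‖y‖ ≤ q ^ max r l) ↔ ‖y‖ ≤ q ^ (0 : ℤ) := by
      intro y
      rw [h0, and_iff_left_iff_imp]
      intro hy
      calc ‖x‖ * ‖y‖ ≤ q ^ min l (r + j) * q ^ (0 : ℤ) := by
            gcongr; exact zpow_nonneg h.pos.le _
        _ ≤ q ^ max r l := by
          rw [← zpow_add₀ h.pos.ne', h.zpow_le_zpow_iff]; omega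
    simp only [this]
    rw [integral_ite_addChar_zero h hψc]
    simp
  rw [cellBoundIntegral_eq_double h hψ hr hl]
  have hx : ∀ x : F, (if ‖x‖ ≤ q ^ min l (r + j) then (ψ (-1 * x) : ℂ) * ∫ y,
        (if ‖y‖ ≤ q ^ min r (l + i) ∧ ‖x‖ * ‖y‖ ≤ q ^ max r l then (ψ (-1 * y) : ℂ) else 0)
          ∂haarF F else 0) = if ‖x‖ ≤ q ^ min l (r + j) then (ψ (-1 * x) : ℂ) else 0 := by
    intro x
    split_ifs with c
    · rw [hy x c, mul_one]
    · rfl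
  simp only [hx]
  rw [integral_ite_addChar_zero h hψc, show min r l = 0 by omega, zpow_zero, one_mul, norm_neg,
    norm_one, ← zpow_zero q]
  simp only [h.zpow_le_zpow_iff]
  by_cases c : min l (r + j) = 0
  · rw [c]; simp
  · rw [if_neg c, if_neg (by omega)]

include h hψ hψc in
-- When `‖x‖ < q ^ max r l`, the domain of `y` is stable under a translation by some `y₀` of norm at
-- most `q` with `ψ y₀ ≠ 1`, so the integral over `y` vanishes. What survives is the sphere `‖x‖ = q
-- ^ max r l`, which is nonempty in the domain only if `r ≤ l ≤ r + j`. On it `y` is integral. The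
-- character integral over a sphere of radius `q ^ l` is `-1` for `l = 1` and zero for `l ≥ 2`; the
-- factor `q` is the volume in `z`.
lemma cellBoundIntegral_of_one_le {i j r l : ℤ} (hr : 0 ≤ r) (hl : 0 ≤ l) (hj : 0 ≤ j)
    (h1 : 1 ≤ min r (l + i)) :
    cellBoundIntegral q ψ i j r l = if r = 1 ∧ l = 1 then -(q : ℂ) else 0 := by
  have hq1 : q ^ (max r l - 1) < q ^ max r l := zpow_lt_zpow_right₀ h.one_lt (by omega)
  have hy : ∀ x : F, ∫ y, (if ‖y‖ ≤ q ^ min r (l + i) ∧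
      ‖x‖ * ‖y‖ ≤ q ^ max r l then (ψ (-1 * y) : ℂ) else 0) ∂haarF F =
      if ‖x‖ ≤ q ^ (max r l - 1) then 0 else ∫ y, (if ‖y‖ ≤ q ^ min r (l + i) ∧
      ‖x‖ * ‖y‖ ≤ q ^ max r l then (ψ (-1 * y) : ℂ) else 0) ∂haarF F := by
    intro x
    split_ifs with hx
    · obtain ⟨y₀, hy₀, hne⟩ := hψc.exists_ne_one (y := ϖ ^ (-1 : ℤ)) (by
        rw [h.norm_zpow]; simpa using h.one_lt)
      rw [h.norm_zpow, neg_neg] at hy₀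
      have hxy : ‖x * y₀‖ ≤ q ^ max r l := by
        rw [norm_mul]
        calc ‖x‖ * ‖y₀‖ ≤ q ^ (max r l - 1) * q ^ (1 : ℤ) := by
              gcongr; exact zpow_nonneg h.pos.le _
          _ = q ^ max r l := by rw [← zpow_add₀ h.pos.ne', sub_add_cancel]
      refine integral_eq_zero_of_translate _ (w := ((ψ y₀)⁻¹ : Circle)) ?_ y₀ fun y => ?_
      · rw [Ne, Circle.coe_eq_one, inv_eq_one]
        exact hne
      · have h2 : ψ (-1 * (y + y₀)) = (ψ y₀)⁻¹ * ψ (-1 * y) := by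
          rw [← AddChar.map_neg_eq_inv, ← AddChar.map_add_eq_mul]; congr 1; ring
        simp only [← norm_mul, mul_add, norm_add_le_iff_of_norm_le hxy,
          norm_add_le_iff_of_norm_le (hy₀.trans (h.zpow_le_zpow_iff.mpr h1))]
        rw [← mul_add, h2, Circle.coe_mul, mul_ite, mul_zero]
    · rfl
  rw [cellBoundIntegral_eq_double h hψ hr hl]
  by_cases hc : r ≤ l ∧ l ≤ r + j
  · -- only `‖x‖ = q ^ l` contributes
    have e1 : max r l = l := max_eq_right hc.1
    have e2 : min l (r + j) = l := min_eq_left hc.2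
    have hx : ∀ x : F, (if ‖x‖ ≤ q ^ min l (r + j) then (ψ (-1 * x) : ℂ) * ∫ y,
        (if ‖y‖ ≤ q ^ min r (l + i) ∧ ‖x‖ * ‖y‖ ≤ q ^ max r l then (ψ (-1 * y) : ℂ) else 0)
          ∂haarF F else 0) = (if ‖x‖ ≤ q ^ l then (ψ (-1 * x) : ℂ) else 0) -
            (if ‖x‖ ≤ q ^ (l - 1) then (ψ (-1 * x) : ℂ) else 0) := by
      intro x
      rw [hy x, e2, e1]
      rw [e1] at hq1
      by_cases c1 : ‖x‖ ≤ q ^ (l - 1)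
      · simp only [if_pos c1, if_pos (c1.trans hq1.le), mul_zero, sub_self]
      · simp only [if_neg c1, sub_zero]
        by_cases c2 : ‖x‖ ≤ q ^ l
        · have hx0 : x ≠ 0 := by
            rintro rfl
            exact c1 (by rw [norm_zero]; exact zpow_nonneg h.pos.le _)
          obtain ⟨t, ht⟩ := h.exists_zpow x hx0
          rw [ht, h.zpow_le_zpow_iff] at c1 c2
          have htl : t = l := by omega
          rw [if_pos (by rw [ht, htl]), if_pos (by rw [ht, htl]), ht, htl]
          have : ∀ y : F, (‖y‖ ≤ q ^ min r (l + i) ∧ q ^ l * ‖y‖ ≤ q ^ l) ↔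
              ‖y‖ ≤ q ^ (0 : ℤ) := by
            intro y
            rw [zpow_zero, mul_le_iff_le_one_right (zpow_pos h.pos _), and_iff_right_iff_imp]
            intro hy
            exact hy.trans (one_le_zpow₀ h.one_lt.le (by omega))
          simp only [this]
          rw [integral_ite_addChar_zero h hψc]
          simp
        · rw [if_neg c2, if_neg c2]
    simp only [hx]
    have hint : ∀ k : ℤ, Integrable (fun x : F => if ‖x‖ ≤ q ^ k then (ψ (-1 * x) : ℂ) else 0)
        (haarF F) := by
      intro k
      have := integrable_ite_of_bounded (haarF F) (P := fun x => ‖x‖ ≤ q ^ k)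
        (isClosed_le continuous_norm continuous_const).measurableSet (fun x hx => hx)
        (f := fun x => (ψ (-1 * x) : ℂ)) (by fun_prop)
      convert this
    rw [integral_sub (hint _) (hint _), integral_ite_addChar_zero h hψc,
      integral_ite_addChar_zero h hψc, norm_neg, norm_one]
    simp only [← zpow_zero q, h.zpow_le_zpow_iff]
    rw [if_neg (show ¬ (0 : ℤ) ≤ -l by omega)]
    by_cases c : l = 1
    · have hr1 : r = 1 := by omega
      subst c hr1
      simp
    · rw [if_neg (show ¬ (0 : ℤ) ≤ -(l - 1) by omega), if_neg (by omega)]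
      simp
  · have hx : ∀ x : F, (if ‖x‖ ≤ q ^ min l (r + j) then (ψ (-1 * x) : ℂ) * ∫ y,
        (if ‖y‖ ≤ q ^ min r (l + i) ∧ ‖x‖ * ‖y‖ ≤ q ^ max r l then (ψ (-1 * y) : ℂ) else 0)
          ∂haarF F else 0) = 0 := by
      intro x
      split_ifs with c
      · rw [hy x, if_pos (c.trans (h.zpow_le_zpow_iff.mpr (by omega))), mul_zero]
      · rfl
    simp only [hx]
    rw [if_neg (by omega)]
    simp

open scoped Classical in
/-- The integral of `ψ(-x-y)` over the points of `N` where the maximum of the entries is `q^r` and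
the maximum of the (normalized) minors is `q^l`. -/
def cellIntegral (q : ℝ) (ψ : AddChar F Circle) (i j r l : ℤ) : ℂ :=
  ∫ p : F × F × F, (if max 1 (max (q ^ (-j) * ‖p.1‖) (max ‖p.2.1‖ ‖p.2.2‖)) = q ^ r ∧
    max 1 (max ‖p.1‖ (max (q ^ (-i) * ‖p.2.1‖) ‖p.1 * p.2.1 - p.2.2‖)) = q ^ l
      then (ψ (-p.1 - p.2.1) : ℂ) else 0) ∂haarF3 F

/-- The nonnegative real numbers which are zero or powers of `q`. -/
def IsZeroOrZPow (q t : ℝ) : Prop := t = 0 ∨ ∃ k : ℤ, t = q ^ k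

lemma IsZeroOrZPow.max {s t : ℝ} (hs : IsZeroOrZPow q s) (ht : IsZeroOrZPow q t) :
    IsZeroOrZPow q (max s t) := by
  rcases max_choice s t with hm | hm <;> rw [hm] <;> assumption

include h in
lemma IsNormalizedUniformizer.isZeroOrZPow_norm (x : F) : IsZeroOrZPow q ‖x‖ := by
  by_cases hx : x = 0
  · exact Or.inl (by simp [hx])
  · exact Or.inr (h.exists_zpow x hx)

include h in
lemma IsNormalizedUniformizer.isZeroOrZPow_zpow_mul {t : ℝ} (k : ℤ) (ht : IsZeroOrZPow q t) :
    IsZeroOrZPow q (q ^ k * t) := by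
  rcases ht with rfl | ⟨l, rfl⟩
  · exact Or.inl (by simp)
  · exact Or.inr ⟨k + l, by rw [zpow_add₀ h.pos.ne']⟩

include h in
-- The norms take values in a discrete set, so a value equal to `q ^ k` is one that passes the bound
-- `q ^ k` and fails the next smaller one.
lemma IsZeroOrZPow.eq_iff {t : ℝ} (ht : IsZeroOrZPow q t) (k : ℤ) :
    t = q ^ k ↔ t ≤ q ^ k ∧ ¬ t ≤ q ^ (k - 1) := by
  have hk : q ^ (k - 1) < q ^ k := zpow_lt_zpow_right₀ h.one_lt (by omega)
  rcases ht with rfl | ⟨l, rfl⟩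
  · have h1 := zpow_pos h.pos k
    have h2 := (zpow_pos h.pos (k - 1)).le
    constructor
    · intro h0; rw [← h0] at h1; exact absurd h1 (lt_irrefl _)
    · rintro ⟨-, h3⟩; exact absurd h2 h3
  · rw [h.zpow_inj, h.zpow_le_zpow_iff, h.zpow_le_zpow_iff]
    omega

open scoped Classical in
lemma ite_and_not_eq {P P' Q Q' : Prop} (hP : P' → P) (hQ : Q' → Q) (c : ℂ) :
    (if (P ∧ ¬P') ∧ Q ∧ ¬Q' then c else 0) = (if P ∧ Q then c else 0) - (if P' ∧ Q then c else 0) -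
      ((if P ∧ Q' then c else 0) - (if P' ∧ Q' then c else 0)) := by
  by_cases h1 : P' <;> by_cases h2 : Q'
  · simp [h1, h2, hP h1, hQ h2]
  · simp [h1, h2, hP h1]
  · simp [h1, h2, hQ h2]
  · simp [h1, h2]

include h hψ in
-- Inclusion and exclusion in both maxima converts exact values into bounds.
lemma cellIntegral_eq (i j r l : ℤ) : cellIntegral q ψ i j r l =
    cellBoundIntegral q ψ i j r l - cellBoundIntegral q ψ i j (r - 1) l -
      (cellBoundIntegral q ψ i j r (l - 1) - cellBoundIntegral q ψ i j (r - 1) (l - 1)) := by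
  classical
  have hI := integrable_cellBound (q := q) hψ i j
  have hS : ∀ l', Integrable (fun p : F × F × F =>
      (if CellBound q i j r l' p then (ψ (-p.1 - p.2.1) : ℂ) else 0) -
        if CellBound q i j (r - 1) l' p then (ψ (-p.1 - p.2.1) : ℂ) else 0) (haarF3 F) :=
    fun l' => (hI r l').sub (hI (r - 1) l')
  simp only [cellIntegral, cellBoundIntegral]
  rw [← integral_sub (hI r l) (hI _ _), ← integral_sub (hI r (l - 1)) (hI _ _),
    ← integral_sub (hS l) (hS (l - 1))]
  congr 1
  funext p
  have e1 : IsZeroOrZPow q (max 1 (max (q ^ (-j) * ‖p.1‖) (max ‖p.2.1‖ ‖p.2.2‖))) :=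
    IsZeroOrZPow.max (Or.inr ⟨0, by simp⟩) ((h.isZeroOrZPow_zpow_mul _ (h.isZeroOrZPow_norm _)).max
      ((h.isZeroOrZPow_norm _).max (h.isZeroOrZPow_norm _)))
  have e2 : IsZeroOrZPow q
      (max 1 (max ‖p.1‖ (max (q ^ (-i) * ‖p.2.1‖) ‖p.1 * p.2.1 - p.2.2‖))) :=
    IsZeroOrZPow.max (Or.inr ⟨0, by simp⟩) ((h.isZeroOrZPow_norm _).max
      ((h.isZeroOrZPow_zpow_mul _ (h.isZeroOrZPow_norm _)).max (h.isZeroOrZPow_norm _)))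
  have m1 : q ^ (r - 1) ≤ q ^ r := h.zpow_le_zpow_iff.mpr (by omega)
  have m2 : q ^ (l - 1) ≤ q ^ l := h.zpow_le_zpow_iff.mpr (by omega)
  have hb : ∀ r l, (if CellBound q i j r l p then (ψ (-p.1 - p.2.1) : ℂ) else 0) =
      if max 1 (max (q ^ (-j) * ‖p.1‖) (max ‖p.2.1‖ ‖p.2.2‖)) ≤ q ^ r ∧
        max 1 (max ‖p.1‖ (max (q ^ (-i) * ‖p.2.1‖) ‖p.1 * p.2.1 - p.2.2‖)) ≤ q ^ l
      then (ψ (-p.1 - p.2.1) : ℂ) else 0 := fun r l => if_congr Iff.rfl rfl rfl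
  simp only [e1.eq_iff h, e2.eq_iff h, hb]
  convert ite_and_not_eq (fun c => LE.le.trans c m1) (fun c => LE.le.trans c m2) _

include h hψ hψc in
lemma cellBoundIntegral_eq {i j r l : ℤ} (hi : 0 ≤ i) (hj : 0 ≤ j) :
    cellBoundIntegral q ψ i j r l =
      if r < 0 ∨ l < 0 then 0
      else if r = 0 then (if l = 0 ∨ j = 0 then 1 else 0)
      else if l = 0 then (if i = 0 then 1 else 0)
      else if r = 1 ∧ l = 1 then -(q : ℂ) else 0 := by
  split_ifs with c1 c2 c3 c4 c5 c6
  · exact cellBoundIntegral_of_neg h c1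
  · rw [cellBoundIntegral_of_min_eq_zero h hψ hψc (by omega) (by omega) hj hi (by omega),
      if_pos (by omega)]
  · rw [cellBoundIntegral_of_min_eq_zero h hψ hψc (by omega) (by omega) hj hi (by omega),
      if_neg (by omega)]
  · rw [cellBoundIntegral_of_min_eq_zero h hψ hψc (by omega) (by omega) hj hi (by omega),
      if_pos (by omega)]
  · rw [cellBoundIntegral_of_one_le h hψ hψc (by omega) (by omega) hj (by omega),
      if_neg (by omega)]
  · rw [cellBoundIntegral_of_one_le h hψ hψc (by omega) (by omega) hj (by omega), if_pos c6]
  · rw [cellBoundIntegral_of_one_le h hψ hψc (by omega) (by omega) hj (by omega), if_neg c6]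

end Whittaker

/-! ### The sum over the torus -/

section TorusSum

variable {F : Type*} [NontriviallyNormedField F] [IsUltrametricDist F] [ProperSpace F]
  [MeasurableSpace F] [BorelSpace F] {ϖ : F} {q : ℝ} {ψ : AddChar F Circle} {ρ a : F}
  (h : IsNormalizedUniformizer ϖ q) (hψ : Continuous ψ) (hψc : HasConductorIntegers ψ)
  (hρ : IsPrimitiveRoot ρ 3) {e : ℤ} (he : ‖a‖ = q ^ e)

/-- The value of the orbital integral when `‖a‖ = q ^ e`. -/
def orbitalValue (ψ : AddChar F Circle) (ρ a : F) (e : ℤ) (m n : ℕ) : ℂ :=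
  if n + e = 0 ∧ m = 0 then 1
  else if n + e = 1 ∧ m = 0 then 3
  else if 1 + e = 2 ∧ m = 0 ∧ n = 1 then 1 + (ψ (-a) : ℂ) + (ψ (ρ ^ 2 * a) : ℂ)
  else if n + e = 2 ∧ m = 0 ∧ 1 < n then 1
  else if n + e = 0 ∧ m = 1 then 2
  else if n + e = 1 ∧ m = 1 ∧ 0 < n then 2
  else if 3 ≤ 2 * m + n + e ∧ m + n = 1 then 1 + (ψ (-a) : ℂ) + (ψ (ρ ^ 2 * a) : ℂ)
  else 0

/-- `levelDiff`, extended by zero. -/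
def levelDiffExt (ψ : AddChar F Circle) (ρ a : F) (e i j : ℤ) : ℂ :=
  if i < 0 ∨ j < 0 then 0 else levelDiff ψ ρ a e i j

include h hψc hρ he in
lemma one_add_add_eq_three (he0 : e ≤ 0) : 1 + (ψ (-a) : ℂ) + (ψ (ρ ^ 2 * a) : ℂ) = 3 := by
  have ha : q ^ e ≤ 1 := zpow_le_one_of_nonpos₀ h.one_lt.le he0
  rw [hψc.eq_one (by rw [norm_neg, he]; exact ha),
    hψc.eq_one (by rw [norm_rho_sq_mul hρ he]; exact ha)]
  norm_num

/-- For `e ≤ 0` all the characters involved equal one, so the identity is one between integers. The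
key is that `2 * (i + e) + j + 1` does not change under `(i, j) ↦ (i + 1, j - 2)`. For `m ≥ 2` the
terms therefore cancel in pairs, and the truncation at 3 agrees across the boundary `i + e = 1`. The
small values of `m` and `n` are a finite check. -/
lemma levelDiff_int_combination {d : ℤ → ℤ → ℤ} {e v : ℤ} {m n : ℕ} (hmn : 1 ≤ m + n)
    (h0 : ∀ i j : ℤ, i < 0 ∨ j < 0 → d i j = 0)
    (h1 : ∀ i j : ℤ, 0 ≤ i → 0 ≤ j → 1 ≤ i + e → d i j = 3)
    (h2 : ∀ i j : ℤ, 0 ≤ i → 0 ≤ j → i + e ≤ 0 →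
      d i j = max 0 (min 3 (2 * (i + e) + j + 1)))
    (he : e ≤ 0)
    (hv : v = if n + e = 0 ∧ m = 0 then 1
        else if n + e = 1 ∧ m = 0 then 3
        else if 1 + e = 2 ∧ m = 0 ∧ n = 1 then 3
        else if n + e = 2 ∧ m = 0 ∧ 1 < n then 1
        else if n + e = 0 ∧ m = 1 then 2
        else if n + e = 1 ∧ m = 1 ∧ 0 < n then 2
        else if 3 ≤ 2 * m + n + e ∧ m + n = 1 then 3
        else 0) :
    d n m - d (n - 2) (m + 1) - d (n + 1) (m - 2) +
      (1 - (if n = 1 then 1 else 0) - (if m = 1 then 1 else 0)) * d (n - 1) (m - 1) = v := by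
  have a2 := h1 n m (by omega) (by omega)
  have a3 := h2 n m (by omega) (by omega)
  rcases Nat.lt_or_ge m 2 with hm | hm
  · rw [h0 (n + 1) (m - 2) (by omega), sub_zero]
    rcases Nat.lt_or_ge n 2 with hn | hn
    · rw [h0 (n - 2) (m + 1) (by omega), sub_zero]
      have d1 := h0 (n - 1) (m - 1)
      have d2 := h1 (n - 1) (m - 1)
      have d3 := h2 (n - 1) (m - 1)
      generalize d n m = A at *
      generalize d (n - 1) (m - 1) = D at *
      clear h0 h1 h2
      interval_cases n <;> interval_cases m
      · omega
      · simp at *; split_ifs at hv <;> omega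
      · simp at *; split_ifs at hv <;> omega
      · simp at *; split_ifs at hv <;> omega
    · rw [if_neg (show ¬ n = 1 by omega), sub_zero]
      have b2 := h1 (n - 2) (m + 1) (by omega) (by omega)
      have b3 := h2 (n - 2) (m + 1) (by omega) (by omega)
      have d1 : (1 - (if m = 1 then 1 else 0)) * d (n - 1) (m - 1) = 0 := by
        split_ifs
        · ring
        · rw [h0 _ _ (by omega), mul_zero]
      rw [d1]
      generalize d n m = A at *
      generalize d (n - 2) (m + 1) = B at *
      clear h0 h1 h2 d1
      interval_cases m <;> simp at hv <;> split_ifs at hv <;> omega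
  · have c2 := h1 (n + 1) (m - 2) (by omega) (by omega)
    have c3 := h2 (n + 1) (m - 2) (by omega) (by omega)
    have hv0 : v = 0 := by rw [hv]; split_ifs <;> omega
    have hAC : d n m = d (n + 1) (m - 2) := by
      clear h0 h1 h2 hv
      rcases lt_trichotomy (n + e) 0 with hE | hE | hE
      · rw [a3 (by omega), c3 (by omega)]; omega
      · rw [a3 (by omega), c2 (by omega)]; omega
      · rw [a2 (by omega), c2 (by omega)]
    have hBD : (1 - (if n = 1 then 1 else 0)) * d (n - 1) (m - 1) = d (n - 2) (m + 1) := by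
      rcases Nat.lt_or_ge n 2 with hn | hn
      · rw [h0 (n - 2) (m + 1) (by omega)]
        split_ifs
        · ring
        · rw [h0 _ _ (by omega), mul_zero]
      · have b2 := h1 (n - 2) (m + 1) (by omega) (by omega)
        have b3 := h2 (n - 2) (m + 1) (by omega) (by omega)
        have d2 := h1 (n - 1) (m - 1) (by omega) (by omega)
        have d3 := h2 (n - 1) (m - 1) (by omega) (by omega)
        rw [if_neg (by omega), sub_zero, one_mul]
        clear h0 h1 h2 hv
        rcases lt_trichotomy (n - 2 + e) (-1) with hE | hE | hE
        · rw [d3 (by omega), b3 (by omega)]; omega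
        · rw [d3 (by omega), b3 (by omega)]; omega
        · rcases eq_or_lt_of_le (show 0 ≤ n - 2 + e by omega) with hE' | hE'
          · rw [d2 (by omega), b3 (by omega)]; omega
          · rw [d2 (by omega), b2 (by omega)]
    rw [if_neg (show ¬ m = 1 by omega), sub_zero, hBD, hAC, hv0]
    ring

include h hψc hρ he in
-- For `e ≤ 0` the three-term value is `3`, and the integer identity applies. For `e > 0` every
-- `levelDiffExt` with nonnegative indices equals the same three-term value, so only the signs of
-- the indices have to be tracked.
lemma levelDiffExt_combination (m n : ℕ) (hmn : 1 ≤ m + n) :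
    levelDiffExt ψ ρ a e n m - levelDiffExt ψ ρ a e (n - 2) (m + 1) -
      levelDiffExt ψ ρ a e (n + 1) (m - 2) +
      ((1 - (if n = 1 then 1 else 0) - (if m = 1 then 1 else 0) : ℤ) : ℂ) *
        levelDiffExt ψ ρ a e (n - 1) (m - 1) = orbitalValue ψ ρ a e m n := by
  rcases le_or_gt e 0 with he0 | he0
  · have h3 := one_add_add_eq_three h hψc hρ he he0
    have hD : ∀ i j : ℤ, levelDiffExt ψ ρ a e i j = ((if i < 0 ∨ j < 0 then 0
        else if 1 ≤ i + e then 3 else max 0 (min 3 (2 * (i + e) + j + 1)) : ℤ) : ℂ) := by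
      intro i j
      simp only [levelDiffExt, levelDiff, h3]
      split_ifs <;> push_cast <;> rfl
    have hV : orbitalValue ψ ρ a e m n = ((if n + e = 0 ∧ m = 0 then 1
        else if n + e = 1 ∧ m = 0 then 3
        else if 1 + e = 2 ∧ m = 0 ∧ n = 1 then 3
        else if n + e = 2 ∧ m = 0 ∧ 1 < n then 1
        else if n + e = 0 ∧ m = 1 then 2
        else if n + e = 1 ∧ m = 1 ∧ 0 < n then 2
        else if 3 ≤ 2 * m + n + e ∧ m + n = 1 then 3
        else 0 : ℤ) : ℂ) := by
      simp only [orbitalValue, h3]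
      split_ifs <;> push_cast <;> rfl
    rw [hV, hD, hD, hD, hD, ← levelDiff_int_combination (e := e) (d := fun i j =>
      if i < 0 ∨ j < 0 then 0 else if 1 ≤ i + e then 3 else max 0 (min 3 (2 * (i + e) + j + 1)))
      hmn (fun i j hij => if_pos hij)
      (fun i j hi hj hij => by rw [if_neg (by omega), if_pos hij])
      (fun i j hi hj hij => by rw [if_neg (by omega), if_neg (by omega)]) he0 rfl]
    push_cast
    rfl
  · generalize hT : 1 + (ψ (-a) : ℂ) + (ψ (ρ ^ 2 * a) : ℂ) = T
    have hD : ∀ i j : ℤ, levelDiffExt ψ ρ a e i j =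
        ((if i < 0 ∨ j < 0 then 0 else 1 : ℤ) : ℂ) * T := by
      intro i j
      simp only [levelDiffExt, levelDiff, hT]
      by_cases hij : i < 0 ∨ j < 0
      · simp [hij]
      · rw [if_neg hij, if_neg hij, if_pos (by omega)]
        simp
    have hV : orbitalValue ψ ρ a e m n = ((if m + n = 1 then 1 else 0 : ℤ) : ℂ) * T := by
      simp only [orbitalValue, hT]
      split_ifs <;> first | omega | simp
    have hI : (if (n : ℤ) < 0 ∨ (m : ℤ) < 0 then 0 else 1 : ℤ) -
        (if (n - 2 : ℤ) < 0 ∨ (m + 1 : ℤ) < 0 then 0 else 1) -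
        (if (n + 1 : ℤ) < 0 ∨ (m - 2 : ℤ) < 0 then 0 else 1) +
        (1 - (if n = 1 then 1 else 0) - (if m = 1 then 1 else 0)) *
        (if (n - 1 : ℤ) < 0 ∨ (m - 1 : ℤ) < 0 then 0 else 1) = if m + n = 1 then 1 else 0 := by
      rcases Nat.lt_or_ge n 2 with hn | hn <;> rcases Nat.lt_or_ge m 2 with hm | hm
      · split_ifs <;> omega
      · rw [if_neg (show ¬ m = 1 by omega)]
        split_ifs <;> omega
      · rw [if_neg (show ¬ n = 1 by omega)]
        split_ifs <;> omega
      · rw [if_neg (show ¬ m = 1 by omega), if_neg (show ¬ n = 1 by omega)]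
        split_ifs <;> omega
    have comb : ∀ a b c k d : ℤ, (a : ℂ) * T - b * T - c * T + (k : ℂ) * (d * T) =
        ((a - b - c + k * d : ℤ) : ℂ) * T := by
      intros; push_cast; ring
    rw [hV, hD, hD, hD, hD, comb, hI]

/-- The Whittaker coefficient of the double coset of `d_{m,n}` at `t`, multiplied by the volume of
`t N(𝒪) t⁻¹`, where `t` is `diag(ϖ^(n+m), ϖ^m, 1)` shifted by `-(l α₁ + r α₂)`. -/
def torusCoeff (q : ℝ) (m n r l : ℕ) : ℂ :=
  ((if r = 0 ∧ l = 0 then 1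
    else if (r = 1 ∧ l = 0) ∨ (r = 0 ∧ l = 1) then -1
    else if r = 1 ∧ l = 1 then 1 - (if n = 1 then 1 else 0) - (if m = 1 then 1 else 0)
    else 0 : ℤ) : ℂ) +
  ((if (r = 1 ∧ l = 1) ∨ (r = 2 ∧ l = 2) then -1
    else if (r = 1 ∧ l = 2) ∨ (r = 2 ∧ l = 1) then 1 else 0 : ℤ) : ℂ) * q

include h hψ hψc in
-- The bounded integrals are nonzero only along the two axes of the `(r, l)` quadrant and at `(1,
-- 1)`, and their second difference vanishes for `r ≥ 3` or `l ≥ 3`. At `r = l = 1` one has `i = n -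
-- 1` and `j = m - 1`, which is where the corrections at `n = 1` and `m = 1` come from.
lemma cellIntegral_eq_torusCoeff {m n r l : ℕ} (hi : 0 ≤ (n + r - 2 * l : ℤ))
    (hj : 0 ≤ (m + l - 2 * r : ℤ)) :
    cellIntegral q ψ (n + r - 2 * l) (m + l - 2 * r) r l = torusCoeff q m n r l := by
  have hV : ∀ r' l' : ℤ, cellBoundIntegral q ψ (n + r - 2 * l) (m + l - 2 * r) r' l' =
      ((if (r' = 0 ∧ 0 ≤ l' ∧ (l' = 0 ∨ (m + l - 2 * r : ℤ) = 0)) ∨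
          (l' = 0 ∧ 0 ≤ r' ∧ (n + r - 2 * l : ℤ) = 0) then 1 else 0 : ℤ) : ℂ) -
        ((if r' = 1 ∧ l' = 1 then 1 else 0 : ℤ) : ℂ) * q := by
    intro r' l'
    rw [cellBoundIntegral_eq h hψ hψc hi hj]
    split_ifs <;> first | omega | simp
  have comb : ∀ a a' b b' c c' d d' : ℤ, ((a : ℂ) - a' * q) - (b - b' * q) -
      ((c - c' * q) - (d - d' * q)) =
      ((a - b - (c - d) : ℤ) : ℂ) + ((-a' + b' - (-c' + d') : ℤ) : ℂ) * q := by
    intros; push_cast; ring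
  rw [cellIntegral_eq h hψ, hV, hV, hV, hV, comb, torusCoeff]
  congr 3
  · clear comb hV
    rcases Nat.lt_or_ge r 3 with hr | hr <;> rcases Nat.lt_or_ge l 3 with hl | hl
    · interval_cases r <;> interval_cases l <;> norm_num <;> omega
    · rcases Nat.lt_or_ge r 2 with hr2 | hr2
      · interval_cases r
        · rw [if_neg (show ¬ (((0 : ℕ) : ℤ) - 1 = 0 ∧ _ ∨ _) by omega)]
          rw [sub_zero, if_neg (show ¬ (((0 : ℕ) : ℤ) - 1 = 0 ∧ _ ∨ _) by omega), sub_zero]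
          split_ifs <;> omega
        · rw [if_neg (by omega), if_neg (show ¬ (((1 : ℕ) : ℤ) = 0 ∧ _ ∨ _) by omega)]
          split_ifs <;> omega
      · rw [if_neg (by omega), if_neg (by omega), if_neg (by omega), if_neg (by omega),
          if_neg (by omega), if_neg (by omega), if_neg (by omega)]
        rfl
    · rcases Nat.lt_or_ge l 2 with hl2 | hl2
      · interval_cases l
        · split_ifs <;> omega
        · rw [if_neg (by omega), if_neg (by omega)]
          split_ifs <;> omega
      · rw [if_neg (by omega), if_neg (by omega), if_neg (by omega), if_neg (by omega),
          if_neg (by omega), if_neg (by omega), if_neg (by omega)]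
        rfl
    · rw [if_neg (by omega), if_neg (by omega), if_neg (by omega), if_neg (by omega),
        if_neg (by omega), if_neg (by omega), if_neg (by omega)]
      rfl
  · clear comb hV
    split_ifs <;> omega

include h hψ hψc hρ he in
/-- The sum of the orbital integrals of the `ω(t)φ_∘` against the Whittaker coefficients of the
double coset of `d_{m,n}`. -/
lemma sum_levelSum_mul_cellIntegral
    (hneg : ∀ i j : ℤ, i < 0 ∨ j < 0 → levelSum q ψ ρ a e i j = 0)
    (m n : ℕ) (hmn : 1 ≤ m + n) (R : ℕ) (hR : 3 ≤ R) :
    ∑ r ∈ Finset.range R, ∑ l ∈ Finset.range R,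
      levelSum q ψ ρ a e (n + r - 2 * l) (m + l - 2 * r) *
        cellIntegral q ψ (n + r - 2 * l) (m + l - 2 * r) r l = orbitalValue ψ ρ a e m n := by
  -- Off the dominant chamber the coefficient need not be the cell integral, but `levelSum` vanishes
  -- there.
  have hw : ∀ r l : ℕ, levelSum q ψ ρ a e (n + r - 2 * l) (m + l - 2 * r) *
        cellIntegral q ψ (n + r - 2 * l) (m + l - 2 * r) r l =
      levelSum q ψ ρ a e (n + r - 2 * l) (m + l - 2 * r) * torusCoeff q m n r l := by
    intro r l
    by_cases hd : (n + r - 2 * l : ℤ) < 0 ∨ (m + l - 2 * r : ℤ) < 0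
    · rw [hneg _ _ hd, zero_mul, zero_mul]
    · push Not at hd
      rw [cellIntegral_eq_torusCoeff h hψ hψc hd.1 hd.2]
  have hz : ∀ r l, 3 ≤ r ∨ 3 ≤ l → torusCoeff q m n r l = 0 := by
    intro r l hrl
    unfold torusCoeff
    split_ifs <;> first | omega | simp
  simp only [hw]
  have hs := Finset.sum_subset (Finset.range_subset_range.mpr hR)
    (f := fun r : ℕ => ∑ l ∈ Finset.range R,
      levelSum q ψ ρ a e (n + r - 2 * l) (m + l - 2 * r) * torusCoeff q m n r l)
    fun r _ hr => Finset.sum_eq_zero fun l _ => by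
      rw [Finset.mem_range] at hr
      rw [hz r l (by omega), mul_zero]
  rw [← hs]
  have hl : ∀ f : ℕ → ℂ, (∀ l, 3 ≤ l → f l = 0) →
      ∑ l ∈ Finset.range R, f l = f 0 + f 1 + f 2 := by
    intro f hf
    rw [← Finset.sum_subset (Finset.range_subset_range.mpr hR)
      fun l _ hl => hf l (by simpa using hl)]
    simp [Finset.sum_range_succ]
  -- With the extension by zero the recursion holds for all integers, since off the chamber every
  -- term vanishes.
  have hrec : ∀ i j : ℤ, levelSum q ψ ρ a e i j =
      q * levelSum q ψ ρ a e (i - 1) (j - 1) + levelDiffExt ψ ρ a e i j := by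
    intro i j
    unfold levelDiffExt
    split_ifs with hij
    · rw [hneg i j hij, hneg _ _ (by omega)]; simp
    · exact levelSum_eq h hψc hρ he (by omega) (by omega)
  rw [Finset.sum_range_succ, Finset.sum_range_succ, Finset.sum_range_succ, Finset.sum_range_zero,
    hl _ (fun l hl => by rw [hz _ l (Or.inr hl), mul_zero]),
    hl _ (fun l hl => by rw [hz _ l (Or.inr hl), mul_zero]),
    hl _ (fun l hl => by rw [hz _ l (Or.inr hl), mul_zero]),
    ← levelDiffExt_combination h hψc hρ he m n hmn]
  simp only [Nat.cast_zero, Nat.cast_one, Nat.cast_ofNat, mul_zero, mul_one, add_zero, sub_zero,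
    zero_add]
  norm_num
  have h1 := hrec n m
  have h2 := hrec (n - 2) (m + 1)
  have h3 := hrec (n + 1) (m - 2)
  have h4 := hrec (n - 1) (m - 1)
  -- Replacing `L(n-1, m-1)` by the recursion uses the coefficient `1 - [n = 1] - [m = 1]`, while
  -- the coefficient of `q L(n-2, m-2)` in the sum is `-1`. The discrepancy is harmless because
  -- `L(n-2, m-2) = 0` when `n = 1` or `m = 1`.
  have h5 : ((if n = 1 then 1 else 0) + (if m = 1 then 1 else 0) : ℂ) *
      levelSum q ψ ρ a e (n - 2) (m - 2) = 0 := by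
    by_cases hn : n = 1 ∨ m = 1
    · rw [hneg _ _ (by omega), mul_zero]
    · rw [if_neg (by omega), if_neg (by omega)]; simp
  rw [show torusCoeff q m n 0 0 = 1 by simp [torusCoeff],
    show torusCoeff q m n 0 1 = -1 by simp [torusCoeff],
    show torusCoeff q m n 0 2 = 0 by simp [torusCoeff],
    show torusCoeff q m n 1 0 = -1 by simp [torusCoeff],
    show torusCoeff q m n 1 1 = 1 - (if n = 1 then 1 else 0) - (if m = 1 then 1 else 0) - q by
      simp [torusCoeff]; ring,
    show torusCoeff q m n 1 2 = q by simp [torusCoeff],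
    show torusCoeff q m n 2 0 = 0 by simp [torusCoeff],
    show torusCoeff q m n 2 1 = q by simp [torusCoeff],
    show torusCoeff q m n 2 2 = -q by simp [torusCoeff],
    show (n : ℤ) + 1 - 2 = n - 1 by ring, show (m : ℤ) + 1 - 2 = m - 1 by ring,
    show (n : ℤ) + 1 - 4 = n - 3 by ring, show (m : ℤ) + 1 - 4 = m - 3 by ring,
    show (n : ℤ) + 2 - 4 = n - 2 by ring, show (m : ℤ) + 2 - 4 = m - 2 by ring]
  rw [show (n : ℤ) - 2 - 1 = n - 3 by ring, show (m : ℤ) + 1 - 1 = m by ring] at h2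
  rw [show (n : ℤ) + 1 - 1 = n by ring, show (m : ℤ) - 2 - 1 = m - 3 by ring] at h3
  rw [show (n : ℤ) - 1 - 1 = n - 2 by ring, show (m : ℤ) - 1 - 1 = m - 2 by ring] at h4
  linear_combination h1 - h2 - h3 +
    (1 - (if n = 1 then 1 else 0) - (if m = 1 then 1 else 0)) * h4 - q * h5

end TorusSum

/-! ### The Weil representation on the spherical vector -/

section UnipotentElements

variable {F : Type*} [NontriviallyNormedField F]

/-- The element of `GL₃(F)` with matrix `unipMat x y z`. -/
def unipGL (x y z : F) : GL (Fin 3) F where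
  val := unipMat x y z
  inv := unipMat (-x) (-y) (x * y - z)
  val_inv := by
    rw [unipMat_mul]; ext i j; fin_cases i <;> fin_cases j <;> simp [unipMat]
  inv_val := by
    rw [unipMat_mul]; ext i j; fin_cases i <;> fin_cases j <;> simp [unipMat]

/-- The element of `N` with coordinates `x, y, z`. -/
def unipOf (x y z : F) : unip F := ⟨unipGL x y z, x, y, z, rfl⟩

@[simp] lemma ux_unipOf (x y z : F) : ux (unipOf x y z) = x := by
  simp [ux, unipOf, unipGL, unipMat]

@[simp] lemma uy_unipOf (x y z : F) : uy (unipOf x y z) = y := by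
  simp [uy, unipOf, unipGL, unipMat]

@[simp] lemma uz_unipOf (x y z : F) : uz (unipOf x y z) = z := by
  simp [uz, unipOf, unipGL, unipMat]

/-- The element `(g, u)` of `H`. -/
def hMk (g : SL(2, F)) (u : unip F) : HGroup F := (g, u)

@[simp] lemma hMk_fst (g : SL(2, F)) (u : unip F) : (hMk g u).1 = g := rfl

@[simp] lemma hMk_snd (g : SL(2, F)) (u : unip F) : (hMk g u).2 = u := rfl

end UnipotentElements

/-! ### Conjugation by `N` on `𝔰𝔩₃` in the Lagrangian coordinates. -/

section Conjugation

variable {F : Type*} [NontriviallyNormedField F] {ρ : F}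

/-- The coordinate vector `v` of the conjugate of `slMk ρ p v` by `unipMat x y z`. -/
def conjV (ρ x y z : F) (p v : Fin 4 → F) : Fin 4 → F :=
  slV ρ (unipMat (-x) (-y) (x * y - z) * slMk ρ p v * unipMat x y z)

variable (hρ : IsPrimitiveRoot ρ 3) (h3 : (3 : F) ≠ 0)

include hρ h3

lemma inv_rho_sub_one : (ρ - 1)⁻¹ = (-2 - ρ) / 3 := by
  have hr := cube_root_sum hρ
  have h1 : ρ - 1 ≠ 0 := sub_ne_zero.mpr (hρ.ne_one (by norm_num))
  field_simp
  linear_combination hr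

lemma trace_slMk (p v : Fin 4 → F) : (slMk ρ p v).trace = 0 := by
  have hr := cube_root_sum hρ
  simp [slMk, Matrix.trace_fin_three, inv_rho_sub_one hρ h3]
  field_simp
  grind

lemma slMk_slP_slV {X : Matrix (Fin 3) (Fin 3) F} (hX : X.trace = 0) :
    slMk ρ (slP ρ X) (slV ρ X) = X := by
  have hr := cube_root_sum hρ
  rw [Matrix.trace_fin_three] at hX
  ext i j
  fin_cases i <;> fin_cases j <;> simp [slMk, slP, slV, inv_rho_sub_one hρ h3]
  all_goals
    field_simp
    grind

/-- Conjugation by `N` preserves the subspace `p = 0`, so the new `p` does not involve `v`. It is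
the first column of the geometric action on `F⁸`. -/
lemma slP_conj (x y z : F) (ξ : F8 F) (v : Fin 4 → F) (i : Fin 4) :
    slP ρ (unipMat (-x) (-y) (x * y - z) * slMk ρ (fun i => ξ i 0) v * unipMat x y z) i =
      act ρ ξ (hMk 1 (unipOf x y z)) i 0 := by
  have hr := cube_root_sum hρ
  fin_cases i <;>
    simp [slP, slMk, unipMat, act, Matrix.mul_apply, Fin.sum_univ_three, inv_rho_sub_one hρ h3] <;>
    field_simp <;> grind

/-- The new `v` is the image of the old one under the map dual to the action on `q`, plus a shift
linear in `p`. Pairing this shift with the second column of `ξ·u` gives the phase, which is how the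
cocycle arises. -/
lemma pairing_conj (x y z : F) (ξ : F8 F) (v : Fin 4 → F) :
    -2 * ∑ i, ξ i 1 * v i = phase ρ ξ (hMk 1 (unipOf x y z)) +
      -2 * ∑ i, act ρ ξ (hMk 1 (unipOf x y z)) i 1 * conjV ρ x y z (fun i => ξ i 0) v i := by
  have hr := cube_root_sum hρ
  rw [phase_eq]
  simp only [sympl_apply, Fin.sum_univ_four]
  simp [conjV, slV, slMk, unipMat, act, Matrix.mul_apply, Fin.sum_univ_three,
    inv_rho_sub_one hρ h3]
  field_simp
  grind

end Conjugation

/-! ### Units in residual characteristic greater than three; integral trace-zero matrices. -/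

section Integrality

variable {F : Type*} [NontriviallyNormedField F] [IsUltrametricDist F] [ProperSpace F]
  [MeasurableSpace F] [BorelSpace F] {ρ : F}

lemma norm_natCast_eq_one (hF : 3 < ringChar (residueField F)) {n : ℕ} (h0 : 0 < n) (hn : n ≤ 3) :
    ‖(n : F)‖ = 1 := by
  refine le_antisymm (mem_ringOfIntegers.mp (natCast_mem _ n)) (not_lt.mp fun hlt => ?_)
  have h1 : ‖((n : ringOfIntegers F) : F)‖ < 1 := by simpa using hlt
  have h2 := (residue_eq_zero_iff _).mpr h1
  rw [map_natCast] at h2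
  have h4 : ringChar (residueField F) ≤ n := Nat.le_of_dvd h0 (ringChar.dvd h2)
  omega

variable (hF : 3 < ringChar (residueField F))

include hF

lemma norm_two : ‖(2 : F)‖ = 1 := by
  simpa using norm_natCast_eq_one hF (n := 2) (by norm_num) (by norm_num)

lemma norm_three : ‖(3 : F)‖ = 1 := by
  simpa using norm_natCast_eq_one hF (n := 3) (by norm_num) (by norm_num)

lemma three_ne_zero_of_residueChar : (3 : F) ≠ 0 := by
  rw [← norm_ne_zero_iff, norm_three hF]; exact one_ne_zero

variable (hρ : IsPrimitiveRoot ρ 3)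

include hρ

/-- Up to a unit the square of `ρ - 1` is `3`, which is itself a unit. -/
lemma norm_rho_sub_one : ‖ρ - 1‖ = 1 := by
  have h1 : (ρ - 1) ^ 2 = -3 * ρ := by linear_combination cube_root_sum hρ
  have h2 := congrArg norm h1
  rw [norm_pow, norm_mul, norm_neg, norm_three hF, norm_rho hρ, one_mul] at h2
  exact (pow_eq_one_iff_of_nonneg (norm_nonneg _) two_ne_zero).mp h2

lemma forall_norm_slP_slV_iff {X : Matrix (Fin 3) (Fin 3) F} (hX : X.trace = 0) :
    ((∀ i, ‖slP ρ X i‖ ≤ 1) ∧ ∀ i, ‖slV ρ X i‖ ≤ 1) ↔ ∀ i j, ‖X i j‖ ≤ 1 := by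
  have h3 := three_ne_zero_of_residueChar hF
  have r0 : ρ ∈ ringOfIntegers F := mem_ringOfIntegers.mpr (norm_rho hρ).le
  have r1 : ρ - 1 ∈ ringOfIntegers F := sub_mem r0 (one_mem _)
  have r2 : (ρ - 1)⁻¹ ∈ ringOfIntegers F := mem_ringOfIntegers.mpr (by
    rw [norm_inv, norm_rho_sub_one hF hρ, inv_one])
  have r3 : (ρ - 1) / 3 ∈ ringOfIntegers F := mem_ringOfIntegers.mpr (by
    rw [norm_div, norm_rho_sub_one hF hρ, norm_three hF, div_one])
  simp only [← mem_ringOfIntegers]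
  constructor
  · rintro ⟨hp, hv⟩
    have e : ∀ i j, slMk ρ (slP ρ X) (slV ρ X) i j ∈ ringOfIntegers F := by
      generalize slP ρ X = p at hp
      generalize slV ρ X = v at hv
      intro i j
      fin_cases i <;> fin_cases j <;> simp only [slMk] <;> simp
      · exact add_mem (mul_mem r2 (hp _)) (mul_mem r3 (hv _))
      · exact hv _
      · exact hv _
      · exact hp _
      · rw [mul_div_assoc]
        exact add_mem (mul_mem (mul_mem r0 r2) (hp _)) (mul_mem (mul_mem (pow_mem r0 2) r3) (hv _))
      · exact hv _
      · exact hp _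
      · exact hp _
      · rw [mul_div_assoc]
        exact add_mem (mul_mem (mul_mem (pow_mem r0 2) r2) (hp _)) (mul_mem (mul_mem r0 r3) (hv _))
    rwa [slMk_slP_slV hρ h3 hX] at e
  · intro h
    constructor
    · intro i
      fin_cases i
      · exact h _ _
      · exact h _ _
      · exact h _ _
      · exact mul_mem r3 (add_mem (add_mem (h _ _) (mul_mem (pow_mem r0 2) (h _ _)))
          (mul_mem r0 (h _ _)))
    · intro i
      fin_cases i
      · exact h _ _
      · exact h _ _
      · exact h _ _
      · exact mul_mem r2 (add_mem (add_mem (h _ _) (mul_mem r0 (h _ _)))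
          (mul_mem (pow_mem r0 2) (h _ _)))

end Integrality

/-! ### Character integrals over boxes, and shears of product measures. -/

section ProductIntegrals

variable {F : Type*} [NontriviallyNormedField F] [IsUltrametricDist F] [ProperSpace F]
  [MeasurableSpace F] [BorelSpace F] {ϖ : F} {q : ℝ} {ψ : AddChar F Circle}

lemma addChar_map_sum {ι : Type*} (s : Finset ι) (f : ι → F) :
    (ψ (∑ i ∈ s, f i) : ℂ) = ∏ i ∈ s, (ψ (f i) : ℂ) := by
  classical
  induction s using Finset.induction_on with
  | empty => simp
  | insert i s hi ih =>
    rw [Finset.sum_insert hi, Finset.prod_insert hi, AddChar.map_add_eq_mul, Circle.coe_mul, ih]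

open scoped Classical in
lemma integral_pi_ite_addChar (h : IsNormalizedUniformizer ϖ q) (hψc : HasConductorIntegers ψ)
    {ι : Type*} [Fintype ι] (k : ι → ℤ) (l : ι → F) :
    ∫ v : ι → F, (if ∀ i, ‖v i‖ ≤ q ^ k i then (ψ (∑ i, l i * v i) : ℂ) else 0)
      ∂Measure.pi (fun _ => haarF F) =
      if ∀ i, ‖l i‖ ≤ q ^ (-k i) then (q : ℂ) ^ (∑ i, k i) else 0 := by
  have e : ∀ v : ι → F, (if ∀ i, ‖v i‖ ≤ q ^ k i then (ψ (∑ i, l i * v i) : ℂ) else 0) =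
      ∏ i, (if ‖v i‖ ≤ q ^ k i then (ψ (l i * v i) : ℂ) else 0) := by
    intro v
    split_ifs with hv
    · rw [Finset.prod_congr rfl fun i _ => if_pos (hv i), addChar_map_sum]
    · push Not at hv
      obtain ⟨i, hi⟩ := hv
      exact (Finset.prod_eq_zero (Finset.mem_univ i) (if_neg (not_le.mpr hi))).symm
  simp only [e]
  rw [integral_fintype_prod_eq_prod (fun i x => if ‖x‖ ≤ q ^ k i then (ψ (l i * x) : ℂ) else 0)]
  simp only [integral_ite_addChar_zero h hψc]
  have hq : (q : ℂ) ≠ 0 := by exact_mod_cast h.pos.ne'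
  split_ifs with hl
  · rw [Finset.prod_congr rfl fun i _ => if_pos (hl i)]
    induction (Finset.univ : Finset ι) using Finset.induction_on with
    | empty => simp
    | insert i s hi ih => rw [Finset.prod_insert hi, Finset.sum_insert hi, ih, zpow_add₀ hq]
  · push Not at hl
    obtain ⟨i, hi⟩ := hl
    exact Finset.prod_eq_zero (Finset.mem_univ i) (if_neg (not_le.mpr hi))

/-- With the other coordinates fixed, the map is a translation of the `k`-th coordinate; Fubini does
the rest. -/
lemma measurePreserving_update_add {n : ℕ} (k : Fin (n + 1)) {g : (Fin (n + 1) → F) → F}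
    (hg : Continuous g) (hgk : ∀ v t, g (Function.update v k t) = g v) :
    MeasurePreserving (fun v => Function.update v k (v k + g v))
      (Measure.pi fun _ : Fin (n + 1) => haarF F) (Measure.pi fun _ => haarF F) := by
  let e := MeasurableEquiv.piFinSuccAbove (fun _ : Fin (n + 1) => F) k
  have he : MeasurePreserving e _ _ :=
    measurePreserving_piFinSuccAbove (fun _ : Fin (n + 1) => haarF F) k
  let G : (Fin n → F) → F := fun w => g (k.insertNth 0 w)
  have hG : Measurable G := by
    refine hg.measurable.comp ?_
    have := e.symm.measurable.comp (measurable_const.prodMk measurable_id :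
      Measurable fun w : Fin n → F => ((0 : F), w))
    exact this
  have h1 : MeasurePreserving (fun p : (Fin n → F) × F => (p.1, p.2 + G p.1))
      ((Measure.pi fun _ => haarF F).prod (haarF F)) ((Measure.pi fun _ => haarF F).prod (haarF F)) := by
    refine (MeasurePreserving.id _).skew_product (g := fun w t => t + G w)
      (measurable_snd.add (hG.comp measurable_fst)) (Filter.Eventually.of_forall fun w => ?_)
    exact map_add_right_eq_self _ _
  have h2 := he.symm.comp (Measure.measurePreserving_swap.comp
    (h1.comp (Measure.measurePreserving_swap.comp he)))
  convert h2 using 1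
  funext v
  have hgv : G (fun i => v (k.succAbove i)) = g v := by
    rw [← hgk v 0]
    change g _ = g _
    congr 1
    funext i
    refine Fin.succAboveCases k ?_ (fun j => ?_) i <;> simp
  apply e.injective
  change e _ = e (e.symm _)
  rw [e.apply_symm_apply]
  refine Prod.ext ?_ ?_
  · change Function.update v k _ k = v k + G (fun i => v (k.succAbove i))
    rw [Function.update_self, hgv]
  · funext i
    change Function.update v k _ (k.succAbove i) = v (k.succAbove i)
    rw [Function.update_of_ne (Fin.succAbove_ne k i)]

end ProductIntegrals

/-! ### Invariance of the spherical vector under `K`. -/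

section SphericalVector

variable {F : Type*} [NontriviallyNormedField F] [IsUltrametricDist F] [ProperSpace F]
  [MeasurableSpace F] [BorelSpace F] {ϖ : F} {q : ℝ} {ψ : AddChar F Circle} {ρ : F}

lemma continuous_conjV (x y z : F) (p : Fin 4 → F) (k : Fin 4) :
    Continuous fun v => conjV ρ x y z p v k := by
  fin_cases k <;>
    simp [conjV, slV, slMk, unipMat, Matrix.mul_apply, Fin.sum_univ_three] <;> fun_prop

open scoped Classical in
lemma phiCirc_eq_ite (ξ : F8 F) : phiCirc F ξ = if ∀ i j, ‖ξ i j‖ ≤ 1 then 1 else 0 := by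
  unfold phiCirc
  split_ifs with hξ
  · rw [Set.indicator_of_mem (by exact hξ)]; rfl
  · rw [Set.indicator_of_notMem (by exact hξ)]

section Shears

variable (hρ : IsPrimitiveRoot ρ 3) (h3 : (3 : F) ≠ 0)

include hρ h3

/-- For fixed `p` the map is unipotent triangular in `v`: coordinate 3 moves by a constant,
coordinates 1 and 2 by functions of coordinate 3, and coordinate 0 by a function of the other three.
-/
lemma conjV_eq (x y z : F) (p v : Fin 4 → F) :
    conjV ρ x y z p v =
      ![v 0 + (conjV ρ x y z p ![0, v 1, v 2, v 3] 0),
        v 1 + (conjV ρ x y z p ![0, 0, 0, v 3] 1),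
        v 2 + (conjV ρ x y z p ![0, 0, 0, v 3] 2),
        v 3 + (conjV ρ x y z p 0 3)] := by
  have hr := cube_root_sum hρ
  ext i
  fin_cases i <;>
    simp [conjV, slV, slMk, unipMat, Matrix.mul_apply, Fin.sum_univ_three,
      inv_rho_sub_one hρ h3] <;>
    field_simp <;> grind

lemma measurePreserving_conjV (x y z : F) (p : Fin 4 → F) :
    MeasurePreserving (conjV ρ x y z p)
      (Measure.pi fun _ : Fin 4 => haarF F) (Measure.pi fun _ => haarF F) := by
  have hc := fun k => continuous_conjV (ρ := ρ) x y z p k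
  have m0 := measurePreserving_update_add (0 : Fin 4)
    (g := fun v : Fin 4 → F => conjV ρ x y z p ![0, v 1, v 2, v 3] 0)
    ((hc 0).comp (by fun_prop)) (by intro v t; simp)
  have m1 := measurePreserving_update_add (1 : Fin 4)
    (g := fun v : Fin 4 → F => conjV ρ x y z p ![0, 0, 0, v 3] 1)
    ((hc 1).comp (by fun_prop)) (by intro v t; simp)
  have m2 := measurePreserving_update_add (2 : Fin 4)
    (g := fun v : Fin 4 → F => conjV ρ x y z p ![0, 0, 0, v 3] 2)
    ((hc 2).comp (by fun_prop)) (by intro v t; simp)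
  have m3 := measurePreserving_update_add (3 : Fin 4)
    (g := fun _ : Fin 4 → F => conjV ρ x y z p 0 3) continuous_const (by intro v t; rfl)
  -- Coordinate 0 is moved first and coordinate 3 last, so each shift is evaluated at unmodified
  -- coordinates.
  convert m3.comp (m2.comp (m1.comp m0)) using 1
  funext v
  rw [conjV_eq hρ h3]
  ext i
  fin_cases i <;> simp

end Shears

variable (hF : 3 < ringChar (residueField F)) (h : IsNormalizedUniformizer ϖ q)
  (hψ : Continuous ψ) (hψc : HasConductorIntegers ψ) (hρ : IsPrimitiveRoot ρ 3)

include hF h hψc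

open scoped Classical in
-- The integers are self-dual for the pairing `ψ(2 q v)`, because 2 is a unit.
lemma fromMixed_phiCirc (X : Matrix (Fin 3) (Fin 3) F) :
    fromMixed ψ ρ (phiCirc F) X =
      if (∀ i, ‖slP ρ X i‖ ≤ 1) ∧ ∀ i, ‖slV ρ X i‖ ≤ 1 then 1 else 0 := by
  have key := integral_pi_ite_addChar h hψc (fun _ : Fin 4 => 0) (fun i => 2 * slV ρ X i)
  simp only [zpow_zero, neg_zero, norm_mul, norm_two hF, one_mul, Finset.sum_const_zero] at key
  have e : ∀ v : Fin 4 → F, phiCirc F (fun i => ![slP ρ X i, v i]) *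
      (ψ (2 * ∑ i, v i * slV ρ X i) : ℂ) =
      (if ∀ i, ‖slP ρ X i‖ ≤ 1 then 1 else 0) *
        (if ∀ i, ‖v i‖ ≤ 1 then (ψ (∑ i, 2 * slV ρ X i * v i) : ℂ) else 0) := by
    intro v
    rw [Finset.mul_sum]
    have e1 : (∑ i, 2 * (v i * slV ρ X i)) = ∑ i, 2 * slV ρ X i * v i :=
      Finset.sum_congr rfl fun i _ => by ring
    rw [e1]
    have e2 : (∀ i j, ‖(![slP ρ X i, v i] : Fin 2 → F) j‖ ≤ 1) ↔
        (∀ k, ‖slP ρ X k‖ ≤ 1) ∧ ∀ k, ‖v k‖ ≤ 1 := by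
      simp [Fin.forall_fin_two, forall_and]
    rw [phiCirc_eq_ite, if_congr e2 rfl rfl]
    by_cases c1 : ∀ k, ‖slP ρ X k‖ ≤ 1
    · by_cases c2 : ∀ k, ‖v k‖ ≤ 1
      · rw [if_pos ⟨c1, c2⟩, if_pos c1, if_pos c2]
      · rw [if_neg (fun hh => c2 hh.2), if_neg c2, zero_mul, mul_zero]
    · rw [if_neg (fun hh => c1 hh.1), if_neg c1, zero_mul, zero_mul]
  rw [fromMixed]
  simp only [e]
  rw [integral_const_mul, key]
  split_ifs <;> simp_all

include hρ

open scoped Classical in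
lemma fromMixed_phiCirc_of_trace {X : Matrix (Fin 3) (Fin 3) F} (hX : X.trace = 0) :
    fromMixed ψ ρ (phiCirc F) X = if ∀ i j, ‖X i j‖ ≤ 1 then 1 else 0 := by
  rw [fromMixed_phiCirc hF h hψc]
  exact if_congr (forall_norm_slP_slV_iff hF hρ hX) rfl rfl

/-- In the model on `𝔰𝔩₃` the spherical vector is the indicator of the integral matrices, a set
stable under conjugation by `K`. The action of `g * k` therefore agrees with that of `g`. -/
lemma weilGL_mul_integral (g k : GL (Fin 3) F) (hk : ∀ i j, ‖k i j‖ ≤ 1)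
    (hk' : ∀ i j, ‖k⁻¹ i j‖ ≤ 1) :
    weilGL ψ ρ (g * k) (phiCirc F) = weilGL ψ ρ g (phiCirc F) := by
  have h3 := three_ne_zero_of_residueChar hF
  have conj_norm : ∀ (k : GL (Fin 3) F) (_ : ∀ i j, ‖k i j‖ ≤ 1) (_ : ∀ i j, ‖k⁻¹ i j‖ ≤ 1)
      (Y : Matrix (Fin 3) (Fin 3) F), (∀ i j, ‖Y i j‖ ≤ 1) →
      ∀ i j, ‖((k⁻¹ : GL (Fin 3) F).1 * Y * k.1) i j‖ ≤ 1 := by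
    intro k hk hk' Y hY i j
    simp only [← mem_ringOfIntegers] at *
    simp only [Matrix.mul_apply]
    exact sum_mem fun l _ => mul_mem (sum_mem fun m _ => mul_mem (hk' _ _) (hY _ _)) (hk _ _)
  have tr : ∀ (g : GL (Fin 3) F) (Y : Matrix (Fin 3) (Fin 3) F), Y.trace = 0 →
      ((g⁻¹ : GL (Fin 3) F).1 * Y * g.1).trace = 0 := by
    intro g Y hY
    rw [Matrix.trace_mul_comm, ← mul_assoc, Units.mul_inv, one_mul, hY]
  funext ξ
  unfold weilGL toMixed
  congr 1
  funext v
  congr 1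
  have t0 := tr g _ (trace_slMk hρ h3 (fun i => ξ i 0) v)
  have t1 := tr (g * k) _ (trace_slMk hρ h3 (fun i => ξ i 0) v)
  beta_reduce
  rw [fromMixed_phiCirc_of_trace hF h hψc hρ t0, fromMixed_phiCirc_of_trace hF h hψc hρ t1]
  refine if_congr ?_ rfl rfl
  generalize slMk ρ (fun i => ξ i 0) v = X
  have e : ((g * k)⁻¹ : GL (Fin 3) F).1 * X * (g * k).1 =
      (k⁻¹ : GL (Fin 3) F).1 * ((g⁻¹ : GL (Fin 3) F).1 * X * g.1) * k.1 := by
    rw [_root_.mul_inv_rev, Units.val_mul, Units.val_mul]; simp only [mul_assoc]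
  constructor
  · intro hh
    rw [e] at hh
    have := conj_norm k⁻¹ hk' (by rwa [inv_inv]) _ hh
    rw [inv_inv] at this
    convert this using 4
    simp only [mul_assoc]
    rw [Units.mul_inv, mul_one, Units.mul_inv_cancel_left]
  · intro hh
    rw [e]
    exact conj_norm k hk hk' _ hh

end SphericalVector

/-! ### The translates of the spherical vector by `N` and the torus. -/

section TorusFormula

variable {F : Type*} [NontriviallyNormedField F] [IsUltrametricDist F] [ProperSpace F]
  [MeasurableSpace F] [BorelSpace F] {ϖ : F} {q : ℝ} {ψ : AddChar F Circle} {ρ : F}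

/-- The matrix `diag(ϖ^(i+j), ϖ^j, 1)`. -/
def torusGL {ϖ : F} (h0 : ϖ ≠ 0) (i j : ℤ) : GL (Fin 3) F where
  val := Matrix.diagonal ![ϖ ^ (i + j), ϖ ^ j, 1]
  inv := Matrix.diagonal ![ϖ ^ (-(i + j)), ϖ ^ (-j), 1]
  val_inv := by
    rw [Matrix.diagonal_mul_diagonal, ← Matrix.diagonal_one]
    congr 1
    ext k
    fin_cases k <;> simp [← zpow_add₀ h0, zpow_ne_zero j h0]
  inv_val := by
    rw [Matrix.diagonal_mul_diagonal, ← Matrix.diagonal_one]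
    congr 1
    ext k
    fin_cases k <;> simp [← zpow_add₀ h0, zpow_ne_zero j h0]

/-- The exponents of the radii of the support of `ω(diag(ϖ^(i+j), ϖ^j, 1)) φ_∘`. -/
def radExp (i j : ℤ) : Fin 4 → ℤ := ![i + j, j, i, 0]

lemma sum_radExp (i j : ℤ) : ∑ k, radExp i j k = 2 * (i + j) := by
  simp [Fin.sum_univ_four, radExp]; ring

variable (hF : 3 < ringChar (residueField F)) (h : IsNormalizedUniformizer ϖ q)
  (hψ : Continuous ψ) (hψc : HasConductorIntegers ψ) (hρ : IsPrimitiveRoot ρ 3)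

include h in
lemma norm_slP_torus_le_iff (i j : ℤ) (X : Matrix (Fin 3) (Fin 3) F) (k : Fin 4) :
    ‖slP ρ ((torusGL h.ne_zero i j)⁻¹.1 * X * (torusGL h.ne_zero i j).1) k‖ ≤ 1 ↔
      ‖slP ρ X k‖ ≤ q ^ radExp i j k := by
  have e : slP ρ ((torusGL h.ne_zero i j)⁻¹.1 * X * (torusGL h.ne_zero i j).1) k =
      slP ρ X k * ϖ ^ radExp i j k := by
    change slP ρ (Matrix.diagonal ![ϖ ^ (-(i + j)), ϖ ^ (-j), 1] * X *
      Matrix.diagonal ![ϖ ^ (i + j), ϖ ^ j, 1]) k = _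
    have h0 := h.ne_zero
    fin_cases k <;> simp [slP, radExp, Matrix.mul_diagonal, Matrix.diagonal_mul] 
    all_goals
      try simp only [zpow_add₀ h0, _root_.zpow_neg]
      try field_simp
      try simp
  rw [e, norm_mul, h.norm_zpow, _root_.zpow_neg, ← div_eq_mul_inv,
    div_le_one (zpow_pos h.pos _)]

include h in
lemma norm_slV_torus_le_iff (i j : ℤ) (X : Matrix (Fin 3) (Fin 3) F) (k : Fin 4) :
    ‖slV ρ ((torusGL h.ne_zero i j)⁻¹.1 * X * (torusGL h.ne_zero i j).1) k‖ ≤ 1 ↔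
      ‖slV ρ X k‖ ≤ q ^ (-radExp i j k) := by
  have e : slV ρ ((torusGL h.ne_zero i j)⁻¹.1 * X * (torusGL h.ne_zero i j).1) k =
      slV ρ X k * ϖ ^ (-radExp i j k) := by
    change slV ρ (Matrix.diagonal ![ϖ ^ (-(i + j)), ϖ ^ (-j), 1] * X *
      Matrix.diagonal ![ϖ ^ (i + j), ϖ ^ j, 1]) k = _
    have h0 := h.ne_zero
    fin_cases k <;> simp [slV, radExp, Matrix.mul_diagonal, Matrix.diagonal_mul] 
    all_goals
      try simp only [zpow_add₀ h0, _root_.zpow_neg]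
      try field_simp
      try simp
  rw [e, norm_mul, h.norm_zpow, neg_neg, _root_.zpow_neg, ← one_div,
    le_div_iff₀ (zpow_pos h.pos _)]

include hF h hψ hψc hρ

open scoped Classical in
/-- The value of `ω(u t) φ_∘` for `u ∈ N` and `t = diag(ϖ^(i+j), ϖ^j, 1)`. -/
lemma weilGL_unip_torus (x y z : F) (i j : ℤ) (ξ : F8 F) :
    weilGL ψ ρ (unipGL x y z * torusGL h.ne_zero i j) (phiCirc F) ξ =
      if ∀ k l, ‖act ρ ξ (hMk 1 (unipOf x y z)) k l‖ ≤ q ^ radExp i j k then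
        (q : ℂ) ^ (-(2 * (i + j))) * (ψ (phase ρ ξ (hMk 1 (unipOf x y z))) : ℂ) else 0 := by
  have h3 := three_ne_zero_of_residueChar hF
  set t := torusGL h.ne_zero i j with ht
  set p : Fin 4 → F := fun i => ξ i 0
  set η := act ρ ξ (hMk 1 (unipOf x y z)) with hη
  have key := integral_pi_ite_addChar h hψc (fun k => -radExp i j k) (fun k => -2 * η k 1)
  simp only [norm_mul, norm_neg, norm_two hF, one_mul, neg_neg, Finset.sum_neg_distrib,
    sum_radExp] at key
  have hinv : ((unipGL x y z * t)⁻¹ : GL (Fin 3) F).1 =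
      t⁻¹.1 * unipMat (-x) (-y) (x * y - z) := by
    rw [_root_.mul_inv_rev]; rfl
  -- In terms of `w = conjV ρ x y z p v` the integrand separates into a constant carrying the phase
  -- and the condition on `p`, times a character on a box. The substitution preserves the measure.
  have e : ∀ v : Fin 4 → F,
      fromMixed ψ ρ (phiCirc F) (((unipGL x y z * t)⁻¹ : GL (Fin 3) F).1 * slMk ρ p v *
        (unipGL x y z * t).1) * (ψ (-2 * ∑ i, ξ i 1 * v i) : ℂ) =
      (fun w : Fin 4 → F => (if ∀ k, ‖η k 0‖ ≤ q ^ radExp i j k then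
          (ψ (phase ρ ξ (hMk 1 (unipOf x y z))) : ℂ) else 0) *
        (if ∀ k, ‖w k‖ ≤ q ^ (-radExp i j k) then (ψ (∑ k, -2 * η k 1 * w k) : ℂ) else 0))
        (conjV ρ x y z p v) := by
    intro v
    have hconj : ((unipGL x y z * t)⁻¹ : GL (Fin 3) F).1 * slMk ρ p v * (unipGL x y z * t).1 =
        t⁻¹.1 * (unipMat (-x) (-y) (x * y - z) * slMk ρ p v * unipMat x y z) * t.1 := by
      rw [hinv, Units.val_mul, show (unipGL x y z).1 = unipMat x y z from rfl]
      simp only [mul_assoc]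
    rw [hconj, fromMixed_phiCirc hF h hψc]
    simp only [ht, norm_slP_torus_le_iff h, norm_slV_torus_le_iff h]
    simp only [p, slP_conj hρ h3]
    rw [pairing_conj hρ h3 x y z ξ v, AddChar.map_add_eq_mul, Circle.coe_mul, Finset.mul_sum]
    simp only [← mul_assoc, ← hη]
    change (if (∀ k, ‖η k 0‖ ≤ q ^ radExp i j k) ∧
      ∀ k, ‖conjV ρ x y z (fun i => ξ i 0) v k‖ ≤ q ^ (-radExp i j k) then (1 : ℂ) else 0) * _ * _
        = _
    by_cases c1 : ∀ k, ‖η k 0‖ ≤ q ^ radExp i j k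
    · by_cases c2 : ∀ k, ‖conjV ρ x y z (fun i => ξ i 0) v k‖ ≤ q ^ (-radExp i j k)
      · rw [if_pos ⟨c1, c2⟩, if_pos c1, if_pos c2, one_mul]
      · rw [if_neg (fun hh => c2 hh.2), if_neg c2, zero_mul, zero_mul, mul_zero]
    · rw [if_neg (fun hh => c1 hh.1), if_neg c1, zero_mul, zero_mul, zero_mul]
  unfold weilGL toMixed
  rw [integral_congr_ae (Filter.Eventually.of_forall e)]
  have hmp := measurePreserving_conjV hρ h3 x y z p
  set W : (Fin 4 → F) → ℂ := fun w =>
    if ∀ k, ‖w k‖ ≤ q ^ (-radExp i j k) then (ψ (∑ k, -2 * η k 1 * w k) : ℂ) else 0 with hW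
  have hmeas : Measurable W := by
    refine Measurable.ite ?_ (Continuous.measurable (by fun_prop)) measurable_const
    rw [Set.ofPred_forall]
    exact MeasurableSet.iInter fun k =>
      (isClosed_le (continuous_norm.comp (continuous_apply k)) continuous_const).measurableSet
  have key' : ∫ v, W (conjV ρ x y z p v) ∂Measure.pi (fun _ => haarF F) =
      if ∀ k, ‖η k 1‖ ≤ q ^ radExp i j k then (q : ℂ) ^ (-(2 * (i + j))) else 0 := by
    rw [← integral_map hmp.aemeasurable hmeas.aestronglyMeasurable, hmp.map_eq]
    convert key
  change ∫ v, _ * W (conjV ρ x y z p v) ∂_ = _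
  rw [integral_const_mul, key']
  simp only [Fin.forall_fin_two, forall_and]
  by_cases c1 : ∀ k, ‖η k 0‖ ≤ q ^ radExp i j k
  · by_cases c2 : ∀ k, ‖η k 1‖ ≤ q ^ radExp i j k
    · rw [if_pos c1, if_pos c2, if_pos ⟨c1, c2⟩, mul_comm]
    · rw [if_neg c2, mul_zero, if_neg (fun hh => c2 hh.2)]
  · rw [if_neg c1, zero_mul, if_neg (fun hh => c1 hh.1)]

end TorusFormula

/-! ### Integral matrices, Iwasawa and Cartan decompositions -/

section IntegralMatrices

variable {F : Type*} [NontriviallyNormedField F] [IsUltrametricDist F] [ProperSpace F]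
  [MeasurableSpace F] [BorelSpace F]

/-- Integral matrices with unit determinant. -/
def IsIntegralUnit (k : Matrix (Fin 3) (Fin 3) F) : Prop := (∀ i j, ‖k i j‖ ≤ 1) ∧ ‖k.det‖ = 1

lemma norm_det_le_one {n : Type*} [Fintype n] [DecidableEq n] {k : Matrix n n F}
    (hk : ∀ i j, ‖k i j‖ ≤ 1) : ‖k.det‖ ≤ 1 := by
  simp only [← mem_ringOfIntegers] at *
  rw [Matrix.det_apply]
  refine sum_mem fun σ _ => ?_
  rw [Units.smul_def]
  exact zsmul_mem (prod_mem fun i _ => hk _ _) _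

lemma norm_adjugate_le_one {k : Matrix (Fin 3) (Fin 3) F}
    (hk : ∀ i j, ‖k i j‖ ≤ 1) (i j : Fin 3) : ‖k.adjugate i j‖ ≤ 1 := by
  rw [Matrix.adjugate_apply]
  refine norm_det_le_one fun a b => ?_
  rw [Matrix.updateRow_apply]
  split_ifs
  · rw [Pi.single_apply]
    split_ifs <;> simp
  · exact hk a b

lemma norm_mul_le_one {k l : Matrix (Fin 3) (Fin 3) F} (hk : ∀ i j, ‖k i j‖ ≤ 1)
    (hl : ∀ i j, ‖l i j‖ ≤ 1) (i j : Fin 3) : ‖(k * l) i j‖ ≤ 1 := by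
  simp only [← mem_ringOfIntegers] at *
  rw [Matrix.mul_apply]
  exact sum_mem fun m _ => mul_mem (hk _ _) (hl _ _)

lemma IsIntegralUnit.mul {k l : Matrix (Fin 3) (Fin 3) F} (hk : IsIntegralUnit k)
    (hl : IsIntegralUnit l) : IsIntegralUnit (k * l) :=
  ⟨norm_mul_le_one hk.1 hl.1, by rw [Matrix.det_mul, norm_mul, hk.2, hl.2, one_mul]⟩

lemma isIntegralUnit_one : IsIntegralUnit (1 : Matrix (Fin 3) (Fin 3) F) := by
  refine ⟨fun i j => ?_, by simp⟩
  rw [Matrix.one_apply]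
  split_ifs <;> simp

lemma IsIntegralUnit.adjugate {k : Matrix (Fin 3) (Fin 3) F} (hk : IsIntegralUnit k) :
    IsIntegralUnit k.adjugate :=
  ⟨norm_adjugate_le_one hk.1, by rw [Matrix.det_adjugate, norm_pow, hk.2, one_pow]⟩

lemma IsIntegralUnit.exists_integralGL {k : Matrix (Fin 3) (Fin 3) F} (hk : IsIntegralUnit k) :
    ∃ g ∈ integralGL F, g.1 = k := by
  have h0 : k.det ≠ 0 := norm_ne_zero_iff.mp (by rw [hk.2]; exact one_ne_zero)
  exact ⟨Matrix.GeneralLinearGroup.mkOfDetNeZero k h0, hk, rfl⟩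

lemma inv_mem_integralGL {g : GL (Fin 3) F} (hg : g ∈ integralGL F) : g⁻¹ ∈ integralGL F := by
  have e : (g⁻¹ : GL (Fin 3) F).1 = g.1.det⁻¹ • g.1.adjugate := by
    rw [Matrix.coe_units_inv, Matrix.inv_def, Ring.inverse_eq_inv']
  have hd : ‖g.1.det⁻¹‖ = 1 := by rw [norm_inv, hg.2, inv_one]
  refine ⟨fun i j => ?_, ?_⟩
  · rw [e, Matrix.smul_apply, norm_smul, hd, one_mul]
    exact norm_adjugate_le_one hg.1 i j
  · have h1 : (g⁻¹ : GL (Fin 3) F).1.det * g.1.det = 1 := by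
      rw [← Matrix.det_mul, Units.inv_mul, Matrix.det_one]
    have h2 := congrArg norm h1
    rwa [norm_mul, hg.2, mul_one, norm_one] at h2

variable (F) in
/-- `GL₃(𝒪)` as a subgroup of `GL₃(F)`. -/
def integralSubgroup : Subgroup (GL (Fin 3) F) where
  carrier := integralGL F
  mul_mem' := fun {a b} ha hb => IsIntegralUnit.mul (k := a.1) (l := b.1) ha hb
  one_mem' := isIntegralUnit_one
  inv_mem' := inv_mem_integralGL

/-- The largest norm of an entry of a matrix. -/
def entryNorm (A : Matrix (Fin 3) (Fin 3) F) : ℝ := ‖(fun i j => A i j : Fin 3 → Fin 3 → F)‖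

lemma entryNorm_le_iff {A : Matrix (Fin 3) (Fin 3) F} {r : ℝ} (hr : 0 ≤ r) :
    entryNorm A ≤ r ↔ ∀ i j, ‖A i j‖ ≤ r := by
  rw [entryNorm, pi_norm_le_iff_of_nonneg hr]
  exact forall_congr' fun i => pi_norm_le_iff_of_nonneg hr

lemma entryNorm_nonneg (A : Matrix (Fin 3) (Fin 3) F) : 0 ≤ entryNorm A := norm_nonneg _

lemma norm_le_entryNorm (A : Matrix (Fin 3) (Fin 3) F) (i j : Fin 3) : ‖A i j‖ ≤ entryNorm A :=
  (entryNorm_le_iff (entryNorm_nonneg A)).mp le_rfl i j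

lemma norm_sum_mul_le {f g : Fin 3 → F} {r : ℝ} (hr : 0 ≤ r) (hfg : ∀ i, ‖f i * g i‖ ≤ r) :
    ‖∑ i, f i * g i‖ ≤ r :=
  IsUltrametricDist.norm_sum_le_of_forall_le_of_nonneg hr fun i _ => hfg i

lemma entryNorm_mul_left_le {k : Matrix (Fin 3) (Fin 3) F} (hk : ∀ i j, ‖k i j‖ ≤ 1)
    (A : Matrix (Fin 3) (Fin 3) F) : entryNorm (k * A) ≤ entryNorm A := by
  rw [entryNorm_le_iff (entryNorm_nonneg A)]
  intro i j
  rw [Matrix.mul_apply]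
  refine norm_sum_mul_le (entryNorm_nonneg A) fun m => ?_
  rw [norm_mul]
  exact (mul_le_of_le_one_left (norm_nonneg _) (hk i m)).trans (norm_le_entryNorm A m j)

lemma entryNorm_mul_right_le {k : Matrix (Fin 3) (Fin 3) F} (hk : ∀ i j, ‖k i j‖ ≤ 1)
    (A : Matrix (Fin 3) (Fin 3) F) : entryNorm (A * k) ≤ entryNorm A := by
  rw [entryNorm_le_iff (entryNorm_nonneg A)]
  intro i j
  rw [Matrix.mul_apply]
  refine norm_sum_mul_le (entryNorm_nonneg A) fun m => ?_
  rw [norm_mul]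
  exact (mul_le_of_le_one_right (norm_nonneg _) (hk m j)).trans (norm_le_entryNorm A i m)

lemma entryNorm_smul (c : F) (A : Matrix (Fin 3) (Fin 3) F) :
    entryNorm (c • A) = ‖c‖ * entryNorm A :=
  norm_smul c (fun i j => A i j : Fin 3 → Fin 3 → F)

/-- Multiplication by integral matrices cannot increase the norm, and the adjugates undo it up to
the unit determinants. -/
lemma entryNorm_integral_mul_mul {k k' : Matrix (Fin 3) (Fin 3) F} (hk : IsIntegralUnit k)
    (hk' : IsIntegralUnit k') (A : Matrix (Fin 3) (Fin 3) F) :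
    entryNorm (k * A * k') = entryNorm A := by
  refine le_antisymm ((entryNorm_mul_right_le hk'.1 _).trans (entryNorm_mul_left_le hk.1 _)) ?_
  have h1 : k.adjugate * (k * A * k') * k'.adjugate = (k.det * k'.det) • A := by
    have e : k.adjugate * (k * A * k') * k'.adjugate =
        (k.adjugate * k) * A * (k' * k'.adjugate) := by simp only [mul_assoc]
    rw [e, Matrix.adjugate_mul, Matrix.mul_adjugate]
    simp [smul_smul, mul_comm]
  have h2 := (entryNorm_mul_right_le hk'.adjugate.1 (k.adjugate * (k * A * k'))).trans
    (entryNorm_mul_left_le hk.adjugate.1 (k * A * k'))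
  rwa [h1, entryNorm_smul, norm_mul, hk.2, hk'.2, one_mul, one_mul] at h2

lemma entryNorm_adjugate_integral_mul_mul {k k' : Matrix (Fin 3) (Fin 3) F}
    (hk : IsIntegralUnit k) (hk' : IsIntegralUnit k') (A : Matrix (Fin 3) (Fin 3) F) :
    entryNorm (k * A * k').adjugate = entryNorm A.adjugate := by
  rw [Matrix.adjugate_mul_distrib, Matrix.adjugate_mul_distrib, ← mul_assoc,
    entryNorm_integral_mul_mul hk'.adjugate hk.adjugate]

/-- `B` lies in the double coset `K A K`. -/
def IntegralEquiv (A B : Matrix (Fin 3) (Fin 3) F) : Prop :=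
  ∃ k k', IsIntegralUnit k ∧ IsIntegralUnit k' ∧ B = k * A * k'

lemma IntegralEquiv.trans {A B C : Matrix (Fin 3) (Fin 3) F} (h1 : IntegralEquiv A B)
    (h2 : IntegralEquiv B C) : IntegralEquiv A C := by
  obtain ⟨k, k', hk, hk', rfl⟩ := h1
  obtain ⟨l, l', hl, hl', rfl⟩ := h2
  exact ⟨l * k, k' * l', hl.mul hk, hk'.mul hl', by simp only [mul_assoc]⟩

lemma IntegralEquiv.norm_det {A B : Matrix (Fin 3) (Fin 3) F} (h1 : IntegralEquiv A B) :
    ‖B.det‖ = ‖A.det‖ := by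
  obtain ⟨k, k', hk, hk', rfl⟩ := h1
  rw [Matrix.det_mul, Matrix.det_mul, norm_mul, norm_mul, hk.2, hk'.2, one_mul, mul_one]

lemma IntegralEquiv.entryNorm_eq {A B : Matrix (Fin 3) (Fin 3) F} (h1 : IntegralEquiv A B) :
    entryNorm B = entryNorm A := by
  obtain ⟨k, k', hk, hk', rfl⟩ := h1
  exact entryNorm_integral_mul_mul hk hk' A

lemma IntegralEquiv.entryNorm_adjugate_eq {A B : Matrix (Fin 3) (Fin 3) F}
    (h1 : IntegralEquiv A B) : entryNorm B.adjugate = entryNorm A.adjugate := by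
  obtain ⟨k, k', hk, hk', rfl⟩ := h1
  exact entryNorm_adjugate_integral_mul_mul hk hk' A

lemma isIntegralUnit_perm (σ : Equiv.Perm (Fin 3)) :
    IsIntegralUnit (σ.permMatrix F) := by
  refine ⟨fun i j => ?_, ?_⟩
  · rw [Equiv.Perm.permMatrix, PEquiv.toMatrix_apply]
    split_ifs <;> simp
  · rw [Matrix.det_permutation]
    rcases Int.units_eq_one_or (Equiv.Perm.sign σ) with h | h <;> rw [h] <;> simp

lemma integralEquiv_submatrix (A : Matrix (Fin 3) (Fin 3) F) (σ τ : Equiv.Perm (Fin 3)) :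
    IntegralEquiv A (A.submatrix σ τ) := by
  refine ⟨_, _, isIntegralUnit_perm σ, isIntegralUnit_perm τ⁻¹, ?_⟩
  rw [Equiv.Perm.permMatrix, Equiv.Perm.permMatrix, PEquiv.toMatrix_toPEquiv_mul,
    PEquiv.mul_toMatrix_toPEquiv]
  rfl

lemma exists_norm_eq_entryNorm (A : Matrix (Fin 3) (Fin 3) F) :
    ∃ i j, ∀ a b, ‖A a b‖ ≤ ‖A i j‖ := by
  obtain ⟨⟨i, j⟩, -, h⟩ := Finset.exists_max_image (Finset.univ : Finset (Fin 3 × Fin 3))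
    (fun p => ‖A p.1 p.2‖) Finset.univ_nonempty
  exact ⟨i, j, fun a b => h (a, b) (Finset.mem_univ _)⟩

lemma isIntegralUnit_lower {a b c : F} (ha : ‖a‖ ≤ 1) (hb : ‖b‖ ≤ 1) (hc : ‖c‖ ≤ 1) :
    IsIntegralUnit !![1, 0, 0; a, 1, 0; b, c, 1] := by
  refine ⟨fun i j => ?_, by simp [Matrix.det_fin_three]⟩
  fin_cases i <;> fin_cases j <;> simp [ha, hb, hc]

lemma isIntegralUnit_upper {a b c : F} (ha : ‖a‖ ≤ 1) (hb : ‖b‖ ≤ 1) (hc : ‖c‖ ≤ 1) :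
    IsIntegralUnit !![1, a, b; 0, 1, c; 0, 0, 1] := by
  refine ⟨fun i j => ?_, by simp [Matrix.det_fin_three]⟩
  fin_cases i <;> fin_cases j <;> simp [ha, hb, hc]

lemma norm_neg_div_le_one {a b : F} (hab : ‖a‖ ≤ ‖b‖) : ‖-(a / b)‖ ≤ 1 := by
  rw [norm_neg, norm_div]
  exact div_le_one_of_le₀ hab (norm_nonneg _)

/-- The entry of largest norm is moved to the corner and used as a pivot. The quotients by it are
integral, so clearing its row and column stays within the double coset. -/
lemma exists_integralEquiv_block (A : Matrix (Fin 3) (Fin 3) F) (hA : A.det ≠ 0) :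
    ∃ d a b c e : F, IntegralEquiv A !![d, 0, 0; 0, a, b; 0, c, e] ∧
      d ≠ 0 ∧ ‖a‖ ≤ ‖d‖ ∧ ‖b‖ ≤ ‖d‖ ∧ ‖c‖ ≤ ‖d‖ ∧ ‖e‖ ≤ ‖d‖ := by
  obtain ⟨i, j, hij⟩ := exists_norm_eq_entryNorm A
  set B := A.submatrix (Equiv.swap 0 i) (Equiv.swap 0 j) with hB
  have hAB : IntegralEquiv A B := integralEquiv_submatrix A _ _
  have hmax : ∀ a b, ‖B a b‖ ≤ ‖B 0 0‖ := fun a b => by simpa [hB] using hij _ _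
  have h0 : B 0 0 ≠ 0 := by
    intro h00
    have hz : B = 0 := by
      ext a b
      have := hmax a b
      rw [h00, norm_zero] at this
      simpa using this
    have hd := hAB.norm_det
    rw [hz] at hd
    simp at hd
    exact hA (norm_eq_zero.mp hd.symm)
  have hbd : ∀ a b, ‖B a b + -(B a 0 / B 0 0) * B 0 b‖ ≤ ‖B 0 0‖ := by
    intro a b
    refine (IsUltrametricDist.norm_add_le_max _ _).trans (max_le (hmax a b) ?_)
    rw [norm_mul]
    exact (mul_le_of_le_one_left (norm_nonneg _) (norm_neg_div_le_one (hmax a 0))).trans (hmax 0 b)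
  refine ⟨B 0 0, B 1 1 + -(B 1 0 / B 0 0) * B 0 1, B 1 2 + -(B 1 0 / B 0 0) * B 0 2,
    B 2 1 + -(B 2 0 / B 0 0) * B 0 1, B 2 2 + -(B 2 0 / B 0 0) * B 0 2,
    hAB.trans ⟨_, _, isIntegralUnit_lower (norm_neg_div_le_one (hmax 1 0))
      (norm_neg_div_le_one (hmax 2 0)) (c := 0) (by simp),
      isIntegralUnit_upper (norm_neg_div_le_one (hmax 0 1))
      (norm_neg_div_le_one (hmax 0 2)) (c := 0) (by simp), ?_⟩, h0, hbd _ _, hbd _ _, hbd _ _,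
      hbd _ _⟩
  conv_rhs => rw [Matrix.eta_fin_three B]
  ext a b
  fin_cases a <;> fin_cases b <;>
    simp [Matrix.mul_apply, Fin.sum_univ_three] <;> field_simp <;> ring

lemma exists_integralEquiv_diagonal (A : Matrix (Fin 3) (Fin 3) F) (hA : A.det ≠ 0) :
    ∃ d₁ d₂ d₃ : F, IntegralEquiv A (Matrix.diagonal ![d₁, d₂, d₃]) ∧
      d₁ ≠ 0 ∧ d₂ ≠ 0 ∧ d₃ ≠ 0 ∧ ‖d₃‖ ≤ ‖d₂‖ ∧ ‖d₂‖ ≤ ‖d₁‖ := by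
  obtain ⟨d, a, b, c, e, h1, hd, ha, hb, hc, he⟩ := exists_integralEquiv_block A hA
  obtain ⟨a', b', c', e', h2, ha', hb', hc', he'⟩ :
      ∃ a' b' c' e' : F, IntegralEquiv A !![d, 0, 0; 0, a', b'; 0, c', e'] ∧ ‖a'‖ ≤ ‖d‖ ∧
        ‖b'‖ ≤ ‖a'‖ ∧ ‖c'‖ ≤ ‖a'‖ ∧ ‖e'‖ ≤ ‖a'‖ := by
    have hs : ∀ σ τ : Equiv.Perm (Fin 3), σ 0 = 0 → τ 0 = 0 →
        IntegralEquiv A ((!![d, 0, 0; 0, a, b; 0, c, e]).submatrix σ τ) := fun σ τ _ _ =>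
      h1.trans (integralEquiv_submatrix _ σ τ)
    have m1 := hs 1 1 rfl rfl
    have m2 := hs 1 (Equiv.swap 1 2) rfl (by decide)
    have m3 := hs (Equiv.swap 1 2) 1 (by decide) rfl
    have m4 := hs (Equiv.swap 1 2) (Equiv.swap 1 2) (by decide) (by decide)
    have e1 : (Equiv.swap (1 : Fin 3) 2) 0 = 0 := by decide
    have n2 : (!![d, 0, 0; 0, a, b; 0, c, e]).submatrix (1 : Equiv.Perm (Fin 3))
        (Equiv.swap 1 2) = !![d, 0, 0; 0, b, a; 0, e, c] := by
      ext x y; fin_cases x <;> fin_cases y <;> simp [e1]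
    have n3 : (!![d, 0, 0; 0, a, b; 0, c, e]).submatrix (Equiv.swap 1 2)
        (1 : Equiv.Perm (Fin 3)) = !![d, 0, 0; 0, c, e; 0, a, b] := by
      ext x y; fin_cases x <;> fin_cases y <;> simp [e1]
    have n4 : (!![d, 0, 0; 0, a, b; 0, c, e]).submatrix (Equiv.swap 1 2)
        (Equiv.swap 1 2) = !![d, 0, 0; 0, e, c; 0, b, a] := by
      ext x y; fin_cases x <;> fin_cases y <;> simp [e1]
    rw [n2] at m2
    rw [n3] at m3
    rw [n4] at m4
    -- The largest of the four entries of the remaining block is brought to its corner by swapping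
    -- the last two rows or columns.
    rcases le_total ‖a‖ ‖b‖ with x1 | x1 <;> rcases le_total ‖c‖ ‖e‖ with x2 | x2
    · rcases le_total ‖b‖ ‖e‖ with x3 | x3
      · exact ⟨_, _, _, _, m4, he, x2, x3, x1.trans x3⟩
      · exact ⟨_, _, _, _, m2, hb, x1, x3, x2.trans x3⟩
    · rcases le_total ‖b‖ ‖c‖ with x3 | x3
      · exact ⟨_, _, _, _, m3, hc, x2, x1.trans x3, x3⟩
      · exact ⟨_, _, _, _, m2, hb, x1, x2.trans x3, x3⟩
    · rcases le_total ‖a‖ ‖e‖ with x3 | x3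
      · exact ⟨_, _, _, _, m4, he, x2, x1.trans x3, x3⟩
      · exact ⟨_, _, _, _, h1, ha, x1, x2.trans x3, x3⟩
    · rcases le_total ‖a‖ ‖c‖ with x3 | x3
      · exact ⟨_, _, _, _, m3, hc, x2, x3, x1.trans x3⟩
      · exact ⟨_, _, _, _, h1, ha, x1, x3, x2.trans x3⟩
  have hdet := h2.norm_det
  have hA' : ‖A.det‖ ≠ 0 := norm_ne_zero_iff.mpr hA
  rw [← hdet] at hA'
  have ha0 : a' ≠ 0 := by
    intro h0
    rw [h0, norm_zero] at hb' hc'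
    have hb0 : b' = 0 := by simpa using hb'
    have hc0 : c' = 0 := by simpa using hc'
    apply hA'
    simp [Matrix.det_fin_three, h0, hb0, hc0]
  have h3 : IntegralEquiv A (Matrix.diagonal ![d, a', e' + -(c' / a') * b']) := by
    refine h2.trans ⟨_, _, isIntegralUnit_lower (a := 0) (b := 0) (by simp) (by simp)
      (norm_neg_div_le_one hc'), isIntegralUnit_upper (a := 0) (b := 0) (by simp) (by simp)
      (norm_neg_div_le_one hb'), ?_⟩
    ext x y
    fin_cases x <;> fin_cases y <;>
      simp [Matrix.mul_apply, Fin.sum_univ_three] <;> field_simp <;> ring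
  refine ⟨d, a', _, h3, hd, ha0, ?_, ?_, ha'⟩
  · intro h0
    have hdet3 := h3.norm_det
    rw [h0] at hdet3
    simp [Fin.prod_univ_three] at hdet3
    exact hA (norm_eq_zero.mp hdet3.symm)
  · refine (IsUltrametricDist.norm_add_le_max _ _).trans (max_le he' ?_)
    rw [norm_mul]
    exact (mul_le_of_le_one_left (norm_nonneg _) (norm_neg_div_le_one hc')).trans hb'

end IntegralMatrices

/-! ### Cartan and Iwasawa decompositions modulo the center. -/

section Decompositions

variable {F : Type*} [NontriviallyNormedField F] [IsUltrametricDist F] [ProperSpace F]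
  [MeasurableSpace F] [BorelSpace F] {ϖ : F} {q : ℝ}

lemma mk_eq_mk_iff_smul {g₁ g₂ : GL (Fin 3) F} :
    ProjGenLinGroup.mk g₁ = ProjGenLinGroup.mk g₂ ↔ ∃ c : F, c ≠ 0 ∧ g₂.1 = c • g₁.1 := by
  rw [ProjGenLinGroup.mk_eq_mk_iff]
  have e : ∀ u : Fˣ, (g₁ * GeneralLinearGroup.scalar (Fin 3) u).1 = (u : F) • g₁.1 := by
    intro u
    ext i j
    simp [Matrix.scalar_apply, mul_comm]
  constructor
  · rintro ⟨u, rfl⟩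
    exact ⟨u, u.ne_zero, e u⟩
  · rintro ⟨c, hc, h⟩
    exact ⟨Units.mk0 c hc, Units.ext ((e _).trans h.symm)⟩

lemma IntegralEquiv.symm {A B : Matrix (Fin 3) (Fin 3) F} (h1 : IntegralEquiv A B) :
    IntegralEquiv B A := by
  obtain ⟨k, k', hk, hk', rfl⟩ := h1
  obtain ⟨g, hg, rfl⟩ := hk.exists_integralGL
  obtain ⟨g', hg', rfl⟩ := hk'.exists_integralGL
  refine ⟨g⁻¹.1, g'⁻¹.1, inv_mem_integralGL hg, inv_mem_integralGL hg', ?_⟩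
  simp only [mul_assoc]
  rw [Units.mul_inv, mul_one, Units.inv_mul_cancel_left]

lemma IntegralEquiv.smul {A B : Matrix (Fin 3) (Fin 3) F} (h1 : IntegralEquiv A B) (c : F) :
    IntegralEquiv (c • A) (c • B) := by
  obtain ⟨k, k', hk, hk', rfl⟩ := h1
  exact ⟨k, k', hk, hk', by simp⟩

lemma isIntegralUnit_diagonal {a b c : F} (ha : ‖a‖ = 1) (hb : ‖b‖ = 1) (hc : ‖c‖ = 1) :
    IsIntegralUnit (Matrix.diagonal ![a, b, c]) := by
  refine ⟨fun i j => ?_, by simp [Fin.prod_univ_three, ha, hb, hc]⟩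
  fin_cases i <;> fin_cases j <;> simp [ha, hb, hc]

lemma entryNorm_eq_of_le {A : Matrix (Fin 3) (Fin 3) F} {r : ℝ} (hr : ∀ i j, ‖A i j‖ ≤ r)
    {i j : Fin 3} (hij : ‖A i j‖ = r) : entryNorm A = r :=
  le_antisymm ((entryNorm_le_iff (hij ▸ norm_nonneg _)).mpr hr) (hij ▸ norm_le_entryNorm A i j)

lemma entryNorm_diagonal {a b c : F} (hab : ‖b‖ ≤ ‖a‖) (hbc : ‖c‖ ≤ ‖b‖) :
    entryNorm (Matrix.diagonal ![a, b, c]) = ‖a‖ := by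
  refine entryNorm_eq_of_le (i := 0) (j := 0) (fun i j => ?_) (by simp)
  fin_cases i <;> fin_cases j <;> simp [hab, hbc.trans hab]

lemma adjugate_diagonal_three (a b c : F) : (Matrix.diagonal ![a, b, c]).adjugate =
    Matrix.diagonal ![b * c, a * c, a * b] := by
  rw [Matrix.adjugate_fin_three]
  ext i j
  fin_cases i <;> fin_cases j <;> simp

lemma entryNorm_adjugate_diagonal {a b c : F} (hab : ‖b‖ ≤ ‖a‖) (hbc : ‖c‖ ≤ ‖b‖) :
    entryNorm (Matrix.diagonal ![a, b, c]).adjugate = ‖a‖ * ‖b‖ := by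
  rw [adjugate_diagonal_three]
  refine entryNorm_eq_of_le (i := 2) (j := 2) (fun i j => ?_) (by simp)
  fin_cases i <;> fin_cases j <;> simp [mul_nonneg] <;> nlinarith [norm_nonneg a, norm_nonneg b,
    norm_nonneg c, mul_nonneg (norm_nonneg a) (norm_nonneg b)]

/-- The preimage in `GL₃(F)` of the support of `heckeFun ϖ m n`, up to the center. -/
def heckeSet (ϖ : F) (m n : ℕ) : Set (GL (Fin 3) F) :=
  {g | ∃ k ∈ integralGL F, ∃ k' ∈ integralGL F, g.1 = k.1 * dMat ϖ m n * k'.1}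

lemma mk_mem_heckeSet_iff {m n : ℕ} {g : GL (Fin 3) F} :
    ProjGenLinGroup.mk g ∈ ProjGenLinGroup.mk '' heckeSet ϖ m n ↔
      ∃ c : F, c ≠ 0 ∧ IntegralEquiv (dMat ϖ m n) (c • g.1) := by
  constructor
  · rintro ⟨g', ⟨k, hk, k', hk', e⟩, h1⟩
    obtain ⟨c, hc, e'⟩ := mk_eq_mk_iff_smul.mp h1.symm
    exact ⟨c, hc, k.1, k'.1, hk, hk', e' ▸ e⟩
  · rintro ⟨c, hc, k, k', hk, hk', e⟩
    obtain ⟨k, hk, rfl⟩ := hk.exists_integralGL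
    obtain ⟨k', hk', rfl⟩ := hk'.exists_integralGL
    refine ⟨g * GeneralLinearGroup.scalar (Fin 3) (Units.mk0 c hc), ⟨k, hk, k', hk', ?_⟩, ?_⟩
    · rw [← e]
      ext i j
      simp [Matrix.scalar_apply, mul_comm]
    · simp

variable (h : IsNormalizedUniformizer ϖ q)

include h

/-- The Cartan decomposition: double cosets are determined by the norms of minors. -/
lemma mk_mem_heckeSet_iff_norm {m n : ℕ} {g : GL (Fin 3) F} :
    ProjGenLinGroup.mk g ∈ ProjGenLinGroup.mk '' heckeSet ϖ m n ↔
      entryNorm g.1 ^ 2 = q ^ (m : ℤ) * entryNorm g.1.adjugate ∧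
      entryNorm g.1.adjugate ^ 2 = q ^ (n : ℤ) * (entryNorm g.1 * ‖g.1.det‖) := by
  have hq := h.pos
  have hq0 := hq.ne'
  have hd1 : ‖ϖ ^ (-(n : ℤ))‖ ≤ ‖ϖ ^ (-(m : ℤ) - n)‖ := by
    rw [h.norm_zpow, h.norm_zpow, h.zpow_le_zpow_iff]; omega
  have hd2 : ‖(1 : F)‖ ≤ ‖ϖ ^ (-(n : ℤ))‖ := by
    rw [h.norm_zpow, norm_one, ← zpow_zero q, h.zpow_le_zpow_iff]; omega
  rw [mk_mem_heckeSet_iff]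
  constructor
  · rintro ⟨c, hc, h1⟩
    have c0 : ‖c‖ ≠ 0 := norm_ne_zero_iff.mpr hc
    have e1 := h1.entryNorm_eq
    have e2 := h1.entryNorm_adjugate_eq
    have e3 := h1.norm_det
    rw [dMat, entryNorm_diagonal hd1 hd2, entryNorm_smul, h.norm_zpow] at e1
    rw [dMat, entryNorm_adjugate_diagonal hd1 hd2, Matrix.adjugate_smul, entryNorm_smul,
      h.norm_zpow, h.norm_zpow, norm_pow] at e2
    rw [dMat, Matrix.det_diagonal, Matrix.det_smul, norm_mul] at e3
    simp [Fin.prod_univ_three] at e2 e3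
    rw [h.norm_eq] at e3
    set N1 := entryNorm g.1
    set N2 := entryNorm g.1.adjugate
    set N3 := ‖g.1.det‖
    have q1 : q ^ (-(-(m : ℤ) - n)) = q ^ m * q ^ n := by
      rw [← pow_add, ← zpow_natCast]; congr 1; push_cast; ring
    have q2 : q⁻¹ ^ (-(m : ℤ) - n) = q ^ m * q ^ n := by
      rw [_root_.inv_zpow, ← _root_.zpow_neg, q1]
    have q3 : q ^ ((n : ℤ) + m) = q ^ m * q ^ n := by
      rw [← pow_add, ← zpow_natCast]; congr 1; push_cast; ring
    rw [q1] at e1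
    rw [q3] at e2
    rw [q2, _root_.inv_pow, inv_inv] at e3
    rw [zpow_natCast, zpow_natCast]
    -- Both relations are homogeneous under scaling of the matrix, of degrees 2 and 4, so they are
    -- checked after multiplication by powers of `‖c‖`.
    constructor
    · apply mul_left_cancel₀ (pow_ne_zero 2 c0)
      calc ‖c‖ ^ 2 * N1 ^ 2 = (‖c‖ * N1) ^ 2 := by ring
        _ = q ^ m * (‖c‖ ^ 2 * N2) := by rw [e1, e2]; ring
        _ = _ := by ring
    · apply mul_left_cancel₀ (pow_ne_zero 4 c0)
      calc ‖c‖ ^ 4 * N2 ^ 2 = (‖c‖ ^ 2 * N2) ^ 2 := by ring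
        _ = q ^ n * ((‖c‖ * N1) * (‖c‖ ^ 3 * N3)) := by rw [e1, e2, e3]; ring
        _ = _ := by ring
  · rintro ⟨c1, c2⟩
    have hdet : g.1.det ≠ 0 := g.det_ne_zero
    obtain ⟨d₁, d₂, d₃, h1, n1, n2, n3, l1, l2⟩ := exists_integralEquiv_diagonal g.1 hdet
    rw [← h1.entryNorm_eq, ← h1.entryNorm_adjugate_eq, entryNorm_diagonal l2 l1,
      entryNorm_adjugate_diagonal l2 l1] at c1 c2
    rw [← h1.norm_det, Matrix.det_diagonal] at c2
    simp [Fin.prod_univ_three] at c1 c2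
    obtain ⟨k1, e1⟩ := h.exists_zpow d₁ n1
    obtain ⟨k2, e2⟩ := h.exists_zpow d₂ n2
    obtain ⟨k3, e3⟩ := h.exists_zpow d₃ n3
    have r1 : k1 - k2 = m := by
      rw [e1, e2, ← zpow_natCast, ← zpow_natCast, ← _root_.zpow_mul, ← zpow_add₀ hq0, ← zpow_add₀ hq0,
        h.zpow_inj] at c1
      push_cast at c1
      omega
    have r2 : k2 - k3 = n := by
      rw [e1, e2, e3, ← zpow_natCast, ← zpow_natCast, ← zpow_add₀ hq0, ← _root_.zpow_mul,
        ← zpow_add₀ hq0, ← zpow_add₀ hq0, ← zpow_add₀ hq0, h.zpow_inj] at c2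
      push_cast at c2
      omega
    -- Scaling makes the last diagonal entry one. The norms of the others are then those of
    -- `d_{m,n}`, and the discrepancy is a diagonal matrix of units.
    refine ⟨d₃⁻¹, inv_ne_zero n3, ?_⟩
    refine IntegralEquiv.trans ?_ (h1.smul d₃⁻¹).symm
    refine ⟨1, Matrix.diagonal ![d₃⁻¹ * d₁ * ϖ ^ ((m : ℤ) + n), d₃⁻¹ * d₂ * ϖ ^ (n : ℤ), 1],
      isIntegralUnit_one, isIntegralUnit_diagonal ?_ ?_ (by simp), ?_⟩
    · rw [norm_mul, norm_mul, norm_inv, h.norm_zpow, e1, e3, ← _root_.zpow_neg, ← zpow_add₀ hq0,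
        ← zpow_add₀ hq0, ← zpow_zero q]
      congr 1; omega
    · rw [norm_mul, norm_mul, norm_inv, h.norm_zpow, e2, e3, ← _root_.zpow_neg, ← zpow_add₀ hq0,
        ← zpow_add₀ hq0, ← zpow_zero q]
      congr 1; omega
    · have w0 := h.ne_zero
      have w1 := pow_ne_zero n w0
      have w2 := pow_ne_zero m w0
      rw [one_mul, dMat, Matrix.diagonal_mul_diagonal, ← Matrix.diagonal_smul]
      congr 1
      have x1 : ϖ ^ (-(m : ℤ) - n) = (ϖ ^ m)⁻¹ * (ϖ ^ n)⁻¹ := by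
        rw [sub_eq_add_neg, zpow_add₀ w0, _root_.zpow_neg, _root_.zpow_neg, zpow_natCast,
          zpow_natCast]
      have x2 : ϖ ^ ((m : ℤ) + n) = ϖ ^ m * ϖ ^ n := by
        rw [zpow_add₀ w0, zpow_natCast, zpow_natCast]
      ext i
      fin_cases i <;> simp [x1, x2, n3] <;> field_simp

omit h in
-- A column operation of determinant one kills the entry of smaller norm and, if needed, also
-- exchanges the columns. It serves the Iwasawa decompositions of both `GL₃` and `SL₂`.
lemma exists_column_op (a b : F) : ∃ α β γ δ : F, ‖α‖ ≤ 1 ∧ ‖β‖ ≤ 1 ∧ ‖γ‖ ≤ 1 ∧ ‖δ‖ ≤ 1 ∧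
    α * δ - β * γ = 1 ∧ a * α + b * γ = 0 := by
  rcases le_or_gt ‖a‖ ‖b‖ with hab | hab
  · by_cases hb : b = 0
    · have ha : a = 0 := by simpa [hb] using hab
      exact ⟨1, 0, 0, 1, by simp, by simp, by simp, by simp, by ring, by rw [ha, hb]; ring⟩
    · exact ⟨1, 0, -(a / b), 1, by simp, by simp, norm_neg_div_le_one hab, by simp, by ring,
        by field_simp; ring⟩
  · have ha : a ≠ 0 := norm_pos_iff.mp ((norm_nonneg b).trans_lt hab)
    exact ⟨-(b / a), -1, 1, 0, norm_neg_div_le_one hab.le, by simp, by simp, by simp, by ring,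
      by field_simp; ring⟩

omit h in
-- The first two operations clear the last row left of the diagonal. The third mixes only the first
-- two columns, whose last entries are already zero.
lemma exists_mul_upper (A : Matrix (Fin 3) (Fin 3) F) : ∃ k : Matrix (Fin 3) (Fin 3) F,
    IsIntegralUnit k ∧
    (A * k) 1 0 = 0 ∧ (A * k) 2 0 = 0 ∧ (A * k) 2 1 = 0 := by
  obtain ⟨α, β, γ, δ, hα, hβ, hγ, hδ, hdet, he⟩ := exists_column_op (A 2 0) (A 2 2)
  set k₁ : Matrix (Fin 3) (Fin 3) F := !![α, 0, β; 0, 1, 0; γ, 0, δ] with hk₁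
  have i₁ : IsIntegralUnit k₁ := by
    refine ⟨fun i j => ?_, ?_⟩
    · fin_cases i <;> fin_cases j <;> simp [*]
    · rw [hk₁, Matrix.det_fin_three]; simp [hdet]
  set B := A * k₁ with hB
  have b20 : B 2 0 = 0 := by
    simp [hB, hk₁, Matrix.mul_apply, Fin.sum_univ_three, he]
  obtain ⟨α', β', γ', δ', hα', hβ', hγ', hδ', hdet', he'⟩ := exists_column_op (B 2 1) (B 2 2)
  set k₂ : Matrix (Fin 3) (Fin 3) F := !![1, 0, 0; 0, α', β'; 0, γ', δ'] with hk₂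
  have i₂ : IsIntegralUnit k₂ := by
    refine ⟨fun i j => ?_, ?_⟩
    · fin_cases i <;> fin_cases j <;> simp [*]
    · rw [hk₂, Matrix.det_fin_three]; simp [hdet']
  set C := B * k₂ with hC
  have c20 : C 2 0 = 0 := by simp [hC, hk₂, Matrix.mul_apply, Fin.sum_univ_three, b20]
  have c21 : C 2 1 = 0 := by simp [hC, hk₂, Matrix.mul_apply, Fin.sum_univ_three, he']
  obtain ⟨α'', β'', γ'', δ'', hα'', hβ'', hγ'', hδ'', hdet'', he''⟩ :=
    exists_column_op (C 1 0) (C 1 1)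
  set k₃ : Matrix (Fin 3) (Fin 3) F := !![α'', β'', 0; γ'', δ'', 0; 0, 0, 1] with hk₃
  have i₃ : IsIntegralUnit k₃ := by
    refine ⟨fun i j => ?_, ?_⟩
    · fin_cases i <;> fin_cases j <;> simp [*]
    · rw [hk₃, Matrix.det_fin_three]; simp [hdet'']
  refine ⟨k₁ * k₂ * k₃, (i₁.mul i₂).mul i₃, ?_⟩
  have e : A * (k₁ * k₂ * k₃) = C * k₃ := by rw [hC, hB]; simp only [mul_assoc]
  rw [e]
  refine ⟨?_, ?_, ?_⟩ <;> simp [hk₃, Matrix.mul_apply, Fin.sum_univ_three, c20, c21, he'']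

lemma exists_eq_zpow_mul (d : F) (hd : d ≠ 0) : ∃ (k : ℤ) (ε : F), ‖ε‖ = 1 ∧ d = ϖ ^ k * ε := by
  obtain ⟨k, hk⟩ := h.exists_zpow d hd
  have w := zpow_ne_zero (-k) h.ne_zero
  refine ⟨-k, (ϖ ^ (-k))⁻¹ * d, ?_, (mul_inv_cancel_left₀ w d).symm⟩
  rw [norm_mul, norm_inv, h.norm_zpow, neg_neg, hk, inv_mul_cancel₀]
  exact (zpow_pos h.pos k).ne'

/-- The Iwasawa decomposition. -/
lemma exists_iwasawa (g : GL (Fin 3) F) : ∃ (i j : ℤ) (x y z : F), ∃ k ∈ integralGL F,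
    ProjGenLinGroup.mk g = ProjGenLinGroup.mk (unipGL x y z * torusGL h.ne_zero i j * k) := by
  obtain ⟨k, hk, h10, h20, h21⟩ := exists_mul_upper g.1
  obtain ⟨κ, hκ, rfl⟩ := hk.exists_integralGL
  have hdet : (g.1 * κ.1).det ≠ 0 := (g * κ).det_ne_zero
  set U := g.1 * κ.1 with hU
  rw [Matrix.det_fin_three, h10, h20, h21] at hdet
  simp at hdet
  obtain ⟨⟨d0, d1⟩, d2⟩ := hdet
  obtain ⟨k0, ε0, n0, e0⟩ := exists_eq_zpow_mul h _ d0
  obtain ⟨k1, ε1, n1, e1⟩ := exists_eq_zpow_mul h _ d1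
  obtain ⟨k2, ε2, n2, e2⟩ := exists_eq_zpow_mul h _ d2
  obtain ⟨κ', hκ', eκ'⟩ := (isIntegralUnit_diagonal n0 n1 n2).exists_integralGL
  have w0 := h.ne_zero
  refine ⟨k0 - k1, k1 - k2, U 0 1 / U 1 1, U 1 2 / U 2 2, U 0 2 / U 2 2, κ' * κ⁻¹,
    (integralSubgroup F).mul_mem hκ' (inv_mem_integralGL hκ), ?_⟩
  symm
  refine mk_eq_mk_iff_smul.mpr ⟨ϖ ^ k2, zpow_ne_zero _ w0, ?_⟩
  have key : U = ϖ ^ k2 • (unipMat (U 0 1 / U 1 1) (U 1 2 / U 2 2) (U 0 2 / U 2 2) *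
      Matrix.diagonal ![ϖ ^ (k0 - k1 + (k1 - k2)), ϖ ^ (k1 - k2), 1] *
      Matrix.diagonal ![ε0, ε1, ε2]) := by
    have x1 : ϖ ^ k2 * ϖ ^ (k0 - k2) = ϖ ^ k0 := by
      rw [← zpow_add₀ w0]; congr 1; ring
    have x2 : ϖ ^ k2 * ϖ ^ (k1 - k2) = ϖ ^ k1 := by
      rw [← zpow_add₀ w0]; congr 1; ring
    rw [mul_assoc, Matrix.diagonal_mul_diagonal]
    ext a b
    rw [Matrix.smul_apply, Matrix.mul_diagonal]
    fin_cases a <;> fin_cases b <;> simp [unipMat, h10, h20, h21]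
    · rw [← mul_assoc, x1, e0]
    · rw [mul_left_comm, ← mul_assoc (ϖ ^ k2), x2, ← e1, div_mul_cancel₀ _ d1]
    · rw [mul_left_comm, ← e2, div_mul_cancel₀ _ d2]
    · rw [← mul_assoc, x2, e1]
    · rw [mul_left_comm, ← e2, div_mul_cancel₀ _ d2]
    · exact e2
  have hg : g.1 = U * κ⁻¹.1 := by rw [hU, mul_assoc, Units.mul_inv, mul_one]
  rw [hg]
  conv_lhs => rw [key]
  rw [← eκ']
  simp only [Units.val_mul, smul_mul_assoc, mul_assoc]
  rfl

end Decompositions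

/-! ### Left cosets of `K` and membership in the double coset in Iwasawa coordinates. -/

section CosetRepresentatives

variable {F : Type*} [NontriviallyNormedField F] [IsUltrametricDist F] [ProperSpace F]
  [MeasurableSpace F] [BorelSpace F] {ϖ : F} {q : ℝ} (h : IsNormalizedUniformizer ϖ q)

lemma unipGL_inv_mul (x y z x' y' z' : F) : (unipGL x y z)⁻¹ * unipGL x' y' z' =
    unipGL (x' - x) (y' - y) (z' - z - x * (y' - y)) := by
  refine Units.ext ?_
  change unipMat (-x) (-y) (x * y - z) * unipMat x' y' z' = unipMat _ _ _
  rw [unipMat_mul]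
  congr 1 <;> ring

lemma eq_one_of_mul_mul_eq_one {r s t : ℝ} (hr : 0 ≤ r) (hs : 0 ≤ s) (ht : 0 ≤ t) (hr1 : r ≤ 1)
    (hs1 : s ≤ 1) (ht1 : t ≤ 1) (hrst : r * s * t = 1) : r = 1 ∧ s = 1 ∧ t = 1 := by
  refine ⟨?_, ?_, ?_⟩ <;> refine le_antisymm (by assumption) ?_
  · nlinarith [mul_le_one₀ hs1 ht ht1, mul_nonneg hs ht]
  · nlinarith [mul_le_one₀ hr1 ht ht1, mul_nonneg hr ht]
  · nlinarith [mul_le_one₀ hr1 hs hs1, mul_nonneg hr hs]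

include h

/-- The matrix `M` comparing the two elements is upper triangular with last diagonal entry one. If
`c • M` is integral with unit determinant, its diagonal entries have norm at most one and product of
norm one. So all of them are units, `‖c‖ = 1`, and the off-diagonal entries give the stated bounds.
-/
lemma mk_unip_torus_eq_iff (i j i' j' : ℤ) (x y z x' y' z' : F) :
    (∃ κ ∈ integralGL F, ProjGenLinGroup.mk (unipGL x' y' z' * torusGL h.ne_zero i' j') =
      ProjGenLinGroup.mk (unipGL x y z * torusGL h.ne_zero i j * κ)) ↔
    i' = i ∧ j' = j ∧ ‖x' - x‖ ≤ q ^ (-i) ∧ ‖y' - y‖ ≤ q ^ (-j) ∧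
      ‖z' - z - x * (y' - y)‖ ≤ q ^ (-(i + j)) := by
  set M : GL (Fin 3) F := (torusGL h.ne_zero i j)⁻¹ * unipGL (x' - x) (y' - y)
    (z' - z - x * (y' - y)) * torusGL h.ne_zero i' j' with hM
  have hM1 : unipGL x' y' z' * torusGL h.ne_zero i' j' =
      unipGL x y z * torusGL h.ne_zero i j * M := by
    rw [hM, ← unipGL_inv_mul]; group
  have hMe : M.1 = Matrix.diagonal ![ϖ ^ (-(i + j)), ϖ ^ (-j), 1] * unipMat (x' - x) (y' - y)
    (z' - z - x * (y' - y)) * Matrix.diagonal ![ϖ ^ (i' + j'), ϖ ^ j', 1] := rfl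
  have m00 : M.1 0 0 = ϖ ^ (-(i + j)) * ϖ ^ (i' + j') := by
    rw [hMe, Matrix.mul_diagonal, Matrix.diagonal_mul]; simp [unipMat]
  have m11 : M.1 1 1 = ϖ ^ (-j) * ϖ ^ j' := by
    rw [hMe, Matrix.mul_diagonal, Matrix.diagonal_mul]; simp [unipMat]
  have m22 : M.1 2 2 = 1 := by
    rw [hMe, Matrix.mul_diagonal, Matrix.diagonal_mul]; simp [unipMat]
  have m01 : M.1 0 1 = ϖ ^ (-(i + j)) * (x' - x) * ϖ ^ j' := by
    rw [hMe, Matrix.mul_diagonal, Matrix.diagonal_mul]; simp [unipMat]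
  have m02 : M.1 0 2 = ϖ ^ (-(i + j)) * (z' - z - x * (y' - y)) := by
    rw [hMe, Matrix.mul_diagonal, Matrix.diagonal_mul]; simp [unipMat]
  have m12 : M.1 1 2 = ϖ ^ (-j) * (y' - y) := by
    rw [hMe, Matrix.mul_diagonal, Matrix.diagonal_mul]; simp [unipMat]
  have m10 : M.1 1 0 = 0 := by
    rw [hMe, Matrix.mul_diagonal, Matrix.diagonal_mul]; simp [unipMat]
  have m20 : M.1 2 0 = 0 := by
    rw [hMe, Matrix.mul_diagonal, Matrix.diagonal_mul]; simp [unipMat]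
  have m21 : M.1 2 1 = 0 := by
    rw [hMe, Matrix.mul_diagonal, Matrix.diagonal_mul]; simp [unipMat]
  have hMdet : M.1.det = M.1 0 0 * M.1 1 1 * M.1 2 2 := by
    rw [Matrix.det_fin_three, m10, m20, m21]; ring
  have hq0 := h.pos.ne'
  have le_iff : ∀ (k : ℤ) (t : ℝ), q ^ k * t ≤ 1 ↔ t ≤ q ^ (-k) := by
    intro k t
    rw [_root_.zpow_neg, ← one_div, le_div_iff₀' (zpow_pos h.pos k)]
  constructor
  · rintro ⟨κ, hκ, e⟩
    rw [hM1, map_mul, map_mul _ _ κ, mul_left_cancel_iff] at e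
    obtain ⟨c, hc, e⟩ := mk_eq_mk_iff_smul.mp e
    have hen : ∀ a b, ‖c‖ * ‖M.1 a b‖ ≤ 1 := by
      intro a b
      have := hκ.1 a b
      rwa [e, Matrix.smul_apply, norm_smul] at this
    have hdet := hκ.2
    rw [e, Matrix.det_smul, hMdet, norm_mul, norm_pow, norm_mul, norm_mul] at hdet
    simp only [Fintype.card_fin] at hdet
    obtain ⟨d0, d1, d2⟩ := eq_one_of_mul_mul_eq_one
      (mul_nonneg (norm_nonneg _) (norm_nonneg _)) (mul_nonneg (norm_nonneg _) (norm_nonneg _))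
      (mul_nonneg (norm_nonneg _) (norm_nonneg _)) (hen 0 0) (hen 1 1) (hen 2 2)
      (by rw [← hdet]; ring)
    rw [m22, norm_one, mul_one] at d2
    rw [d2, one_mul, m11, norm_mul, h.norm_zpow, h.norm_zpow, ← zpow_add₀ hq0, ← zpow_zero q,
      h.zpow_inj] at d1
    rw [d2, one_mul, m00, norm_mul, h.norm_zpow, h.norm_zpow, ← zpow_add₀ hq0, ← zpow_zero q,
      h.zpow_inj] at d0
    have x1 := hen 0 1
    have x2 := hen 0 2
    have x3 := hen 1 2
    rw [d2, one_mul] at x1 x2 x3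
    have hj : j' = j := by omega
    rw [m01, norm_mul, norm_mul, h.norm_zpow, h.norm_zpow, mul_right_comm, ← zpow_add₀ hq0,
      le_iff] at x1
    rw [m02, norm_mul, h.norm_zpow, le_iff] at x2
    rw [m12, norm_mul, h.norm_zpow, le_iff] at x3
    refine ⟨by omega, hj, ?_, ?_, ?_⟩
    · convert x1 using 2; omega
    · convert x3 using 2; omega
    · convert x2 using 2; omega
  · rintro ⟨rfl, rfl, hx, hy, hz⟩
    refine ⟨M, ⟨fun a b => ?_, ?_⟩, by rw [hM1]⟩
    · fin_cases a <;> fin_cases b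
      · change ‖M.1 0 0‖ ≤ 1
        rw [m00, ← zpow_add₀ h.ne_zero]; simp
      · change ‖M.1 0 1‖ ≤ 1
        rw [m01, norm_mul, norm_mul, h.norm_zpow, h.norm_zpow, mul_right_comm, ← zpow_add₀ hq0,
          le_iff]
        convert hx using 2; omega
      · change ‖M.1 0 2‖ ≤ 1
        rw [m02, norm_mul, h.norm_zpow, le_iff]
        convert hz using 2; omega
      · change ‖M.1 1 0‖ ≤ 1
        rw [m10]; simp
      · change ‖M.1 1 1‖ ≤ 1
        rw [m11, ← zpow_add₀ h.ne_zero]; simp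
      · change ‖M.1 1 2‖ ≤ 1
        rw [m12, norm_mul, h.norm_zpow, le_iff]
        convert hy using 2; omega
      · change ‖M.1 2 0‖ ≤ 1
        rw [m20]; simp
      · change ‖M.1 2 1‖ ≤ 1
        rw [m21]; simp
      · change ‖M.1 2 2‖ ≤ 1
        rw [m22]; simp
    · rw [hMdet, m00, m11, m22, ← zpow_add₀ h.ne_zero, ← zpow_add₀ h.ne_zero]; simp

lemma entryNorm_unip_torus {i j : ℤ} (hi : 0 ≤ i) (hj : 0 ≤ j) (x y z : F) :
    entryNorm (unipGL x y z * torusGL h.ne_zero i j).1 =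
      max 1 (max (q ^ (-j) * ‖x‖) (max ‖y‖ ‖z‖)) := by
  have e : (unipGL x y z * torusGL h.ne_zero i j).1 =
      !![ϖ ^ (i + j), x * ϖ ^ j, z; 0, ϖ ^ j, y; 0, 0, 1] := by
    change unipMat x y z * Matrix.diagonal ![ϖ ^ (i + j), ϖ ^ j, 1] = _
    ext a b
    rw [Matrix.mul_diagonal]
    fin_cases a <;> fin_cases b <;> simp [unipMat]
  have l1 : q ^ (-(i + j)) ≤ 1 := by
    rw [← zpow_zero q, h.zpow_le_zpow_iff]; omega
  have l2 : q ^ (-j) ≤ 1 := by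
    rw [← zpow_zero q, h.zpow_le_zpow_iff]; omega
  rw [e]
  apply le_antisymm
  · rw [entryNorm_le_iff (le_max_of_le_left zero_le_one)]
    intro a b
    fin_cases a <;> fin_cases b <;>
      simp only [Fin.zero_eta, Fin.mk_one, Fin.reduceFinMk, Matrix.of_apply, Matrix.cons_val,
        norm_mul, h.norm_zpow, norm_zero, norm_one]
    · exact le_max_of_le_left l1
    · rw [mul_comm]; exact le_max_of_le_right (le_max_left _ _)
    · exact le_max_of_le_right (le_max_of_le_right (le_max_right _ _))
    · exact le_max_of_le_left zero_le_one
    · exact le_max_of_le_left l2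
    · exact le_max_of_le_right (le_max_of_le_right (le_max_left _ _))
    · exact le_max_of_le_left zero_le_one
    · exact le_max_of_le_left zero_le_one
    · exact le_max_left _ _
  · refine max_le ?_ (max_le ?_ (max_le ?_ ?_))
    · refine le_of_eq_of_le ?_ (norm_le_entryNorm _ 2 2); simp
    · refine le_of_eq_of_le ?_ (norm_le_entryNorm _ 0 1)
      simp only [Matrix.of_apply, Matrix.cons_val, norm_mul, h.norm_zpow, mul_comm]
    · refine le_of_eq_of_le ?_ (norm_le_entryNorm _ 1 2); simp
    · refine le_of_eq_of_le ?_ (norm_le_entryNorm _ 0 2); simp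

lemma entryNorm_adjugate_unip_torus {i j : ℤ} (hi : 0 ≤ i) (hj : 0 ≤ j) (x y z : F) :
    entryNorm (unipGL x y z * torusGL h.ne_zero i j).1.adjugate =
      q ^ (-j) * max 1 (max ‖x‖ (max (q ^ (-i) * ‖y‖) ‖x * y - z‖)) := by
  have w0 := h.ne_zero
  have e : (unipGL x y z * torusGL h.ne_zero i j).1.adjugate = ϖ ^ j •
      !![1, -x, x * y - z; 0, ϖ ^ i, -(ϖ ^ i * y); 0, 0, ϖ ^ (i + j)] := by
    change (unipMat x y z * Matrix.diagonal ![ϖ ^ (i + j), ϖ ^ j, 1]).adjugate = _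
    have e1 : unipMat x y z * Matrix.diagonal ![ϖ ^ (i + j), ϖ ^ j, 1] =
        !![ϖ ^ (i + j), x * ϖ ^ j, z; 0, ϖ ^ j, y; 0, 0, 1] := by
      ext a b
      rw [Matrix.mul_diagonal]
      fin_cases a <;> fin_cases b <;> simp [unipMat]
    rw [e1, Matrix.adjugate_fin_three]
    ext a b
    fin_cases a <;> fin_cases b <;> simp [zpow_add₀ w0] <;> ring
  have l1 : q ^ (-(i + j)) ≤ 1 := by
    rw [← zpow_zero q, h.zpow_le_zpow_iff]; omega
  have l2 : q ^ (-i) ≤ 1 := by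
    rw [← zpow_zero q, h.zpow_le_zpow_iff]; omega
  rw [e, entryNorm_smul, h.norm_zpow]
  congr 1
  apply le_antisymm
  · rw [entryNorm_le_iff (le_max_of_le_left zero_le_one)]
    intro a b
    fin_cases a <;> fin_cases b <;>
      simp only [Fin.zero_eta, Fin.mk_one, Fin.reduceFinMk, Matrix.of_apply, Matrix.cons_val,
        norm_mul, norm_neg, h.norm_zpow, norm_zero, norm_one]
    · exact le_max_left _ _
    · exact le_max_of_le_right (le_max_left _ _)
    · exact le_max_of_le_right (le_max_of_le_right (le_max_right _ _))
    · exact le_max_of_le_left zero_le_one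
    · exact le_max_of_le_left l2
    · exact le_max_of_le_right (le_max_of_le_right (le_max_left _ _))
    · exact le_max_of_le_left zero_le_one
    · exact le_max_of_le_left zero_le_one
    · exact le_max_of_le_left l1
  · refine max_le ?_ (max_le ?_ (max_le ?_ ?_))
    · refine le_of_eq_of_le ?_ (norm_le_entryNorm _ 0 0); simp
    · refine le_of_eq_of_le ?_ (norm_le_entryNorm _ 0 1); simp
    · refine le_of_eq_of_le ?_ (norm_le_entryNorm _ 1 2)
      simp only [Matrix.of_apply, Matrix.cons_val, norm_neg, norm_mul, h.norm_zpow]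
    · refine le_of_eq_of_le ?_ (norm_le_entryNorm _ 0 2); simp

lemma norm_det_unip_torus (i j : ℤ) (x y z : F) :
    ‖(unipGL x y z * torusGL h.ne_zero i j).1.det‖ = q ^ (-(i + 2 * j)) := by
  change ‖(unipMat x y z * Matrix.diagonal ![ϖ ^ (i + j), ϖ ^ j, 1]).det‖ = _
  rw [Matrix.det_mul, Matrix.det_diagonal]
  have : (unipMat x y z).det = 1 := by simp [unipMat, Matrix.det_fin_three]
  rw [this, one_mul, Fin.prod_univ_three]
  simp only [Matrix.cons_val, mul_one, norm_mul, h.norm_zpow]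
  rw [← zpow_add₀ h.pos.ne']
  congr 1
  ring

lemma exists_max_one_eq_zpow {t : ℝ} (ht : IsZeroOrZPow q t) : ∃ r : ℕ, max 1 t = q ^ (r : ℤ) := by
  have h1 : IsZeroOrZPow q (max 1 t) := IsZeroOrZPow.max (Or.inr ⟨0, by simp⟩) ht
  rcases h1 with h0 | ⟨k, hk⟩
  · exact absurd h0 (lt_of_lt_of_le one_pos (le_max_left _ _)).ne'
  · have : (1 : ℝ) ≤ q ^ k := hk ▸ le_max_left _ _
    rw [← zpow_zero q, h.zpow_le_zpow_iff] at this
    exact ⟨k.toNat, by rw [hk, Int.toNat_of_nonneg this]⟩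

/-- Entries, minors and determinant have maximal norms `q^r`, `q^(l-j)` and `q^(-(i+2j))`. Comparing
exponents in `mk_mem_heckeSet_iff_norm` gives the two linear equations for `i` and `j`. -/
lemma mk_unip_torus_mem_heckeSet_iff {m n : ℕ} {i j : ℤ} (hi : 0 ≤ i) (hj : 0 ≤ j) (x y z : F) :
    ProjGenLinGroup.mk (unipGL x y z * torusGL h.ne_zero i j) ∈
        ProjGenLinGroup.mk '' heckeSet ϖ m n ↔
      ∃ r l : ℕ, i = n + r - 2 * l ∧ j = m + l - 2 * r ∧
        max 1 (max (q ^ (-j) * ‖x‖) (max ‖y‖ ‖z‖)) = q ^ (r : ℤ) ∧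
        max 1 (max ‖x‖ (max (q ^ (-i) * ‖y‖) ‖x * y - z‖)) = q ^ (l : ℤ) := by
  have hq0 := h.pos.ne'
  obtain ⟨r, hr⟩ := exists_max_one_eq_zpow h
    ((h.isZeroOrZPow_zpow_mul (-j) (h.isZeroOrZPow_norm x)).max
      ((h.isZeroOrZPow_norm y).max (h.isZeroOrZPow_norm z)))
  obtain ⟨l, hl⟩ := exists_max_one_eq_zpow h ((h.isZeroOrZPow_norm x).max
      ((h.isZeroOrZPow_zpow_mul (-i) (h.isZeroOrZPow_norm y)).max
        (h.isZeroOrZPow_norm (x * y - z))))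
  rw [mk_mem_heckeSet_iff_norm h, entryNorm_unip_torus h hi hj,
    entryNorm_adjugate_unip_torus h hi hj, norm_det_unip_torus h, hr, hl, ← zpow_add₀ hq0,
    ← zpow_add₀ hq0, ← zpow_add₀ hq0, ← zpow_add₀ hq0, ← zpow_natCast, ← zpow_natCast,
    ← _root_.zpow_mul, ← _root_.zpow_mul, h.zpow_inj, h.zpow_inj]
  push_cast
  constructor
  · rintro ⟨h1, h2⟩
    exact ⟨r, l, by omega, by omega, rfl, rfl⟩
  · rintro ⟨r', l', h1, h2, h3, h4⟩
    rw [h.zpow_inj] at h3 h4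
    omega

end CosetRepresentatives

/-! ### Hecke operators as finite sums -/

section Topology

variable {F : Type*} [NontriviallyNormedField F] [IsUltrametricDist F] [ProperSpace F]
  [MeasurableSpace F] [BorelSpace F]

instance : IsTopologicalGroup PGL(3, F) :=
  inferInstanceAs (IsTopologicalGroup (GL (Fin 3) F ⧸ Subgroup.center (GL (Fin 3) F)))

lemma continuous_mk : Continuous (ProjGenLinGroup.mk : GL (Fin 3) F → PGL(3, F)) :=
  QuotientGroup.continuous_mk

lemma isOpenMap_mk : IsOpenMap (ProjGenLinGroup.mk : GL (Fin 3) F → PGL(3, F)) :=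
  QuotientGroup.isOpenMap_coe

lemma isOpen_integralGL : IsOpen (integralGL F) := by
  have h1 : IsOpen (Metric.closedBall (0 : F) 1) :=
    IsUltrametricDist.isOpen_closedBall 0 one_ne_zero
  have h2 : IsOpen (Metric.sphere (0 : F) 1) :=
    IsUltrametricDist.isOpen_sphere 0 one_ne_zero
  have e : integralGL F = (⋂ i : Fin 3, ⋂ j : Fin 3,
      (fun g : GL (Fin 3) F => g i j) ⁻¹' Metric.closedBall (0 : F) 1) ∩
      (fun g : GL (Fin 3) F => g.1.det) ⁻¹' Metric.sphere (0 : F) 1 := by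
    ext g
    simp [integralGL]
  rw [e]
  refine IsOpen.inter ?_ (h2.preimage (Units.continuous_val.matrix_det))
  refine isOpen_iInter_of_finite fun i => isOpen_iInter_of_finite fun j => h1.preimage ?_
  exact (continuous_apply j).comp (GeneralLinearGroup.continuous_apply _ continuous_id i)

lemma isCompact_integralGL : IsCompact (integralGL F) := by
  have hc : IsCompact {A : Matrix (Fin 3) (Fin 3) F | ∀ i j, ‖A i j‖ ≤ 1} := by
    have := isCompact_univ_pi (fun _ : Fin 3 => isCompact_univ_pi
      (fun _ : Fin 3 => isCompact_closedBall (0 : F) 1))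
    have e : {A : Fin 3 → Fin 3 → F | ∀ i j, ‖A i j‖ ≤ 1} = Set.univ.pi fun _ : Fin 3 =>
        Set.univ.pi fun _ : Fin 3 => Metric.closedBall (0 : F) 1 := by
      ext A
      simp [Set.mem_pi]
    rw [← e] at this
    exact this
  have h2 : IsCompact (Units.embedProduct (Matrix (Fin 3) (Fin 3) F) ⁻¹'
      ({A : Matrix (Fin 3) (Fin 3) F | ∀ i j, ‖A i j‖ ≤ 1} ×ˢ
        (MulOpposite.unop ⁻¹' {A : Matrix (Fin 3) (Fin 3) F | ∀ i j, ‖A i j‖ ≤ 1}))) := by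
    refine Units.isClosedEmbedding_embedProduct.isCompact_preimage (hc.prod ?_)
    exact (MulOpposite.opHomeomorph (M := Matrix (Fin 3) (Fin 3) F)).symm.isClosedEmbedding.isCompact_preimage hc
  convert h2 using 1
  ext g
  simp only [Set.mem_preimage, Units.embedProduct_apply, Set.mem_prod, Set.mem_ofPred_eq,
    MulOpposite.unop_op]
  constructor
  · intro hg
    exact ⟨hg.1, (inv_mem_integralGL hg).1⟩
  · rintro ⟨h1, h3⟩
    refine ⟨h1, ?_⟩
    have n1 := norm_det_le_one h1
    have n2 := norm_det_le_one h3
    have n3 : g.1.det * (g⁻¹).1.det = 1 := by rw [← Matrix.det_mul, Units.mul_inv, Matrix.det_one]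
    have n4 := congrArg norm n3
    rw [norm_mul, norm_one] at n4
    nlinarith [norm_nonneg g.1.det, norm_nonneg (g⁻¹).1.det]

variable (F) in
/-- `KZ/Z` as a subgroup of `PGL₃(F)`. -/
def integralPGLSubgroup : Subgroup PGL(3, F) := (integralSubgroup F).map ProjGenLinGroup.mk

lemma isOpen_integralPGL : IsOpen (integralPGL F) := isOpenMap_mk _ isOpen_integralGL

lemma isCompact_image_heckeSet {ϖ : F} (h0 : ϖ ≠ 0) (m n : ℕ) :
    IsCompact (ProjGenLinGroup.mk '' heckeSet ϖ m n) := by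
  have hd : (dMat ϖ m n).det ≠ 0 := by
    rw [dMat, Matrix.det_diagonal, Fin.prod_univ_three]
    simp [zpow_ne_zero _ h0, h0]
  obtain ⟨d, hd⟩ : ∃ d : GL (Fin 3) F, d.1 = dMat ϖ m n :=
    ⟨GeneralLinearGroup.mkOfDetNeZero _ hd, rfl⟩
  have e : heckeSet ϖ m n = (fun p : GL (Fin 3) F × GL (Fin 3) F => p.1 * d * p.2) ''
      (integralGL F ×ˢ integralGL F) := by
    ext g
    constructor
    · rintro ⟨k, hk, k', hk', e⟩
      exact ⟨(k, k'), ⟨hk, hk'⟩, Units.ext (by rw [e, ← hd]; rfl)⟩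
    · rintro ⟨⟨k, k'⟩, ⟨hk, hk'⟩, rfl⟩
      exact ⟨k, hk, k', hk', by rw [← hd]; rfl⟩
  rw [e]
  refine ((isCompact_integralGL.prod isCompact_integralGL).image ?_).image continuous_mk
  fun_prop

end Topology

/-! ### Integration of functions invariant under an open subgroup. -/

section CosetIntegral

lemma integral_comp_quotient_mk {G : Type*} [Group G] [TopologicalSpace G] [IsTopologicalGroup G]
    [MeasurableSpace G] [BorelSpace G] (μ : Measure G) [μ.IsMulLeftInvariant] (K : Subgroup G)
    (hK : IsOpen (K : Set G)) (hμ : μ (K : Set G) = 1) (f : G ⧸ K → ℂ) (T : Finset (G ⧸ K))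
    (hf : ∀ c, c ∉ T → f c = 0) :
    ∫ g, f (QuotientGroup.mk g) ∂μ = ∑ c ∈ T, f c := by
  classical
  have hmeas : ∀ c : G ⧸ K, MeasurableSet (QuotientGroup.mk ⁻¹' {c} : Set G) := by
    intro c
    have := QuotientGroup.discreteTopology hK
    exact ((isOpen_discrete {c}).preimage QuotientGroup.continuous_mk).measurableSet
  have hvol : ∀ c : G ⧸ K, μ (QuotientGroup.mk ⁻¹' {c} : Set G) = 1 := by
    intro c
    induction c using QuotientGroup.induction_on with
    | H g =>
      rw [← hμ, ← measure_preimage_mul μ g⁻¹ (K : Set G)]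
      congr 1
      ext x
      simp only [Set.mem_preimage, Set.mem_singleton_iff, SetLike.mem_coe]
      rw [eq_comm, QuotientGroup.eq]
  have e : ∀ g : G, f (QuotientGroup.mk g) =
      ∑ c ∈ T, (QuotientGroup.mk ⁻¹' {c} : Set G).indicator (fun _ => f c) g := by
    intro g
    simp only [Set.indicator_apply, Set.mem_preimage, Set.mem_singleton_iff]
    rw [Finset.sum_ite_eq]
    split_ifs with hg
    · rfl
    · exact hf _ hg
  simp only [e]
  rw [integral_finsetSum]
  · refine Finset.sum_congr rfl fun c _ => ?_
    rw [integral_indicator_const _ (hmeas c), Measure.real, hvol]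
    simp
  · intro c _
    exact (integrable_indicator_iff (hmeas c)).mpr (integrableOn_const (by rw [hvol]; simp))

end CosetIntegral

/-! ### Coset representatives of the Hecke double coset. -/

section HeckeCosets

variable {F : Type*} [NontriviallyNormedField F] [IsUltrametricDist F] [ProperSpace F]
  [MeasurableSpace F] [BorelSpace F] {ϖ : F} {q : ℝ} {ψ : AddChar F Circle} {ρ : F}
  (hF : 3 < ringChar (residueField F)) (h : IsNormalizedUniformizer ϖ q)
  (hψ : Continuous ψ) (hψc : HasConductorIntegers ψ) (hρ : IsPrimitiveRoot ρ 3)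

/-- Iwasawa coordinates `(i, j, x, y, z)` of the element `u t` with
`u = (1 x z; 0 1 y; 0 0 1)` and `t = diag(ϖ^(i+j), ϖ^j, 1)`. -/
structure IwasawaCoord (F : Type*) where
  /-- The exponent `i`. -/
  i : ℤ
  /-- The exponent `j`. -/
  j : ℤ
  /-- The coordinate `x`. -/
  x : F
  /-- The coordinate `y`. -/
  y : F
  /-- The coordinate `z`. -/
  z : F

/-- The matrix with given Iwasawa coordinates. -/
def IwasawaCoord.toGL {ϖ : F} (h0 : ϖ ≠ 0) (c : IwasawaCoord F) : GL (Fin 3) F :=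
  unipGL c.x c.y c.z * torusGL h0 c.i c.j

/-- `C` represents the left `K`-cosets in the double coset of `d_{m,n}`. -/
structure IsHeckeReps {ϖ : F} (h0 : ϖ ≠ 0) (m n : ℕ) (C : Finset (IwasawaCoord F)) : Prop where
  mem : ∀ c ∈ C, ProjGenLinGroup.mk (c.toGL h0) ∈ ProjGenLinGroup.mk '' heckeSet ϖ m n
  exists_rep : ∀ g : GL (Fin 3) F, ProjGenLinGroup.mk g ∈ ProjGenLinGroup.mk '' heckeSet ϖ m n →
    ∃ c ∈ C, ∃ κ ∈ integralGL F,
      ProjGenLinGroup.mk g = ProjGenLinGroup.mk (c.toGL h0 * κ)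
  unique : ∀ c ∈ C, ∀ c' ∈ C, (∃ κ ∈ integralGL F,
      ProjGenLinGroup.mk (c'.toGL h0) = ProjGenLinGroup.mk (c.toGL h0 * κ)) → c' = c

include h in
lemma mk_mul_mem_heckeSet {m n : ℕ} {g κ : GL (Fin 3) F} (hκ : κ ∈ integralGL F)
    (hg : ProjGenLinGroup.mk g ∈ ProjGenLinGroup.mk '' heckeSet ϖ m n) :
    ProjGenLinGroup.mk (g * κ) ∈ ProjGenLinGroup.mk '' heckeSet ϖ m n := by
  obtain ⟨g', ⟨k, hk, k', hk', e⟩, h1⟩ := hg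
  refine ⟨g' * κ, ⟨k, hk, k' * κ, (integralSubgroup F).mul_mem hk' hκ, ?_⟩, ?_⟩
  · rw [Units.val_mul, e, Units.val_mul]; simp only [mul_assoc]
  · rw [map_mul, map_mul, h1]

include hF h hψc hρ in
lemma weil_mk_mul_integral (g κ : GL (Fin 3) F) (hκ : κ ∈ integralGL F) :
    weil ψ ρ (ProjGenLinGroup.mk (g * κ)) (phiCirc F) =
      weil ψ ρ (ProjGenLinGroup.mk g) (phiCirc F) :=
  weilGL_mul_integral hF h hψc hρ g κ hκ.1 (inv_mem_integralGL hκ).1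

include hF h hψc hρ in
/-- The operator `ω(f_{m,n})` applied to the spherical vector, as a finite sum over left cosets. -/
lemma exists_isHeckeReps (μG : Measure PGL(3, F)) [μG.IsHaarMeasure]
    (hμG : μG (integralPGL F) = 1) (m n : ℕ) :
    ∃ C : Finset (IwasawaCoord F), IsHeckeReps h.ne_zero m n C ∧
      ∀ ξ : F8 F, weilConv ψ ρ μG (heckeFun ϖ m n) (phiCirc F) ξ =
        ∑ c ∈ C, weilGL ψ ρ (c.toGL h.ne_zero) (phiCirc F) ξ := by
  classical
  have h0 := h.ne_zero
  set K := integralPGLSubgroup F with hK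
  have hKo : IsOpen (K : Set PGL(3, F)) := isOpen_integralPGL
  have hdisc := QuotientGroup.discreteTopology hKo
  set S := ProjGenLinGroup.mk '' heckeSet ϖ m n with hS
  -- The double coset is compact and the quotient by the open subgroup is discrete, so only finitely
  -- many cosets occur.
  have hT : (((QuotientGroup.mk : PGL(3, F) → PGL(3, F) ⧸ K) '' S)).Finite :=
    isCompact_iff_finite.mp
      ((isCompact_image_heckeSet h0 m n).image QuotientGroup.continuous_mk)
  have hcoset : ∀ g g' : GL (Fin 3) F, ((QuotientGroup.mk (ProjGenLinGroup.mk g) :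
      PGL(3, F) ⧸ K) = QuotientGroup.mk (ProjGenLinGroup.mk g')) ↔
      ∃ κ ∈ integralGL F, ProjGenLinGroup.mk g' = ProjGenLinGroup.mk (g * κ) := by
    intro g g'
    rw [QuotientGroup.eq]
    constructor
    · rintro ⟨κ, hκ, e⟩
      exact ⟨κ, hκ, by rw [map_mul, e, mul_inv_cancel_left]⟩
    · rintro ⟨κ, hκ, e⟩
      exact ⟨κ, hκ, by rw [e, map_mul, inv_mul_cancel_left]⟩
  have hrep : ∀ c : PGL(3, F) ⧸ K, ∃ w : IwasawaCoord F,
      (QuotientGroup.mk (ProjGenLinGroup.mk (w.toGL h0)) : PGL(3, F) ⧸ K) = c := by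
    intro c
    induction c using QuotientGroup.induction_on with
    | H g =>
      obtain ⟨g, rfl⟩ := ProjGenLinGroup.mk_surjective g
      obtain ⟨i, j, x, y, z, κ, hκ, e⟩ := exists_iwasawa h g
      exact ⟨⟨i, j, x, y, z⟩, (hcoset _ _).mpr ⟨κ, hκ, e⟩⟩
  choose τ hτ using hrep
  have hτinj : Function.Injective τ := fun c c' hcc => by rw [← hτ c, ← hτ c', hcc]
  have hmemS : ∀ g g' : GL (Fin 3) F, ((QuotientGroup.mk (ProjGenLinGroup.mk g) :
      PGL(3, F) ⧸ K) = QuotientGroup.mk (ProjGenLinGroup.mk g')) →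
      ProjGenLinGroup.mk g ∈ S → ProjGenLinGroup.mk g' ∈ S := by
    intro g g' hgg hg
    obtain ⟨κ, hκ, e⟩ := (hcoset _ _).mp hgg
    rw [e]
    exact mk_mul_mem_heckeSet h hκ hg
  have hTmem : ∀ g : GL (Fin 3) F, (QuotientGroup.mk (ProjGenLinGroup.mk g) : PGL(3, F) ⧸ K) ∈
      hT.toFinset ↔ ProjGenLinGroup.mk g ∈ S := by
    intro g
    rw [Set.Finite.mem_toFinset]
    constructor
    · rintro ⟨s, hs, e⟩
      obtain ⟨s, rfl⟩ := ProjGenLinGroup.mk_surjective s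
      exact hmemS _ _ e hs
    · intro hg
      exact ⟨_, hg, rfl⟩
  refine ⟨hT.toFinset.image τ, ⟨?_, ?_, ?_⟩, ?_⟩
  · intro w hw
    obtain ⟨c, hc, rfl⟩ := Finset.mem_image.mp hw
    rwa [← hTmem, hτ]
  · intro g hg
    refine ⟨τ _, Finset.mem_image_of_mem τ ((hTmem g).mpr hg), ?_⟩
    exact (hcoset _ _).mp (hτ _)
  · intro w hw w' hw' hκ
    obtain ⟨c, hc, rfl⟩ := Finset.mem_image.mp hw
    obtain ⟨c', hc', rfl⟩ := Finset.mem_image.mp hw'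
    have := (hcoset _ _).mpr hκ
    rw [hτ, hτ] at this
    rw [this]
  · intro ξ
    rw [Finset.sum_image (fun c _ c' _ hcc => hτinj hcc), weilConv]
    have hf : ∀ g : PGL(3, F), heckeFun ϖ m n g * weil ψ ρ g (phiCirc F) ξ =
        (fun c : PGL(3, F) ⧸ K => if c ∈ hT.toFinset then
          weilGL ψ ρ ((τ c).toGL h0) (phiCirc F) ξ else 0) (QuotientGroup.mk g) := by
      intro g
      obtain ⟨g, rfl⟩ := ProjGenLinGroup.mk_surjective g
      by_cases hg : ProjGenLinGroup.mk g ∈ S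
      · have h1 : heckeFun ϖ m n (ProjGenLinGroup.mk g) = 1 := Set.indicator_of_mem hg _
        have h2 := (hTmem g).mpr hg
        obtain ⟨κ, hκ, e⟩ := (hcoset _ _).mp (hτ (QuotientGroup.mk (ProjGenLinGroup.mk g)))
        have h3 : ∀ w : IwasawaCoord F, ProjGenLinGroup.mk g =
            ProjGenLinGroup.mk (w.toGL h0 * κ) → weil ψ ρ (ProjGenLinGroup.mk g) (phiCirc F) ξ =
              weilGL ψ ρ (w.toGL h0) (phiCirc F) ξ := fun w ew => by
          rw [ew, weil_mk_mul_integral hF h hψc hρ _ _ hκ]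
          rfl
        rw [h1, one_mul, h3 _ e]
        exact (if_pos h2).symm
      · have h1 : heckeFun ϖ m n (ProjGenLinGroup.mk g) = 0 := Set.indicator_of_notMem hg _
        rw [h1, zero_mul]
        exact (if_neg (fun h2 => hg ((hTmem g).mp h2))).symm
    rw [integral_congr_ae (Filter.Eventually.of_forall hf)]
    refine (integral_comp_quotient_mk μG K hKo hμG (fun c : PGL(3, F) ⧸ K =>
      if c ∈ hT.toFinset then weilGL ψ ρ ((τ c).toGL h0) (phiCirc F) ξ else 0) hT.toFinset
      (fun c hc => if_neg hc)).trans ?_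
    exact Finset.sum_congr rfl fun c hc => if_pos hc

end HeckeCosets

/-! ### Sums of `θ⁻¹` over cosets as cell integrals. -/

section WhittakerCoefficients

variable {F : Type*} [NontriviallyNormedField F] [IsUltrametricDist F] [ProperSpace F]
  [MeasurableSpace F] [BorelSpace F] {ϖ : F} {q : ℝ} {ψ : AddChar F Circle}
  (h : IsNormalizedUniformizer ϖ q) (hψ : Continuous ψ) (hψc : HasConductorIntegers ψ)

/-- The set of points of `N` in a coset of `N ∩ t K t⁻¹`. -/
def unipCoset (q : ℝ) (c : IwasawaCoord F) : Set (F × F × F) :=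
  {p | ‖p.1 - c.x‖ ≤ q ^ (-c.i) ∧ ‖p.2.1 - c.y‖ ≤ q ^ (-c.j) ∧
    ‖p.2.2 - c.z - c.x * (p.2.1 - c.y)‖ ≤ q ^ (-(c.i + c.j))}

lemma isClosed_unipCoset (c : IwasawaCoord F) : IsClosed (unipCoset q c) := by
  have c1 : Continuous fun p : F × F × F => ‖p.1 - c.x‖ := by fun_prop
  have c2 : Continuous fun p : F × F × F => ‖p.2.1 - c.y‖ := by fun_prop
  have c3 : Continuous fun p : F × F × F => ‖p.2.2 - c.z - c.x * (p.2.1 - c.y)‖ := by fun_prop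
  exact (isClosed_le c1 continuous_const).inter
    ((isClosed_le c2 continuous_const).inter (isClosed_le c3 continuous_const))

lemma isBounded_unipCoset (c : IwasawaCoord F) : ∃ R : ℝ, ∀ p ∈ unipCoset q c, ‖p‖ ≤ R := by
  refine ⟨max (q ^ (-c.i) + ‖c.x‖) (max (q ^ (-c.j) + ‖c.y‖)
    (q ^ (-(c.i + c.j)) + (‖c.z‖ + ‖c.x‖ * q ^ (-c.j)))), ?_⟩
  rintro ⟨x, y, z⟩ ⟨h1, h2, h3⟩
  simp only at h1 h2 h3
  rw [Prod.norm_def, Prod.norm_def]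
  refine max_le_max ?_ (max_le_max ?_ ?_)
  · calc ‖x‖ = ‖(x - c.x) + c.x‖ := by ring_nf
      _ ≤ _ := (norm_add_le _ _).trans (by gcongr)
  · calc ‖y‖ = ‖(y - c.y) + c.y‖ := by ring_nf
      _ ≤ _ := (norm_add_le _ _).trans (by gcongr)
  · calc ‖z‖ = ‖(z - c.z - c.x * (y - c.y)) + (c.z + c.x * (y - c.y))‖ := by ring_nf
      _ ≤ _ := by
        refine (norm_add_le _ _).trans (add_le_add h3 ((norm_add_le _ _).trans ?_))
        rw [norm_mul]
        gcongr

open scoped Classical in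
lemma integrable_unipCoset (c : IwasawaCoord F) (w : ℂ) :
    Integrable (fun p => if p ∈ unipCoset q c then w else 0) (haarF3 F) := by
  obtain ⟨R, hR⟩ := isBounded_unipCoset (q := q) c
  exact integrable_ite_of_bounded _ (isClosed_unipCoset c).measurableSet hR continuous_const

include h

open scoped Classical in
lemma integral_unipCoset (c : IwasawaCoord F) (w : ℂ) :
    ∫ p, (if p ∈ unipCoset q c then w else 0) ∂haarF3 F = (q : ℂ) ^ (-(2 * (c.i + c.j))) * w := by
  rw [integral_haarF3 (integrable_unipCoset c w)]
  have hq : (q : ℂ) ≠ 0 := by exact_mod_cast h.pos.ne'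
  have e : ∀ x y z : F, (if (x, y, z) ∈ unipCoset q c then w else 0) =
      (if ‖x - c.x‖ ≤ q ^ (-c.i) then (if ‖y - c.y‖ ≤ q ^ (-c.j) then
        (if ‖z - (c.z + c.x * (y - c.y))‖ ≤ q ^ (-(c.i + c.j)) then w else 0) else 0) else 0) := by
    intro x y z
    have e0 : z - (c.z + c.x * (y - c.y)) = z - c.z - c.x * (y - c.y) := by ring
    rw [e0, ← ite_and, ← ite_and]
    exact if_congr and_assoc.symm rfl rfl
  have i1 : ∀ x y : F, ∫ z, (if (x, y, z) ∈ unipCoset q c then w else 0) ∂haarF F =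
      if ‖x - c.x‖ ≤ q ^ (-c.i) then (if ‖y - c.y‖ ≤ q ^ (-c.j) then
        ((q ^ (-(c.i + c.j)) : ℝ) : ℂ) * w else 0) else 0 := by
    intro x y
    simp only [e]
    split_ifs
    · rw [integral_ite_closedBall h]; push_cast; rfl
    · simp
    · simp
  simp only [i1]
  have i2 : ∀ x : F, ∫ y, (if ‖x - c.x‖ ≤ q ^ (-c.i) then (if ‖y - c.y‖ ≤ q ^ (-c.j) then
        ((q ^ (-(c.i + c.j)) : ℝ) : ℂ) * w else 0) else 0) ∂haarF F =
      if ‖x - c.x‖ ≤ q ^ (-c.i) then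
        ((q ^ (-c.j) : ℝ) : ℂ) * (((q ^ (-(c.i + c.j)) : ℝ) : ℂ) * w) else 0 := by
    intro x
    split_ifs
    · rw [integral_ite_closedBall h]; push_cast; rfl
    · simp
  simp only [i2]
  rw [integral_ite_closedBall h]
  push_cast
  rw [← mul_assoc, ← mul_assoc, ← zpow_add₀ hq, ← zpow_add₀ hq]
  congr 2
  ring

lemma unipCoset_iff (c : IwasawaCoord F) (i j : ℤ)
    (p : F × F × F) :
    (∃ κ ∈ integralGL F, ProjGenLinGroup.mk (unipGL p.1 p.2.1 p.2.2 * torusGL h.ne_zero i j) =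
      ProjGenLinGroup.mk (c.toGL h.ne_zero * κ)) ↔ (c.i = i ∧ c.j = j) ∧ p ∈ unipCoset q c := by
  rw [IwasawaCoord.toGL, mk_unip_torus_eq_iff h]
  simp only [unipCoset, Set.mem_ofPred_eq]
  tauto

include hψc in
/-- The sum of `θ⁻¹` over the left cosets with a given torus part. -/
lemma IsHeckeReps.sum_theta_inv {m n : ℕ} {C : Finset (IwasawaCoord F)}
    (hC : IsHeckeReps h.ne_zero m n C) (r l : ℕ) {i j : ℤ} (hir : i = n + r - 2 * l)
    (hjl : j = m + l - 2 * r) (hi : 0 ≤ i) (hj : 0 ≤ j) :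
    ∑ c ∈ C with c.i = i ∧ c.j = j, (ψ (-c.x - c.y) : ℂ) =
      (q : ℂ) ^ (2 * (i + j)) * cellIntegral q ψ i j r l := by
  classical
  have hq : (q : ℂ) ≠ 0 := by exact_mod_cast h.pos.ne'
  set D := C.filter (fun c => c.i = i ∧ c.j = j) with hD
  have key : ∀ p : F × F × F,
      (if max 1 (max (q ^ (-j) * ‖p.1‖) (max ‖p.2.1‖ ‖p.2.2‖)) = q ^ (r : ℤ) ∧
        max 1 (max ‖p.1‖ (max (q ^ (-i) * ‖p.2.1‖) ‖p.1 * p.2.1 - p.2.2‖)) = q ^ (l : ℤ)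
          then (ψ (-p.1 - p.2.1) : ℂ) else 0) =
      ∑ c ∈ D, if p ∈ unipCoset q c then (ψ (-c.x - c.y) : ℂ) else 0 := by
    intro p
    have hS := mk_unip_torus_mem_heckeSet_iff h (m := m) (n := n) hi hj p.1 p.2.1 p.2.2
    by_cases hp : max 1 (max (q ^ (-j) * ‖p.1‖) (max ‖p.2.1‖ ‖p.2.2‖)) = q ^ (r : ℤ) ∧
        max 1 (max ‖p.1‖ (max (q ^ (-i) * ‖p.2.1‖) ‖p.1 * p.2.1 - p.2.2‖)) = q ^ (l : ℤ)
    · rw [if_pos hp]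
      obtain ⟨c, hcC, hκ⟩ := hC.exists_rep _ (hS.mpr ⟨r, l, hir, hjl, hp.1, hp.2⟩)
      obtain ⟨hcij, hpc⟩ := (unipCoset_iff h c i j p).mp hκ
      have hcD : c ∈ D := Finset.mem_filter.mpr ⟨hcC, hcij⟩
      rw [Finset.sum_eq_single_of_mem c hcD, if_pos hpc]
      -- For `i, j ≥ 0` the coordinates `x` and `y` vary by integers within the coset, so the
      -- character is constant on it.
      · have e : -p.1 - p.2.1 = (-c.x - c.y) + (-((p.1 - c.x) + (p.2.1 - c.y))) := by ring
        have hle : ‖-((p.1 - c.x) + (p.2.1 - c.y))‖ ≤ 1 := by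
          rw [norm_neg]
          refine norm_add_le_of_le (hpc.1.trans ?_) (hpc.2.1.trans ?_)
          · rw [← zpow_zero q, h.zpow_le_zpow_iff]; omega
          · rw [← zpow_zero q, h.zpow_le_zpow_iff]; omega
        rw [e, AddChar.map_add_eq_mul, hψc.eq_one hle, mul_one]
      · intro c' hc' hne
        refine if_neg fun hpc' => hne ?_
        obtain ⟨hcC', hcij'⟩ := Finset.mem_filter.mp hc'
        -- A point lying in the cosets of `c` and of `c'` would make these represent the same left
        -- coset of `K`.
        obtain ⟨κ', hκ', e'⟩ := (unipCoset_iff h c' i j p).mpr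
          ⟨hcij', hpc'⟩
        obtain ⟨κ, hκ, e⟩ := hκ
        refine hC.unique c hcC c' hcC' ⟨κ * κ'⁻¹, (integralSubgroup F).mul_mem hκ
          (inv_mem_integralGL hκ'), ?_⟩
        rw [e', map_mul, map_mul] at e
        rw [map_mul, map_mul, ← mul_assoc, ← e, map_inv, mul_inv_cancel_right]
    · rw [if_neg hp]
      refine (Finset.sum_eq_zero fun c hc => if_neg fun hpc => hp ?_).symm
      obtain ⟨hcC, hcij⟩ := Finset.mem_filter.mp hc
      obtain ⟨κ, hκ, e⟩ := (unipCoset_iff h c i j p).mpr ⟨hcij, hpc⟩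
      have hmem := mk_mul_mem_heckeSet h hκ (hC.mem c hcC)
      rw [← e] at hmem
      obtain ⟨r', l', h1, h2, h3, h4⟩ := hS.mp hmem
      have hr : r' = r := by omega
      have hl : l' = l := by omega
      rw [hr] at h3
      rw [hl] at h4
      exact ⟨h3, h4⟩
  -- The cell is the disjoint union of the cosets, and each has volume `q ^ (-(2 * (i + j)))`.
  have key2 : cellIntegral q ψ i j r l = ∑ c ∈ D, (q : ℂ) ^ (-(2 * (i + j))) *
      (ψ (-c.x - c.y) : ℂ) := by
    rw [cellIntegral]
    rw [integral_congr_ae (Filter.Eventually.of_forall fun p => (if_congr Iff.rfl rfl rfl).trans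
      (key p)), integral_finsetSum _ fun c _ => integrable_unipCoset c _]
    refine Finset.sum_congr rfl fun c hc => ?_
    rw [integral_unipCoset h, (Finset.mem_filter.mp hc).2.1, (Finset.mem_filter.mp hc).2.2]
  rw [key2, ← Finset.mul_sum, ← mul_assoc, ← zpow_add₀ hq, add_neg_cancel, zpow_zero, one_mul]

/-- Nonnegativity of `c.i` and `c.j` gives `3 * l ≤ m + 2 * n` and `3 * r ≤ 2 * m + n`, which makes
the range finite. The margin `3` ensures that the range contains every `r, l ≤ 2`. -/
lemma IsHeckeReps.exists_cell {m n : ℕ} {C : Finset (IwasawaCoord F)}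
    (hC : IsHeckeReps h.ne_zero m n C) {c : IwasawaCoord F} (hc : c ∈ C) (hi : 0 ≤ c.i)
    (hj : 0 ≤ c.j) : ∃ r l : ℕ, r < 2 * m + 2 * n + 3 ∧ l < 2 * m + 2 * n + 3 ∧
      c.i = n + r - 2 * l ∧ c.j = m + l - 2 * r := by
  obtain ⟨r, l, h1, h2, -, -⟩ := (mk_unip_torus_mem_heckeSet_iff h hi hj c.x c.y c.z).mp (hC.mem c hc)
  exact ⟨r, l, by omega, by omega, h1, h2⟩

include hψc in
/-- Sums over left cosets of `θ⁻¹` times a function of the torus part. -/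
lemma IsHeckeReps.sum_theta_inv_mul {m n : ℕ} {C : Finset (IwasawaCoord F)}
    (hC : IsHeckeReps h.ne_zero m n C) (L : ℤ → ℤ → ℂ)
    (hL : ∀ i j : ℤ, i < 0 ∨ j < 0 → L i j = 0) :
    ∑ c ∈ C, (ψ (-c.x - c.y) : ℂ) * ((q : ℂ) ^ (-(2 * (c.i + c.j))) * L c.i c.j) =
      ∑ r ∈ Finset.range (2 * m + 2 * n + 3), ∑ l ∈ Finset.range (2 * m + 2 * n + 3),
        L (n + r - 2 * l) (m + l - 2 * r) *
          cellIntegral q ψ (n + r - 2 * l) (m + l - 2 * r) r l := by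
  classical
  have hq : (q : ℂ) ≠ 0 := by exact_mod_cast h.pos.ne'
  set R := 2 * m + 2 * n + 3 with hR
  have e1 : ∀ r l : ℕ, L (n + r - 2 * l) (m + l - 2 * r) *
      cellIntegral q ψ (n + r - 2 * l) (m + l - 2 * r) r l =
      ∑ c ∈ C, if c.i = n + r - 2 * l ∧ c.j = m + l - 2 * r then
        (ψ (-c.x - c.y) : ℂ) * ((q : ℂ) ^ (-(2 * (c.i + c.j))) * L c.i c.j) else 0 := by
    intro r l
    rw [← Finset.sum_filter]
    by_cases hneg : (n + r - 2 * l : ℤ) < 0 ∨ (m + l - 2 * r : ℤ) < 0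
    · rw [hL _ _ hneg, zero_mul]
      refine (Finset.sum_eq_zero fun c hc => ?_).symm
      obtain ⟨-, h1, h2⟩ := Finset.mem_filter.mp hc
      rw [h1, h2, hL _ _ hneg, mul_zero, mul_zero]
    · push Not at hneg
      have hs := hC.sum_theta_inv h hψc r l rfl rfl hneg.1 hneg.2
      have : ∀ c ∈ C.filter (fun c => c.i = (n : ℤ) + r - 2 * l ∧ c.j = (m : ℤ) + l - 2 * r),
          (ψ (-c.x - c.y) : ℂ) * ((q : ℂ) ^ (-(2 * (c.i + c.j))) * L c.i c.j) =
          (ψ (-c.x - c.y) : ℂ) * ((q : ℂ) ^ (-(2 * ((n + r - 2 * l : ℤ) + (m + l - 2 * r)))) *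
            L (n + r - 2 * l) (m + l - 2 * r)) := by
        intro c hc
        obtain ⟨-, h1, h2⟩ := Finset.mem_filter.mp hc
        rw [h1, h2]
      rw [Finset.sum_congr rfl this, ← Finset.sum_mul, hs, _root_.zpow_neg]
      have := zpow_ne_zero (2 * ((n + r - 2 * l : ℤ) + (m + l - 2 * r))) hq
      field_simp
  simp only [e1]
  have e2 : ∀ r : ℕ, ∑ l ∈ Finset.range R, ∑ c ∈ C,
      (if c.i = n + r - 2 * l ∧ c.j = m + l - 2 * r then
        (ψ (-c.x - c.y) : ℂ) * ((q : ℂ) ^ (-(2 * (c.i + c.j))) * L c.i c.j) else 0) =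
      ∑ c ∈ C, ∑ l ∈ Finset.range R, (if c.i = n + r - 2 * l ∧ c.j = m + l - 2 * r then
        (ψ (-c.x - c.y) : ℂ) * ((q : ℂ) ^ (-(2 * (c.i + c.j))) * L c.i c.j) else 0) :=
    fun r => Finset.sum_comm
  simp only [e2]
  rw [Finset.sum_comm]
  refine Finset.sum_congr rfl fun c hc => ?_
  by_cases hneg : c.i < 0 ∨ c.j < 0
  · simp [hL _ _ hneg]
  · push Not at hneg
    obtain ⟨r, l, hr, hl, h1, h2⟩ := hC.exists_cell h hc hneg.1 hneg.2
    -- The torus part determines `(r, l)`, as the linear map `(r, l) ↦ (r - 2l, l - 2r)` has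
    -- determinant `-3`.
    rw [Finset.sum_eq_single_of_mem r (Finset.mem_range.mpr hr),
      Finset.sum_eq_single_of_mem l (Finset.mem_range.mpr hl), if_pos ⟨h1, h2⟩]
    · intro l' _ hl'
      exact if_neg fun ⟨h3, h4⟩ => hl' (by omega)
    · intro r' _ hr'
      exact Finset.sum_eq_zero fun l' _ => if_neg fun ⟨h3, h4⟩ => hr' (by omega)

end WhittakerCoefficients

/-! ### The quotient measure -/

section Heisenberg

variable {F : Type*} [NontriviallyNormedField F] [IsUltrametricDist F] [ProperSpace F]
  [MeasurableSpace F] [BorelSpace F]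

/-- Both left and right translations of `N` have this form in coordinates: they translate `x` and
`y`, and move `z` by a function of `x` and `y`. -/
lemma measurePreserving_shear (x₀ y₀ : F) {g : F → F → F} (hg : Measurable (Function.uncurry g)) :
    MeasurePreserving (fun p : F × F × F => (x₀ + p.1, y₀ + p.2.1, p.2.2 + g p.1 p.2.1))
      (haarF3 F) (haarF3 F) := by
  unfold haarF3
  refine MeasurePreserving.skew_product (f := fun x : F => x₀ + x)
    (g := fun (x : F) (p : F × F) => (y₀ + p.1, p.2 + g x p.1))
    (measurePreserving_add_left (haarF F) x₀) ?_ (Filter.Eventually.of_forall fun x => ?_)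
  · refine (measurable_const.add (measurable_fst.comp measurable_snd)).prodMk
      ((measurable_snd.comp measurable_snd).add ?_)
    exact hg.comp (measurable_fst.prodMk (measurable_fst.comp measurable_snd))
  · refine (MeasurePreserving.skew_product (f := fun y : F => y₀ + y)
      (g := fun (y : F) (z : F) => z + g x y)
      (measurePreserving_add_left (haarF F) y₀) ?_ (Filter.Eventually.of_forall fun y => ?_)).map_eq
    · exact measurable_snd.add (hg.comp (measurable_const.prodMk measurable_fst))
    · exact map_add_right_eq_self _ _

variable (F) in
/-- `F³` with the group law of the upper triangular unipotent matrices. -/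
def Heis : Type _ := F × F × F

instance : TopologicalSpace (Heis F) := inferInstanceAs (TopologicalSpace (F × F × F))

instance : MeasurableSpace (Heis F) := inferInstanceAs (MeasurableSpace (F × F × F))

instance : BorelSpace (Heis F) := inferInstanceAs (BorelSpace (F × F × F))

instance : LocallyCompactSpace (Heis F) := inferInstanceAs (LocallyCompactSpace (F × F × F))

instance : SecondCountableTopology (Heis F) :=
  inferInstanceAs (SecondCountableTopology (F × F × F))

instance : Mul (Heis F) :=
  ⟨fun p p' => (p.1 + p'.1, p.2.1 + p'.2.1, p.2.2 + p'.2.2 + p.1 * p'.2.1)⟩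

instance : One (Heis F) := ⟨((0 : F), (0 : F), (0 : F))⟩

instance : Inv (Heis F) := ⟨fun p => (-p.1, -p.2.1, p.1 * p.2.1 - p.2.2)⟩

instance : Group (Heis F) := Group.ofLeftAxioms
  (fun p p' p'' => Prod.ext (add_assoc p.1 p'.1 p''.1) (Prod.ext (add_assoc p.2.1 p'.2.1 p''.2.1)
    (show p.2.2 + p'.2.2 + p.1 * p'.2.1 + p''.2.2 + (p.1 + p'.1) * p''.2.1 =
      p.2.2 + (p'.2.2 + p''.2.2 + p'.1 * p''.2.1) + p.1 * (p'.2.1 + p''.2.1) by ring)))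
  (fun p => Prod.ext (zero_add p.1) (Prod.ext (zero_add p.2.1)
    (show 0 + p.2.2 + 0 * p.2.1 = p.2.2 by ring)))
  (fun p => Prod.ext (neg_add_cancel p.1) (Prod.ext (neg_add_cancel p.2.1)
    (show p.1 * p.2.1 - p.2.2 + p.2.2 + -p.1 * p.2.1 = 0 by ring)))

instance : IsTopologicalGroup (Heis F) where
  continuous_mul := by
    change Continuous fun q : (F × F × F) × (F × F × F) =>
      (q.1.1 + q.2.1, q.1.2.1 + q.2.2.1, q.1.2.2 + q.2.2.2 + q.1.1 * q.2.2.1)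
    fun_prop
  continuous_inv := by
    change Continuous fun p : F × F × F => (-p.1, -p.2.1, p.1 * p.2.1 - p.2.2)
    fun_prop

lemma haarF3_closedBall_one : haarF3 F (Metric.closedBall 0 1) = 1 := by
  have e : Metric.closedBall (0 : F × F × F) 1 =
      Metric.closedBall 0 1 ×ˢ (Metric.closedBall 0 1 ×ˢ Metric.closedBall 0 1) := by
    rw [closedBall_prod_same, closedBall_prod_same]; rfl
  rw [e, haarF3, Measure.prod_prod, Measure.prod_prod, haarF_closedBall_one]
  simp

/-- Uniqueness of Haar measure on the group of upper triangular unipotent matrices. -/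
lemma eq_haarF3_of_invariant (τ : Measure (F × F × F))
    (hinv : ∀ x₀ y₀ z₀ : F, Measure.map (fun p : F × F × F =>
      (x₀ + p.1, y₀ + p.2.1, z₀ + p.2.2 + x₀ * p.2.1)) τ = τ)
    (h1 : τ (Metric.closedBall 0 1) = 1) : τ = haarF3 F := by
  let B : Set (Heis F) := (Metric.ball 0 1 : Set (F × F × F))
  let D : Set (Heis F) := (Metric.closedBall 0 1 : Set (F × F × F))
  have hB : IsOpen B := (Metric.isOpen_ball : IsOpen (Metric.ball 0 1 : Set (F × F × F)))
  have hBne : B.Nonempty :=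
    ⟨(0 : F × F × F), (Metric.mem_ball_self one_pos : (0 : F × F × F) ∈ Metric.ball 0 1)⟩
  have hD : IsCompact D :=
    (isCompact_closedBall 0 1 : IsCompact (Metric.closedBall 0 1 : Set (F × F × F)))
  have hBD : B ⊆ D :=
    (Metric.ball_subset_closedBall : (Metric.ball 0 1 : Set (F × F × F)) ⊆ Metric.closedBall 0 1)
  let K₀ : TopologicalSpace.PositiveCompacts (Heis F) :=
    ⟨⟨D, hD⟩, hBne.mono (interior_maximal hBD hB)⟩
  have key : ∀ (τ : Measure (F × F × F)), (∀ x₀ y₀ z₀ : F, Measure.map (fun p : F × F × F =>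
      (x₀ + p.1, y₀ + p.2.1, z₀ + p.2.2 + x₀ * p.2.1)) τ = τ) →
      τ (Metric.closedBall 0 1) = 1 → τ = Measure.haarMeasure (G := Heis F) K₀ := by
    intro τ hinv h1
    let τ' : Measure (Heis F) := τ
    have hli : τ'.IsMulLeftInvariant := ⟨fun p => hinv p.1 p.2.1 p.2.2⟩
    have hfin : IsFiniteMeasureOnCompacts τ' := by
      refine ⟨fun C hC => ?_⟩
      refine measure_lt_top_of_isCompact_of_isMulLeftInvariant (μ := τ') B hB hBne ?_ hC
      exact ((measure_mono hBD).trans_lt ((show τ' D = 1 from h1) ▸ ENNReal.one_lt_top)).ne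
    have h2 : τ' K₀ = 1 := h1
    have := Measure.haarMeasure_unique τ' K₀
    rw [h2, one_smul] at this
    exact this
  -- Both measures are invariant and equally normalized, so each equals the Haar measure of the
  -- group `Heis F`.
  rw [key τ hinv h1, key (haarF3 F) ?_ haarF3_closedBall_one]
  intro x₀ y₀ z₀
  have := (measurePreserving_shear x₀ y₀ (g := fun _ y => z₀ + x₀ * y)
    (measurable_const.add (measurable_const.mul measurable_snd))).map_eq
  convert this using 2
  funext p
  refine Prod.ext rfl (Prod.ext rfl ?_)
  change z₀ + p.2.2 + x₀ * p.2.1 = p.2.2 + (z₀ + x₀ * p.2.1)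
  ring

end Heisenberg

/-! ### Coordinates on `H` and the Haar measure of `SL₂(𝒪) × N`. -/

section HGroupTopology

variable {F : Type*} [NontriviallyNormedField F] [IsUltrametricDist F] [ProperSpace F]
  [MeasurableSpace F] [BorelSpace F]

instance : IsTopologicalGroup (HGroup F) :=
  inferInstanceAs (IsTopologicalGroup (SL(2, F) × unip F))

lemma HGroup.continuous_fst_apply (i j : Fin 2) : Continuous fun h : HGroup F => h.1 i j := by
  have h1 : Continuous fun h : HGroup F => h.1 := (continuous_fst : Continuous
    (Prod.fst : SL(2, F) × unip F → SL(2, F)))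
  exact (continuous_apply j).comp (SpecialLinearGroup.continuous_apply _ h1 i)

lemma HGroup.continuous_snd_apply (i j : Fin 3) :
    Continuous fun h : HGroup F => (h.2 : GL (Fin 3) F) i j := by
  have h1 : Continuous fun h : HGroup F => (h.2 : GL (Fin 3) F) :=
    continuous_subtype_val.comp (continuous_snd : Continuous
      (Prod.snd : SL(2, F) × unip F → unip F))
  exact (continuous_apply j).comp (GeneralLinearGroup.continuous_apply _ h1 i)

lemma HGroup.continuous_ux : Continuous fun h : HGroup F => ux h.2 :=
  HGroup.continuous_snd_apply 0 1

lemma HGroup.continuous_uy : Continuous fun h : HGroup F => uy h.2 :=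
  HGroup.continuous_snd_apply 1 2

lemma HGroup.continuous_uz : Continuous fun h : HGroup F => uz h.2 :=
  HGroup.continuous_snd_apply 0 2

variable (F) in
/-- `SL₂(𝒪)` as a subgroup of `SL₂(F)`. -/
def integralSL2Subgroup : Subgroup SL(2, F) where
  carrier := integralSL2 F
  mul_mem' := by
    intro a b ha hb i j
    change ‖(a.1 * b.1) i j‖ ≤ 1
    simp only [integralSL2, Set.mem_ofPred_eq, ← mem_ringOfIntegers] at *
    rw [Matrix.mul_apply]
    exact sum_mem fun m _ => mul_mem (ha _ _) (hb _ _)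
  one_mem' := by
    intro i j
    change ‖(1 : Matrix (Fin 2) (Fin 2) F) i j‖ ≤ 1
    rw [Matrix.one_apply]
    split_ifs <;> simp
  inv_mem' := by
    intro a ha i j
    change ‖a.1.adjugate i j‖ ≤ 1
    rw [Matrix.adjugate_fin_two]
    have ha : ∀ i j, ‖a.1 i j‖ ≤ 1 := ha
    fin_cases i <;> fin_cases j <;> simp [ha _ _]

lemma isOpen_integralSL2_fst : IsOpen {h : HGroup F | h.1 ∈ integralSL2 F} := by
  have h1 : IsOpen (Metric.closedBall (0 : F) 1) :=
    IsUltrametricDist.isOpen_closedBall 0 one_ne_zero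
  have e : {h : HGroup F | h.1 ∈ integralSL2 F} = ⋂ i : Fin 2, ⋂ j : Fin 2,
      (fun h : HGroup F => h.1 i j) ⁻¹' Metric.closedBall (0 : F) 1 := by
    ext g
    simp [integralSL2]
  rw [e]
  exact isOpen_iInter_of_finite fun i => isOpen_iInter_of_finite fun j =>
    h1.preimage (HGroup.continuous_fst_apply i j)

lemma unipOf_coords (u : unip F) : unipOf (ux u) (uy u) (uz u) = u :=
  Subtype.ext (Units.ext (unip_val u).symm)

/-- The coordinates of the component in `N`. -/
def HGroup.coords (h : HGroup F) : F × F × F := (ux h.2, uy h.2, uz h.2)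

lemma HGroup.continuous_coords : Continuous (HGroup.coords : HGroup F → F × F × F) :=
  HGroup.continuous_ux.prodMk (HGroup.continuous_uy.prodMk HGroup.continuous_uz)

lemma mem_integralH_iff (h : HGroup F) : h ∈ integralH F ↔
    h.1 ∈ integralSL2 F ∧ h.coords ∈ Metric.closedBall (0 : F × F × F) 1 := by
  have e : ((h.2 : GL (Fin 3) F) ∈ integralGL F) ↔
      h.coords ∈ Metric.closedBall (0 : F × F × F) 1 := by
    rw [mem_closedBall_zero_iff, Prod.norm_def, Prod.norm_def, max_le_iff, max_le_iff]
    constructor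
    · intro hg
      exact ⟨hg.1 0 1, hg.1 1 2, hg.1 0 2⟩
    · rintro ⟨h1, h2, h3⟩
      have h4 : IsIntegralUnit (unipMat (ux h.2) (uy h.2) (uz h.2)) :=
        isIntegralUnit_upper h1 h3 h2
      rw [← unip_val] at h4
      exact h4
  rw [← e]
  rfl

/-- The Haar measure on `SL₂(𝒪) × N` in coordinates. -/
lemma map_coords_restrict (μH : Measure (HGroup F)) [μH.IsHaarMeasure]
    (hμH : μH (integralH F) = 1) :
    Measure.map HGroup.coords (μH.restrict {h | h.1 ∈ integralSL2 F}) = haarF3 F := by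
  have hcm : Measurable (HGroup.coords : HGroup F → F × F × F) := HGroup.continuous_coords.measurable
  have hSm : MeasurableSet {h : HGroup F | h.1 ∈ integralSL2 F} :=
    isOpen_integralSL2_fst.measurableSet
  refine eq_haarF3_of_invariant _ ?_ ?_
  -- Left translation by `(1, u)` does not change the first component, so it preserves the
  -- restricted measure and acts on the coordinates as the Heisenberg translation.
  · intro x₀ y₀ z₀
    have hm : Measurable fun p : F × F × F => (x₀ + p.1, y₀ + p.2.1, z₀ + p.2.2 + x₀ * p.2.1) := by
      fun_prop
    rw [Measure.map_map hm hcm]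
    ext A hA
    rw [Measure.map_apply (hm.comp hcm) hA, Measure.map_apply hcm hA,
      Measure.restrict_apply (hcm hA), Measure.restrict_apply ((hm.comp hcm) hA),
      ← measure_preimage_mul μH (hMk 1 (unipOf x₀ y₀ z₀)) (HGroup.coords ⁻¹' A ∩ _)]
    congr 1
    ext h
    simp [HGroup.coords]
  · rw [Measure.map_apply hcm Metric.isClosed_closedBall.measurableSet,
      Measure.restrict_apply (hcm Metric.isClosed_closedBall.measurableSet), ← hμH]
    congr 1
    ext h
    rw [mem_integralH_iff]
    exact and_comm

end HGroupTopology

/-! ### Iwasawa decomposition of `SL₂(F)`. -/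

section SL2Iwasawa

variable {F : Type*} [NontriviallyNormedField F] [IsUltrametricDist F] [ProperSpace F]
  [MeasurableSpace F] [BorelSpace F] {ϖ : F} {q : ℝ}

/-- The matrix `diag(ϖ^(-k), ϖ^k)`. -/
def slTorus {ϖ : F} (h0 : ϖ ≠ 0) (k : ℤ) : SL(2, F) :=
  ⟨!![ϖ ^ (-k), 0; 0, ϖ ^ k], by simp [Matrix.det_fin_two, zpow_ne_zero k h0]⟩

/-- The matrix `(1 b; 0 1)`. -/
def slUnip (b : F) : SL(2, F) := ⟨!![1, b; 0, 1], by simp [Matrix.det_fin_two]⟩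

lemma slUnip_mul (b b' : F) : slUnip b * slUnip b' = slUnip (b + b') := by
  refine Subtype.ext ?_
  change !![1, b; 0, 1] * !![1, b'; 0, 1] = !![1, b + b'; 0, 1]
  ext i j
  fin_cases i <;> fin_cases j <;> simp [add_comm]

variable (h : IsNormalizedUniformizer ϖ q)

include h

lemma exists_slUnip_mul_slTorus (g : SL(2, F)) : ∃ (b : F) (k : ℤ), ∃ κ ∈ integralSL2 F,
    g = slUnip b * slTorus h.ne_zero k * κ := by
  obtain ⟨α, β, γ, δ, hα, hβ, hγ, hδ, hdet, he⟩ := exists_column_op (g 1 0) (g 1 1)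
  let κ₀ : SL(2, F) := ⟨!![α, β; γ, δ], by simp [Matrix.det_fin_two, hdet]⟩
  have hκ₀ : κ₀ ∈ integralSL2 F := by
    intro i j
    change ‖!![α, β; γ, δ] i j‖ ≤ 1
    fin_cases i <;> fin_cases j <;> simp [*]
  set U : SL(2, F) := g * κ₀ with hU
  have u10 : U.1 1 0 = 0 := by
    change (g.1 * !![α, β; γ, δ]) 1 0 = 0
    rw [Matrix.mul_apply, Fin.sum_univ_two]
    simpa using he
  have hUdet := U.2
  rw [Matrix.det_fin_two, u10, mul_zero, sub_zero] at hUdet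
  have u11 : U.1 1 1 ≠ 0 := right_ne_zero_of_mul (hUdet ▸ one_ne_zero)
  obtain ⟨k, ε, hε, ek⟩ := exists_eq_zpow_mul h _ u11
  have ε0 : ε ≠ 0 := norm_ne_zero_iff.mp (by rw [hε]; exact one_ne_zero)
  have w := zpow_ne_zero k h.ne_zero
  have u00 : U.1 0 0 = (ϖ ^ k)⁻¹ * ε⁻¹ := by
    rw [eq_comm, ← mul_inv, inv_eq_iff_eq_inv, ← ek]
    exact eq_inv_of_mul_eq_one_right hUdet
  let κ₁ : SL(2, F) := ⟨!![ε⁻¹, 0; 0, ε], by simp [Matrix.det_fin_two, ε0]⟩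
  have hκ₁ : κ₁ ∈ integralSL2 F := by
    intro i j
    change ‖!![ε⁻¹, 0; 0, ε] i j‖ ≤ 1
    fin_cases i <;> fin_cases j <;> simp [hε]
  refine ⟨U.1 0 1 / U.1 1 1, k, κ₁ * κ₀⁻¹, (integralSL2Subgroup F).mul_mem hκ₁
    ((integralSL2Subgroup F).inv_mem hκ₀), ?_⟩
  have key : U = slUnip (U.1 0 1 / U.1 1 1) * slTorus h.ne_zero k * κ₁ := by
    refine Subtype.ext ?_
    change U.1 = !![1, U.1 0 1 / U.1 1 1; 0, 1] * !![ϖ ^ (-k), 0; 0, ϖ ^ k] * !![ε⁻¹, 0; 0, ε]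
    conv_lhs => rw [Matrix.eta_fin_two U.1]
    rw [Matrix.mul_fin_two, Matrix.mul_fin_two, u10, u00]
    ext i j
    fin_cases i <;> fin_cases j <;> simp
    · rw [mul_assoc, ← ek, div_mul_cancel₀ _ u11]
    · exact ek
  rw [← mul_assoc, ← key, hU, mul_inv_cancel_right]

lemma slTorus_inv_mul_mem_iff (b : F) (k k' : ℤ) {κ : SL(2, F)} (hκ : κ ∈ integralSL2 F) :
    (slTorus h.ne_zero k')⁻¹ * (slUnip b * slTorus h.ne_zero k * κ) ∈ integralSL2 F ↔
      k' = k ∧ ‖b‖ ≤ q ^ (2 * k) := by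
  have hq0 := h.pos.ne'
  have e1 : (slTorus h.ne_zero k')⁻¹ * (slUnip b * slTorus h.ne_zero k * κ) ∈ integralSL2 F ↔
      (slTorus h.ne_zero k')⁻¹ * slUnip b * slTorus h.ne_zero k ∈ integralSL2 F := by
    rw [← mul_assoc, ← mul_assoc]
    exact (integralSL2Subgroup F).mul_mem_cancel_right hκ
  have e2 : ((slTorus h.ne_zero k')⁻¹ * slUnip b * slTorus h.ne_zero k).1 =
      !![ϖ ^ k' * ϖ ^ (-k), ϖ ^ k' * b * ϖ ^ k; 0, ϖ ^ (-k') * ϖ ^ k] := by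
    change Matrix.adjugate !![ϖ ^ (-k'), 0; 0, ϖ ^ k'] * !![1, b; 0, 1] *
      !![ϖ ^ (-k), 0; 0, ϖ ^ k] = _
    rw [Matrix.adjugate_fin_two, Matrix.mul_fin_two, Matrix.mul_fin_two]
    ext i j
    fin_cases i <;> fin_cases j <;> simp
  have e3 : (slTorus h.ne_zero k')⁻¹ * slUnip b * slTorus h.ne_zero k ∈ integralSL2 F ↔
      ∀ i j, ‖(!![ϖ ^ k' * ϖ ^ (-k), ϖ ^ k' * b * ϖ ^ k; 0, ϖ ^ (-k') * ϖ ^ k] :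
        Matrix (Fin 2) (Fin 2) F) i j‖ ≤ 1 := by
    rw [← e2]; rfl
  rw [e1, e3]
  simp only [Fin.forall_fin_two, Matrix.of_apply, Matrix.cons_val_zero, Matrix.cons_val_one,
    norm_mul, h.norm_zpow, norm_zero, zero_le_one, true_and]
  rw [mul_right_comm, ← zpow_add₀ hq0, ← zpow_add₀ hq0, ← zpow_add₀ hq0, ← zpow_zero q,
    h.zpow_le_zpow_iff, h.zpow_le_zpow_iff]
  have e4 : ∀ k : ℤ, q ^ (-k + -k) * ‖b‖ ≤ q ^ (0 : ℤ) ↔ ‖b‖ ≤ q ^ (2 * k) := by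
    intro k
    rw [zpow_zero, show -k + -k = -(2 * k) by ring, _root_.zpow_neg,
      inv_mul_le_one₀ (zpow_pos h.pos _)]
  constructor
  · rintro ⟨⟨h1, h2⟩, h3⟩
    obtain rfl : k' = k := by omega
    exact ⟨rfl, (e4 _).mp h2⟩
  · rintro ⟨rfl, h1⟩
    exact ⟨⟨by omega, (e4 _).mpr h1⟩, by omega⟩

end SL2Iwasawa

/-! ### The stabilizer of `ξ₁(a)` and its Haar measure. -/

section Stabilizer

variable {F : Type*} [NontriviallyNormedField F] [IsUltrametricDist F] [ProperSpace F]
  [MeasurableSpace F] [BorelSpace F] {ϖ : F} {q : ℝ} {ρ : F} (hρ : IsPrimitiveRoot ρ 3) {a : F}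

include hρ in
-- The first component of `ξ₁(a)` is the row `(0, 1)`, and a matrix of determinant one fixing it is
-- upper unipotent.
lemma stab_fst_eq {s : HGroup F} (hs : s ∈ stab hρ (xiOne ρ a)) :
    s.1 = slUnip (s.1 0 1) := by
  have e (i : Fin 4) (j : Fin 2) := congrFun (congrFun (show act ρ (xiOne ρ a) s = _ from hs) i) j
  have e00 := e 0 0
  have e01 := e 0 1
  simp [act, xiOne, Matrix.vecMul, dotProduct, Fin.sum_univ_two] at e00 e01
  have hd := s.1.2
  rw [Matrix.det_fin_two] at hd
  have hd' : s.1 0 0 * s.1 1 1 - s.1 0 1 * s.1 1 0 = 1 := hd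
  rw [e00, e01] at hd'
  refine Subtype.ext ?_
  change s.1.1 = !![1, s.1.1 0 1; 0, 1]
  conv_lhs => rw [Matrix.eta_fin_two s.1.1]
  ext i j
  fin_cases i <;> fin_cases j
  · simpa using hd'
  · rfl
  · exact e00
  · exact e01

lemma act_hMk (ξ : F8 F) (g : SL(2, F)) (x y z : F) : act ρ ξ (hMk g (unipOf x y z)) =
    ![ξ 0 ᵥ* g.1, (ξ 1 + x • ξ 0) ᵥ* g.1, (ξ 2 - y • ξ 0) ᵥ* g.1,
      (ξ 3 + x • ξ 2 + (y * ρ ^ 2) • ξ 1 - (y * x + ρ * z) • ξ 0) ᵥ* g.1] := by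
  simp only [act, hMk_fst, hMk_snd, ux_unipOf, uy_unipOf, uz_unipOf]

include hρ in
-- The third component of the equation `ξ·h = ξ` determines `y` from `b`, and the fourth then gives
-- `z = ρ a y`.
lemma exists_stab_fst_eq (b : F) : ∃ s ∈ stab hρ (xiOne ρ a), s.1 = slUnip b := by
  refine ⟨hMk (slUnip b) (unipOf 0 (-(1 / 2) * ρ ^ 2 * (a ^ 2)⁻¹ * b)
    (ρ * (-(1 / 2) * ρ ^ 2 * (a ^ 2)⁻¹ * b) * a)), ?_, rfl⟩
  change act ρ (xiOne ρ a) _ = xiOne ρ a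
  rw [act_hMk, show (slUnip b).1 = !![1, b; 0, 1] from rfl]
  ext i j
  fin_cases i <;> fin_cases j <;>
    simp [xiOne]
  ring

/-- The Haar measure on the stabilizer in coordinates. -/
lemma map_stab (μS : Measure (stab hρ (xiOne ρ a))) [μS.IsHaarMeasure]
    (hμS : μS {h | h.1.1 ∈ integralSL2 F} = 1) :
    Measure.map (fun s : stab hρ (xiOne ρ a) => s.1.1 0 1) μS = haarF F := by
  have hm : Measurable fun s : stab hρ (xiOne ρ a) => s.1.1 0 1 :=
    ((HGroup.continuous_fst_apply 0 1).comp continuous_subtype_val).measurable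
  have hinv : (Measure.map (fun s : stab hρ (xiOne ρ a) => s.1.1 0 1) μS).IsAddLeftInvariant := by
    refine ⟨fun b => ?_⟩
    obtain ⟨s₀, hs₀, hb⟩ := exists_stab_fst_eq (a := a) hρ b
    rw [Measure.map_map (measurable_const_add b) hm]
    ext A hA
    rw [Measure.map_apply ((measurable_const_add b).comp hm) hA, Measure.map_apply hm hA,
      ← measure_preimage_mul μS ⟨s₀, hs₀⟩
        ((fun s : stab hρ (xiOne ρ a) => s.1.1 0 1) ⁻¹' A)]
    congr 1
    ext s
    have e : (s₀ * s.1).1 0 1 = b + s.1.1 0 1 := by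
      rw [HGroup.fst_mul, hb, stab_fst_eq hρ s.2, slUnip_mul]
      rfl
    simp only [Set.mem_preimage, Function.comp_apply, Subgroup.coe_mul]
    rw [← e]
  refine eq_haarF_of_isAddLeftInvariant _ ?_
  rw [Measure.map_apply hm Metric.isClosed_closedBall.measurableSet, ← hμS]
  congr 1
  ext s
  rw [Set.mem_preimage, mem_closedBall_zero_iff, Set.mem_ofPred_eq]
  constructor
  · intro hb i j
    rw [stab_fst_eq hρ s.2]
    change ‖!![1, s.1.1 0 1; 0, 1] i j‖ ≤ 1
    fin_cases i <;> fin_cases j <;> simp [hb]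
  · intro hs
    exact hs 0 1

variable (h : IsNormalizedUniformizer ϖ q)

include h in
-- This supplies a weight of total mass one along every `H_ξ`-orbit. If `g` has torus exponent `k`,
-- then `s * g` meets only the `k`-th set, and it does so when the parameter of `s` lies in a ball
-- of volume `q ^ (2 * k)`, which the factor compensates.
lemma lintegral_stab_eq_one (μS : Measure (stab hρ (xiOne ρ a))) [μS.IsHaarMeasure]
    (hμS : μS {h | h.1.1 ∈ integralSL2 F} = 1) (g : HGroup F) :
    ∫⁻ s, ∑' k : ℤ, ENNReal.ofReal (q ^ (-(2 * k))) *
      {x : HGroup F | (slTorus h.ne_zero k)⁻¹ * x.1 ∈ integralSL2 F}.indicator 1 (s.1 * g) ∂μS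
      = 1 := by
  obtain ⟨b₀, k, κ, hκ, e⟩ := exists_slUnip_mul_slTorus h g.1
  have hiff : ∀ (s : stab hρ (xiOne ρ a)) (k' : ℤ), s.1 * g ∈
      {x : HGroup F | (slTorus h.ne_zero k')⁻¹ * x.1 ∈ integralSL2 F} ↔
      k' = k ∧ ‖s.1.1 0 1 + b₀‖ ≤ q ^ (2 * k) := by
    intro s k'
    rw [Set.mem_ofPred_eq, HGroup.fst_mul, e, stab_fst_eq hρ s.2, ← mul_assoc (slUnip _),
      ← mul_assoc (slUnip _), slUnip_mul, slTorus_inv_mul_mem_iff h _ _ _ hκ]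
    rfl
  have hterm : ∀ s : stab hρ (xiOne ρ a), ∑' k' : ℤ, ENNReal.ofReal (q ^ (-(2 * k'))) *
      {x : HGroup F | (slTorus h.ne_zero k')⁻¹ * x.1 ∈ integralSL2 F}.indicator 1 (s.1 * g) =
      (ENNReal.ofReal (q ^ (-(2 * k)))) *
        ((fun b : F => b + b₀) ⁻¹' Metric.closedBall 0 (q ^ (2 * k))).indicator 1 (s.1.1 0 1) := by
    intro s
    rw [tsum_eq_single k]
    · congr 1
      by_cases hs : ‖s.1.1 0 1 + b₀‖ ≤ q ^ (2 * k)
      · rw [Set.indicator_of_mem ((hiff s k).mpr ⟨rfl, hs⟩), Set.indicator_of_mem]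
        · rfl
        · rwa [Set.mem_preimage, mem_closedBall_zero_iff]
      · rw [Set.indicator_of_notMem (fun hm => hs ((hiff s k).mp hm).2), Set.indicator_of_notMem]
        rwa [Set.mem_preimage, mem_closedBall_zero_iff]
    · intro k' hk'
      rw [Set.indicator_of_notMem (fun hm => hk' ((hiff s k').mp hm).1), mul_zero]
  simp only [hterm]
  have hm : Measurable fun s : stab hρ (xiOne ρ a) => s.1.1 0 1 :=
    ((HGroup.continuous_fst_apply 0 1).comp continuous_subtype_val).measurable
  have hA : MeasurableSet ((fun b : F => b + b₀) ⁻¹' Metric.closedBall 0 (q ^ (2 * k))) :=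
    (measurable_add_const b₀) Metric.isClosed_closedBall.measurableSet
  have hf : Measurable fun b : F => (ENNReal.ofReal (q ^ (-(2 * k)))) *
      ((fun b : F => b + b₀) ⁻¹' Metric.closedBall 0 (q ^ (2 * k))).indicator 1 b :=
    measurable_const.mul (measurable_one.indicator hA)
  rw [← lintegral_map hf hm, map_stab hρ μS hμS, lintegral_const_mul _
    (measurable_one.indicator hA), lintegral_indicator_one hA, measure_preimage_add_right,
    h.haarF_closedBall_zero, ← ENNReal.ofReal_mul (zpow_pos h.pos _).le,
    ← zpow_add₀ h.pos.ne', neg_add_cancel, zpow_zero, ENNReal.ofReal_one]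

end Stabilizer

/-! ### Integration over `H_ξ \ H` by torus cosets. -/

section QuotientMeasure

variable {F : Type*} [NontriviallyNormedField F] [IsUltrametricDist F] [ProperSpace F]
  [MeasurableSpace F] [BorelSpace F] {ϖ : F} {q : ℝ} {ρ : F} (hρ : IsPrimitiveRoot ρ 3) {a : F}
  (h : IsNormalizedUniformizer ϖ q)

lemma measurable_mk_stabQuot :
    Measurable (fun g : HGroup F => (Quotient.mk _ g : StabQuot hρ (xiOne ρ a))) :=
  measurable_quotient_mk''

lemma mk_stab_mul {s : HGroup F} (hs : s ∈ stab hρ (xiOne ρ a)) (g : HGroup F) :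
    (Quotient.mk _ (s * g) : StabQuot hρ (xiOne ρ a)) = Quotient.mk _ g := by
  refine Quotient.sound (QuotientGroup.rightRel_apply.mpr ?_)
  rw [_root_.mul_inv_rev, mul_inv_cancel_left]
  exact (stab hρ (xiOne ρ a)).inv_mem hs

lemma isOpen_slTorus_mul_integralSL2 (h0 : ϖ ≠ 0) (k : ℤ) :
    IsOpen {x : HGroup F | (slTorus h0 k)⁻¹ * x.1 ∈ integralSL2 F} :=
  (isOpen_integralSL2_fst (F := F)).preimage
    (continuous_const_mul (hMk (slTorus h0 k) (1 : unip F))⁻¹)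

/-- The quotient measure as a sum over the torus of `SL₂`. -/
lemma quotientMeasure_eq_sum (μH : Measure (HGroup F)) [μH.IsHaarMeasure]
    (μS : Measure (stab hρ (xiOne ρ a))) [μS.IsHaarMeasure]
    (hμS : μS {h | h.1.1 ∈ integralSL2 F} = 1)
    (ν : Measure (StabQuot hρ (xiOne ρ a)))
    (hν : IsQuotientMeasure hρ (xiOne ρ a) μH μS ν) :
    ν = Measure.sum fun k : ℤ => ENNReal.ofReal (q ^ (-(2 * k))) •
      Measure.map (fun g : HGroup F => (Quotient.mk _ (hMk (slTorus h.ne_zero k) 1 * g) :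
        StabQuot hρ (xiOne ρ a))) (μH.restrict {g | g.1 ∈ integralSL2 F}) := by
  have hπ := measurable_mk_stabQuot hρ (a := a)
  ext A hA
  have hmk : ∀ k : ℤ, Measurable fun g : HGroup F =>
      (Quotient.mk _ (hMk (slTorus h.ne_zero k) 1 * g) : StabQuot hρ (xiOne ρ a)) :=
    fun k => hπ.comp (measurable_const_mul _)
  set B : ℤ → Set (HGroup F) := fun k => {x | (slTorus h.ne_zero k)⁻¹ * x.1 ∈ integralSL2 F}
    with hB
  set E : Set (HGroup F) := (fun g => (Quotient.mk _ g : StabQuot hρ (xiOne ρ a))) ⁻¹' A with hE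
  have hEm : MeasurableSet E := hπ hA
  have hBm : ∀ k, MeasurableSet (B k) := fun k =>
    (isOpen_slTorus_mul_integralSL2 h.ne_zero k).measurableSet
  have hfm : ∀ k : ℤ, Measurable fun g : HGroup F => ENNReal.ofReal (q ^ (-(2 * k))) *
      (B k).indicator (1 : HGroup F → ℝ≥0∞) g :=
    fun k => measurable_const.mul (measurable_one.indicator (hBm k))
  -- The defining property of `ν` is applied to the indicator of the preimage of `A` times the
  -- weight, whose fibre integrals are one.
  have key := hν (fun g => E.indicator 1 g * ∑' k : ℤ, ENNReal.ofReal (q ^ (-(2 * k))) *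
      (B k).indicator 1 g) ((measurable_one.indicator hEm).mul (Measurable.tsum hfm))
      (A.indicator 1) (by
        intro g
        have e : ∀ s : stab hρ (xiOne ρ a), E.indicator (1 : HGroup F → ℝ≥0∞) (s.1 * g) =
            A.indicator 1 (Quotient.mk _ g : StabQuot hρ (xiOne ρ a)) := by
          intro s
          rw [← mk_stab_mul hρ s.2 g]
          rfl
        simp only [e]
        rw [lintegral_const_mul _ ?_, lintegral_stab_eq_one hρ h μS hμS g, mul_one]
        exact (Measurable.tsum hfm).comp
          (((continuous_mul_const g).comp continuous_subtype_val).measurable))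
  rw [lintegral_indicator_one hA] at key
  rw [← key, Measure.sum_apply _ hA]
  have e1 : ∀ g : HGroup F, E.indicator 1 g * ∑' k : ℤ, ENNReal.ofReal (q ^ (-(2 * k))) *
      (B k).indicator 1 g = ∑' k : ℤ, ENNReal.ofReal (q ^ (-(2 * k))) *
        (B k ∩ E).indicator (1 : HGroup F → ℝ≥0∞) g := by
    intro g
    rw [← ENNReal.tsum_mul_left]
    refine tsum_congr fun k => ?_
    rw [Set.inter_indicator_one]
    simp only [Pi.mul_apply]
    ring
  simp only [e1]
  have hm : ∀ k : ℤ, AEMeasurable (fun g => ENNReal.ofReal (q ^ (-(2 * k))) *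
      (B k ∩ E).indicator (1 : HGroup F → ℝ≥0∞) g) μH := fun k =>
    (measurable_const.mul (measurable_one.indicator ((hBm k).inter hEm))).aemeasurable
  rw [lintegral_tsum hm]
  refine tsum_congr fun k => ?_
  rw [lintegral_const_mul _ (measurable_one.indicator ((hBm k).inter hEm)),
    lintegral_indicator_one ((hBm k).inter hEm), Measure.smul_apply, smul_eq_mul,
    Measure.map_apply (hmk k) hA, Measure.restrict_apply (hmk k hA),
    ← measure_preimage_mul μH (hMk (slTorus h.ne_zero k) 1) (B k ∩ E)]
  congr 2
  ext g
  simp only [hB, hE, Set.mem_preimage, Set.mem_inter_iff, Set.mem_ofPred_eq, HGroup.fst_mul, hMk_fst,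
    inv_mul_cancel_left]
  exact and_comm

/-- Integration of right `SL₂(𝒪)`-invariant functions on the quotient. -/
lemma integral_stabQuot (μH : Measure (HGroup F)) [μH.IsHaarMeasure] (hμH : μH (integralH F) = 1)
    (μS : Measure (stab hρ (xiOne ρ a))) [μS.IsHaarMeasure]
    (hμS : μS {h | h.1.1 ∈ integralSL2 F} = 1)
    (ν : Measure (StabQuot hρ (xiOne ρ a)))
    (hν : IsQuotientMeasure hρ (xiOne ρ a) μH μS ν)
    {f : StabQuot hρ (xiOne ρ a) → ℂ} {g : HGroup F → ℂ}
    (hfg : ∀ x, f (Quotient.mk _ x) = g x) (hg : Measurable g)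
    (hinv : ∀ x, ∀ κ ∈ integralSL2 F, g (x * hMk κ 1) = g x) (s : Finset ℤ)
    (hs : ∀ k, k ∉ s → ∀ x y z : F, g (hMk (slTorus h.ne_zero k) (unipOf x y z)) = 0)
    (hint : ∀ k ∈ s, Integrable (fun p : F × F × F =>
      g (hMk (slTorus h.ne_zero k) (unipOf p.1 p.2.1 p.2.2))) (haarF3 F)) :
    Integrable f ν ∧ ∫ c, f c ∂ν = ∑ k ∈ s, (q : ℂ) ^ (-(2 * k)) *
      ∫ p : F × F × F, g (hMk (slTorus h.ne_zero k) (unipOf p.1 p.2.1 p.2.2)) ∂haarF3 F := by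
  have hf : Measurable f := measurable_from_quotient.mpr (by
    have e : f ∘ Quotient.mk'' = g := funext hfg
    rw [e]
    exact hg)
  have hπ := measurable_mk_stabQuot hρ (a := a)
  have hmk : ∀ k : ℤ, Measurable fun g : HGroup F =>
      (Quotient.mk _ (hMk (slTorus h.ne_zero k) 1 * g) : StabQuot hρ (xiOne ρ a)) :=
    fun k => hπ.comp (measurable_const_mul _)
  set μ₀ := μH.restrict {g : HGroup F | g.1 ∈ integralSL2 F} with hμ₀
  have hcm : Measurable (HGroup.coords : HGroup F → F × F × F) :=
    HGroup.continuous_coords.measurable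
  set G : ℤ → F × F × F → ℂ := fun k p =>
    g (hMk (slTorus h.ne_zero k) (unipOf p.1 p.2.1 p.2.2)) with hG
  have hGm : ∀ k, AEStronglyMeasurable (G k) (haarF3 F) := by
    intro k
    by_cases hk : k ∈ s
    · exact (hint k hk).aestronglyMeasurable
    · have : G k = 0 := by funext p; exact hs k hk _ _ _
      rw [this]
      exact aestronglyMeasurable_zero
  have hae : ∀ k : ℤ, (fun x : HGroup F => f (Quotient.mk _ (hMk (slTorus h.ne_zero k) 1 * x)))
      =ᵐ[μ₀] fun x => G k x.coords := by
    intro k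
    filter_upwards [ae_restrict_mem isOpen_integralSL2_fst.measurableSet] with x hx
    rw [hfg]
    -- The factors `SL₂` and `N` commute, so the `SL₂(𝒪)` part can be moved to the right, where
    -- invariance removes it.
    have e : hMk (slTorus h.ne_zero k) 1 * x = hMk (slTorus h.ne_zero k) x.2 * hMk x.1 1 :=
      Prod.ext rfl ((one_mul x.2).trans (mul_one x.2).symm)
    rw [e, hinv _ _ hx, hG]
    simp only [HGroup.coords, unipOf_coords]
  have hmap := map_coords_restrict μH hμH
  rw [← hμ₀] at hmap
  set m : ℤ → Measure (StabQuot hρ (xiOne ρ a)) := fun k => ENNReal.ofReal (q ^ (-(2 * k))) •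
    Measure.map (fun g : HGroup F => (Quotient.mk _ (hMk (slTorus h.ne_zero k) 1 * g) :
        StabQuot hρ (xiOne ρ a))) μ₀ with hm
  have hνm : ν = Measure.sum m := quotientMeasure_eq_sum hρ h μH μS hμS ν hν
  have hint0 : ∀ k, Integrable (G k) (haarF3 F) := by
    intro k
    by_cases hk : k ∈ s
    · exact hint k hk
    · have : G k = 0 := by funext p; exact hs k hk _ _ _
      rw [this]
      exact integrable_zero _ _ _
  have hintm : ∀ k, Integrable f (m k) := by
    intro k
    refine Integrable.smul_measure ?_ ENNReal.ofReal_ne_top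
    refine (integrable_map_measure hf.aestronglyMeasurable (hmk k).aemeasurable).mpr ?_
    refine Integrable.congr ?_ (hae k).symm
    have := hint0 k
    rw [← hmap] at this
    exact this.comp_measurable hcm
  have hval : ∀ k, ∫ c, f c ∂m k = (q : ℂ) ^ (-(2 * k)) * ∫ p, G k p ∂haarF3 F := by
    intro k
    rw [hm]
    simp only
    rw [integral_smul_measure, integral_map (hmk k).aemeasurable hf.aestronglyMeasurable,
      integral_congr_ae (hae k), ← hmap, integral_map hcm.aemeasurable (hmap ▸ hGm k),
      ENNReal.toReal_ofReal (zpow_pos h.pos _).le, Complex.real_smul]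
    push_cast
    rfl
  have hnorm : ∀ k, k ∉ s → ∫ c, ‖f c‖ ∂m k = 0 := by
    intro k hk
    rw [hm]
    simp only
    rw [integral_smul_measure, integral_map (hmk k).aemeasurable hf.norm.aestronglyMeasurable]
    have : (fun x : HGroup F => ‖f (Quotient.mk _ (hMk (slTorus h.ne_zero k) 1 * x))‖)
        =ᵐ[μ₀] fun _ => (0 : ℝ) := by
      filter_upwards [hae k] with x hx
      rw [hx, hG]
      simp [hs k hk]
    rw [integral_congr_ae this]
    simp
  have hfi : Integrable f (Measure.sum m) :=
    integrable_sum_measure hintm (summable_of_ne_finset_zero (s := s) hnorm)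
  rw [hνm]
  refine ⟨hfi, ?_⟩
  rw [integral_sum_measure hfi, tsum_eq_sum (s := s)]
  · exact Finset.sum_congr rfl fun k _ => hval k
  · intro k hk
    rw [hval]
    have : G k = 0 := by funext p; exact hs k hk _ _ _
    simp [this]

end QuotientMeasure

/-! ### The orbital integral of a translate of the spherical vector -/

section TorusIntegrand

variable {F : Type*} [NontriviallyNormedField F] [IsUltrametricDist F] [ProperSpace F]
  [MeasurableSpace F] [BorelSpace F] {ϖ : F} {q : ℝ} {ψ : AddChar F Circle} {ρ a : F}

open scoped Classical in
/-- The integrand `h ↦ (ω(t)φ_∘)(ξ·h) 𝔠(ξ,h) θ(h)` for `t = diag(ϖ^(i+j), ϖ^j, 1)`. -/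
def torusIntegrand (q : ℝ) (ψ : AddChar F Circle) (ρ : F) (ξ : F8 F) (i j : ℤ) (g : HGroup F) : ℂ :=
  if ∀ k l, ‖act ρ ξ g k l‖ ≤ q ^ radExp i j k then
    (q : ℂ) ^ (-(2 * (i + j))) * (ψ (phase ρ ξ g + ux g.2 + uy g.2) : ℂ) else 0

lemma hMk_mul (g g' : SL(2, F)) (u u' : unip F) : hMk g u * hMk g' u' = hMk (g * g') (u * u') := rfl

lemma unipOf_mul (x y z x' y' z' : F) :
    unipOf x y z * unipOf x' y' z' = unipOf (x + x') (y + y') (z + z' + x * y') := by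
  refine Subtype.ext (Units.ext ?_)
  exact unipMat_mul x y z x' y' z'

section Translate

variable (hF : 3 < ringChar (residueField F)) (h : IsNormalizedUniformizer ϖ q)
  (hψ : Continuous ψ) (hψc : HasConductorIntegers ψ) (hρ : IsPrimitiveRoot ρ 3)

include hF hψ hψc hρ in
-- Since `u` acts by `φ ↦ 𝔠(ξ, u) φ(ξ·u)`, the cocycle relation absorbs `u` into the group variable.
-- Only `θ(u)⁻¹` is left over.
lemma weilGL_toGL_mul (c : IwasawaCoord F) (ξ : F8 F) (g : HGroup F) :
    weilGL ψ ρ (c.toGL h.ne_zero) (phiCirc F) (act ρ ξ g) * (cocycle ψ ρ ξ g : ℂ) *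
        (theta ψ g : ℂ) =
      (ψ (-c.x - c.y) : ℂ) *
        torusIntegrand q ψ ρ ξ c.i c.j (g * hMk 1 (unipOf c.x c.y c.z)) := by
  rw [IwasawaCoord.toGL, weilGL_unip_torus hF h hψ hψc hρ, ← act_mul hρ, torusIntegrand]
  split_ifs with hc
  · rw [phase_mul hρ, cocycle, theta, mul_left_comm, mul_assoc, mul_assoc]
    congr 1
    rw [← Circle.coe_mul, ← Circle.coe_mul, ← Circle.coe_mul, ← AddChar.map_add_eq_mul,
      ← AddChar.map_add_eq_mul, ← AddChar.map_add_eq_mul]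
    congr 2
    simp only [HGroup.snd_mul, hMk_snd, ux_mul, uy_mul, ux_unipOf, uy_unipOf]
    ring
  · simp

end Translate

lemma continuous_act (ξ : F8 F) (k : Fin 4) (l : Fin 2) :
    Continuous fun g : HGroup F => act ρ ξ g k l := by
  have h1 := fun i j => HGroup.continuous_fst_apply (F := F) i j
  have h1' : ∀ i j, Continuous fun g : HGroup F => g.1.1 i j := h1
  have h2 := HGroup.continuous_ux (F := F)
  have h3 := HGroup.continuous_uy (F := F)
  have h4 := HGroup.continuous_uz (F := F)
  fin_cases k <;> simp only [act] <;> fun_prop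

lemma continuous_phase (ξ : F8 F) : Continuous fun g : HGroup F => phase ρ ξ g := by
  have h2 := HGroup.continuous_ux (F := F)
  have h3 := HGroup.continuous_uy (F := F)
  have h4 := HGroup.continuous_uz (F := F)
  simp only [phase_eq]
  fun_prop

lemma measurable_torusIntegrand (hψ : Continuous ψ) (ξ : F8 F) (i j : ℤ) :
    Measurable (torusIntegrand q ψ ρ ξ i j) := by
  have h2 := HGroup.continuous_ux (F := F)
  have h3 := HGroup.continuous_uy (F := F)
  have h4 := continuous_phase (ρ := ρ) ξ
  refine Measurable.ite ?_ (Continuous.measurable (by fun_prop)) measurable_const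
  have : {g : HGroup F | ∀ k l, ‖act ρ ξ g k l‖ ≤ q ^ radExp i j k} =
      ⋂ k, ⋂ l, {g | ‖act ρ ξ g k l‖ ≤ q ^ radExp i j k} := by
    ext g
    simp
  rw [this]
  refine (isClosed_iInter fun k => isClosed_iInter fun l => ?_).measurableSet
  exact isClosed_le (continuous_act ξ k l).norm continuous_const

lemma norm_vecMul_le {κ : SL(2, F)} (hκ : κ ∈ integralSL2 F) {v : Fin 2 → F} {r : ℝ}
    (hv : ∀ l, ‖v l‖ ≤ r) (l : Fin 2) : ‖(v ᵥ* κ.1) l‖ ≤ r := by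
  have h0 : 0 ≤ r := (norm_nonneg _).trans (hv 0)
  have h1 : ∀ l', ‖v l' * κ.1 l' l‖ ≤ r := fun l' => by
    rw [norm_mul]
    exact (mul_le_mul (hv l') (hκ l' l) (norm_nonneg _) h0).trans_eq (mul_one r)
  rw [Matrix.vecMul, dotProduct, Fin.sum_univ_two]
  exact norm_add_le_of_le (h1 0) (h1 1)

lemma norm_vecMul_le_iff {κ : SL(2, F)} (hκ : κ ∈ integralSL2 F) (v : Fin 2 → F) (r : ℝ) :
    (∀ l, ‖(v ᵥ* κ.1) l‖ ≤ r) ↔ ∀ l, ‖v l‖ ≤ r := by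
  refine ⟨fun hv l => ?_, fun hv l => norm_vecMul_le hκ hv l⟩
  have h1 := norm_vecMul_le ((integralSL2Subgroup F).inv_mem hκ) hv l
  have h2 : κ.1 * (κ⁻¹).1 = 1 := congrArg Subtype.val (mul_inv_cancel κ)
  rwa [Matrix.vecMul_vecMul, h2, Matrix.vecMul_one] at h1

lemma torusIntegrand_mul_integral (hρ : IsPrimitiveRoot ρ 3) (ξ : F8 F) (i j : ℤ) (g : HGroup F)
    {κ : SL(2, F)} (hκ : κ ∈ integralSL2 F) :
    torusIntegrand q ψ ρ ξ i j (g * hMk κ 1) = torusIntegrand q ψ ρ ξ i j g := by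
  have h1 : ∀ k, act ρ ξ (g * hMk κ 1) k = act ρ ξ g k ᵥ* κ.1 := by
    intro k
    rw [act_mul hρ]
    fin_cases k <;> simp [act]
  have h2 : phase ρ ξ (g * hMk κ 1) = phase ρ ξ g := by
    rw [phase_mul hρ, phase_eq ρ _ (hMk κ 1)]
    simp
  unfold torusIntegrand
  simp only [h1, h2, norm_vecMul_le_iff hκ, HGroup.snd_mul, hMk_snd, mul_one]

end TorusIntegrand

/-! ### Support and phase on a torus coset. -/

section TorusValue

variable {F : Type*} [NontriviallyNormedField F] [IsUltrametricDist F] [ProperSpace F]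
  [MeasurableSpace F] [BorelSpace F] {ϖ : F} {q : ℝ} {ψ : AddChar F Circle} {ρ a : F}
  (hF : 3 < ringChar (residueField F)) (h : IsNormalizedUniformizer ϖ q)
  (hψ : Continuous ψ) (hψc : HasConductorIntegers ψ) (hρ : IsPrimitiveRoot ρ 3)
  {e : ℤ} (he : ‖a‖ = q ^ e)

/-- The conditions cutting out the support of the integrand on the torus coset `k`. -/
def TorusCond (q : ℝ) (ρ a : F) (e i j k : ℤ) (p : F × F × F) : Prop :=
  (-(i + j) ≤ k ∧ k ≤ 2 * e + i) ∧ (‖p.1 + a‖ ≤ q ^ (j + k) ∧ ‖p.1‖ ≤ q ^ (2 * e - k)) ∧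
    ‖p.2.1‖ ≤ q ^ (i + k) ∧ ‖p.2.2 - ρ ^ 2 * (p.2.1 * ρ ^ 2 * a - p.2.1 * p.1)‖ ≤ q ^ k

include hF h hρ he in
lemma forall_act_slTorus_iff (i j k : ℤ) (x y z : F) :
    (∀ k' l, ‖act ρ (xiOne ρ a) (hMk (slTorus h.ne_zero k) (unipOf x y z)) k' l‖ ≤
      q ^ radExp i j k') ↔ TorusCond q ρ a e i j k (x, y, z) := by
  have hρ3 := hρ.pow_eq_one
  have hρ1 := norm_rho hρ
  have hq := h.pos
  have e1 : ∀ (t : F) (r s : ℤ), ‖t * ϖ ^ r‖ ≤ q ^ s ↔ ‖t‖ ≤ q ^ (s + r) := by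
    intro t r s
    rw [norm_mul, h.norm_zpow, _root_.zpow_neg, ← div_eq_mul_inv, div_le_iff₀ (zpow_pos hq _),
      ← zpow_add₀ hq.ne']
  set c := -(1 / 2) * ρ ^ 2 * (a ^ 2)⁻¹ with hc
  have hcn : ‖c‖ = q ^ (-(2 * e)) := by
    rw [hc, norm_mul, norm_mul, norm_neg, norm_div, norm_one, norm_two hF, norm_pow, hρ1, norm_inv,
      norm_pow, he, _root_.zpow_neg, _root_.zpow_mul']
    norm_num
  have hw : y * ρ ^ 2 * a - y * x - ρ * z =
      -ρ * (z - ρ ^ 2 * (y * ρ ^ 2 * a - y * x)) := by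
    linear_combination (-(y * ρ ^ 2 * a - y * x)) * hρ3
  have hact : act ρ (xiOne ρ a) (hMk (slTorus h.ne_zero k) (unipOf x y z)) =
      ![![0, 1 * ϖ ^ k], ![0, (x + a) * ϖ ^ k], ![c * ϖ ^ (-k), -y * ϖ ^ k],
        ![c * x * ϖ ^ (-k), -ρ * (z - ρ ^ 2 * (y * ρ ^ 2 * a - y * x)) * ϖ ^ k]] := by
    rw [act_hMk, show (slTorus h.ne_zero k).1 = !![ϖ ^ (-k), 0; 0, ϖ ^ k] from rfl, ← hw]
    ext k' l
    fin_cases k' <;> fin_cases l <;> simp [xiOne, hc] <;> ring_nf <;> simp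
  rw [hact]
  have e2 : ‖c * x‖ ≤ q ^ (-k) ↔ ‖x‖ ≤ q ^ (2 * e - k) := by
    rw [norm_mul, hcn, _root_.zpow_neg, inv_mul_le_iff₀ (zpow_pos hq _), ← zpow_add₀ hq.ne']
    ring_nf
  have e3 : ‖(1 : F)‖ ≤ q ^ (i + j + k) ↔ 0 ≤ i + j + k := by
    rw [norm_one, ← zpow_zero q, h.zpow_le_zpow_iff]
  have e4 : ∀ t : F, ‖-ρ * t‖ = ‖t‖ := fun t => by rw [norm_mul, norm_neg, hρ1, one_mul]
  have hall : ∀ P : Fin 4 → Prop, (∀ k, P k) ↔ P 0 ∧ P 1 ∧ P 2 ∧ P 3 := fun P =>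
    ⟨fun hP => ⟨hP 0, hP 1, hP 2, hP 3⟩, fun ⟨h0, h1, h2, h3⟩ k => by fin_cases k <;> assumption⟩
  rw [hall]
  simp only [TorusCond, Fin.forall_fin_two, radExp, Matrix.cons_val, norm_zero,
    (zpow_pos hq _).le, true_and, e1, e2, e3, e4, hcn, h.zpow_le_zpow_iff, norm_neg, zero_add]
  have e5 : -(2 * e) ≤ i + -k ↔ k ≤ 2 * e + i := by omega
  have e6 : 0 ≤ i + j + k ↔ -(i + j) ≤ k := by omega
  rw [e5, e6]
  tauto

include hF hρ in
-- Once `z` is replaced by its displacement from the centre occurring in `TorusCond`, the phase for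
-- fixed `x` is affine in `y` and in the new variable, without a mixed term. Both can then be
-- integrated as additive characters.
lemma phase_slTorus (ha : a ≠ 0) (k : ℤ) (x y z : F) :
    phase ρ (xiOne ρ a) (hMk (slTorus h.ne_zero k) (unipOf x y z)) + x + y =
      x + ρ * x * (a - ρ * x) / a ^ 2 * y + -(ρ ^ 2 * (a - ρ * x) / a ^ 2) *
        (z - ρ ^ 2 * (y * ρ ^ 2 * a - y * x)) := by
  have h2 := two_ne_zero_of_residueChar hF
  have hr := cube_root_sum hρ
  rw [phase_eq]
  simp only [sympl_apply, xiOne, Matrix.cons_val, hMk_snd, ux_unipOf, uy_unipOf, uz_unipOf]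
  field_simp
  grind

end TorusValue

/-! ### Integration over `N` on a torus coset. -/

section TorusIntegral

variable {F : Type*} [NontriviallyNormedField F] [IsUltrametricDist F] [ProperSpace F]
  [MeasurableSpace F] [BorelSpace F] {ϖ : F} {q : ℝ} {ψ : AddChar F Circle} {ρ a : F}
  (hF : 3 < ringChar (residueField F)) (h : IsNormalizedUniformizer ϖ q)
  (hψ : Continuous ψ) (hψc : HasConductorIntegers ψ) (hρ : IsPrimitiveRoot ρ 3)
  {e : ℤ} (he : ‖a‖ = q ^ e)

open scoped Classical in
include hF hρ he in
lemma torusIntegrand_slTorus (i j k : ℤ) (p : F × F × F) :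
    torusIntegrand q ψ ρ (xiOne ρ a) i j (hMk (slTorus h.ne_zero k) (unipOf p.1 p.2.1 p.2.2)) =
      if TorusCond q ρ a e i j k p then (q : ℂ) ^ (-(2 * (i + j))) *
        (ψ (p.1 + ρ * p.1 * (a - ρ * p.1) / a ^ 2 * p.2.1 + -(ρ ^ 2 * (a - ρ * p.1) / a ^ 2) *
          (p.2.2 - ρ ^ 2 * (p.2.1 * ρ ^ 2 * a - p.2.1 * p.1))) : ℂ) else 0 := by
  have ha : a ≠ 0 := norm_ne_zero_iff.mp (he ▸ (zpow_pos h.pos e).ne')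
  unfold torusIntegrand
  refine if_congr (forall_act_slTorus_iff hF h hρ he i j k _ _ _) ?_ rfl
  rw [← phase_slTorus hF h hρ ha k]
  simp only [hMk_snd, ux_unipOf, uy_unipOf]

include hF hρ he in
lemma torusIntegrand_slTorus_eq_zero {i j k : ℤ} (hk : k ∉ Finset.Icc (-(i + j)) (2 * e + i))
    (x y z : F) : torusIntegrand q ψ ρ (xiOne ρ a) i j
      (hMk (slTorus h.ne_zero k) (unipOf x y z)) = 0 := by
  rw [torusIntegrand_slTorus hF h hρ he i j k (x, y, z), if_neg]
  exact fun hc => hk (Finset.mem_Icc.mpr hc.1)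

include hF hψ hρ he in
lemma integrable_torusIntegrand (i j k : ℤ) :
    Integrable (fun p : F × F × F => torusIntegrand q ψ ρ (xiOne ρ a) i j
      (hMk (slTorus h.ne_zero k) (unipOf p.1 p.2.1 p.2.2))) (haarF3 F) := by
  classical
  simp only [torusIntegrand_slTorus hF h hρ he]
  have hρ1 := norm_rho hρ
  refine integrable_ite_of_bounded _ (R := max (q ^ (2 * e - k)) (max (q ^ (i + k))
    (max (q ^ k) (q ^ (i + k) * max (q ^ e) (q ^ (2 * e - k)))))) ?_ ?_ ?_
  · refine (MeasurableSet.const (α := F × F × F) (-(i + j) ≤ k ∧ k ≤ 2 * e + i)).inter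
      (((IsClosed.inter (X := F × F × F) (s₁ := {p | ‖p.1 + a‖ ≤ q ^ (j + k)})
        (s₂ := {p | ‖p.1‖ ≤ q ^ (2 * e - k)}) ?_ ?_).inter
        (IsClosed.inter (X := F × F × F) (s₁ := {p | ‖p.2.1‖ ≤ q ^ (i + k)})
        (s₂ := {p | ‖p.2.2 - ρ ^ 2 * (p.2.1 * ρ ^ 2 * a - p.2.1 * p.1)‖ ≤ q ^ k})
        ?_ ?_)).measurableSet) <;>
    exact isClosed_le (by fun_prop) continuous_const
  · rintro ⟨x, y, z⟩ ⟨-, ⟨-, h1⟩, h2, h3⟩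
    simp only at h1 h2 h3
    rw [Prod.norm_def, Prod.norm_def]
    refine max_le_max h1 (max_le_max h2 ?_)
    have h4 : ‖ρ ^ 2 * (y * ρ ^ 2 * a - y * x)‖ ≤
        q ^ (i + k) * max (q ^ e) (q ^ (2 * e - k)) := by
      rw [show ρ ^ 2 * (y * ρ ^ 2 * a - y * x) = ρ ^ 2 * y * (ρ ^ 2 * a - x) by ring, norm_mul,
        norm_mul, norm_pow, hρ1, one_pow, one_mul]
      refine mul_le_mul h2 ?_ (norm_nonneg _) (zpow_pos h.pos _).le
      refine norm_sub_le_of_le ((norm_rho_sq_mul hρ he).le.trans (le_max_left _ _))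
        (h1.trans (le_max_right _ _))
    rw [← sub_add_cancel z (ρ ^ 2 * (y * ρ ^ 2 * a - y * x))]
    exact norm_add_le_of_le (h3.trans (le_max_left _ _)) (h4.trans (le_max_right _ _))
  · fun_prop

include h hψc in
lemma integral_ite_addChar_sub (c l : F) (k : ℤ) :
    ∫ x, (if ‖x - c‖ ≤ q ^ k then (ψ (l * (x - c)) : ℂ) else 0) ∂haarF F =
      if ‖l‖ ≤ q ^ (-k) then (q : ℂ) ^ k else 0 := by
  rw [integral_sub_right_eq_self (fun x => if ‖x‖ ≤ q ^ k then (ψ (l * x) : ℂ) else 0) c]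
  simpa using integral_ite_addChar h hψc 0 k l

include hF h hψ hψc hρ he in
-- Integration over `z` gives `q ^ k` and the bound on `x - ρ ^ 2 * a`; integration over `y` gives
-- `q ^ (i + k)` and the bound on the product. The remaining integral over `x` is that of level `κ =
-- 2e - k - i`.
lemma integral_torusIntegrand {i j k : ℤ} (hk : k ∈ Finset.Icc (-(i + j)) (2 * e + i)) :
    ∫ p : F × F × F, torusIntegrand q ψ ρ (xiOne ρ a) i j
      (hMk (slTorus h.ne_zero k) (unipOf p.1 p.2.1 p.2.2)) ∂haarF3 F =
      (q : ℂ) ^ (-(2 * (i + j))) * ((q : ℂ) ^ k * ((q : ℂ) ^ (i + k) *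
        levelIntegral q ψ ρ a e i j (2 * e - k - i))) := by
  classical
  have hk' := Finset.mem_Icc.mp hk
  have hρ1 := norm_rho hρ
  have hρ3 := hρ.pow_eq_one
  have hqe : ∀ s : ℤ, 0 < q ^ s := fun s => zpow_pos h.pos s
  rw [integral_haarF3 (integrable_torusIntegrand hF h hψ hρ he i j k)]
  have e1 : ∀ x y z : F, torusIntegrand q ψ ρ (xiOne ρ a) i j
      (hMk (slTorus h.ne_zero k) (unipOf x y z)) =
      (if ‖x + a‖ ≤ q ^ (j + k) ∧ ‖x‖ ≤ q ^ (2 * e - k) then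
        (q : ℂ) ^ (-(2 * (i + j))) * (ψ x : ℂ) else 0) *
      ((if ‖y‖ ≤ q ^ (i + k) then (ψ (ρ * x * (a - ρ * x) / a ^ 2 * y) : ℂ) else 0) *
        (if ‖z - ρ ^ 2 * (y * ρ ^ 2 * a - y * x)‖ ≤ q ^ k then
          (ψ (-(ρ ^ 2 * (a - ρ * x) / a ^ 2) *
            (z - ρ ^ 2 * (y * ρ ^ 2 * a - y * x))) : ℂ) else 0)) := by
    intro x y z
    rw [torusIntegrand_slTorus hF h hρ he i j k (x, y, z)]
    simp only [TorusCond, hk', and_self, true_and]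
    by_cases c1 : ‖x + a‖ ≤ q ^ (j + k) ∧ ‖x‖ ≤ q ^ (2 * e - k)
    · by_cases c2 : ‖y‖ ≤ q ^ (i + k)
      · by_cases c3 : ‖z - ρ ^ 2 * (y * ρ ^ 2 * a - y * x)‖ ≤ q ^ k
        · rw [if_pos ⟨c1, c2, c3⟩, if_pos c1, if_pos c2, if_pos c3, AddChar.map_add_eq_mul,
            AddChar.map_add_eq_mul, Circle.coe_mul, Circle.coe_mul]
          ring
        · rw [if_neg fun hc => c3 hc.2.2, if_neg c3, mul_zero, mul_zero]
      · rw [if_neg fun hc => c2 hc.2.1, if_neg c2, zero_mul, mul_zero]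
    · rw [if_neg fun hc => c1 hc.1, if_neg c1, zero_mul]
  have hn : ∀ x : F, ‖a - ρ * x‖ = ‖x - ρ ^ 2 * a‖ := fun x => by
    rw [show a - ρ * x = -ρ * (x - ρ ^ 2 * a) by linear_combination -a * hρ3, norm_mul, norm_neg,
      hρ1, one_mul]
  have ha2 : ‖a‖ ^ 2 = q ^ (2 * e) := by
    rw [he, ← zpow_natCast, ← _root_.zpow_mul, mul_comm]
    rfl
  have hl : ∀ x : F, ‖-(ρ ^ 2 * (a - ρ * x) / a ^ 2)‖ ≤ q ^ (-k) ↔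
      ‖x - ρ ^ 2 * a‖ ≤ q ^ (2 * e - k) := by
    intro x
    rw [norm_neg, norm_div, norm_mul, norm_pow, norm_pow, hρ1, one_pow, one_mul, hn, ha2,
      div_le_iff₀ (hqe _), ← zpow_add₀ h.pos.ne', show -k + 2 * e = 2 * e - k by ring]
  have hL : ∀ x : F, ‖ρ * x * (a - ρ * x) / a ^ 2‖ ≤ q ^ (-(i + k)) ↔
      ‖x‖ * ‖x - ρ ^ 2 * a‖ ≤ q ^ (2 * e - k - i) := by
    intro x
    rw [norm_div, norm_mul, norm_mul, norm_pow, hρ1, one_mul, hn, ha2,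
      div_le_iff₀ (hqe _), ← zpow_add₀ h.pos.ne',
      show -(i + k) + 2 * e = 2 * e - k - i by ring]
  simp only [e1, integral_const_mul, integral_ite_addChar_sub h hψc, integral_mul_const,
    integral_ite_addChar_zero h hψc, hl, hL]
  rw [levelIntegral, ← integral_const_mul, ← integral_const_mul, ← integral_const_mul]
  congr 1
  funext x
  have hc : LevelCond q ρ a e i j (2 * e - k - i) x ↔
      (‖x + a‖ ≤ q ^ (j + k) ∧ ‖x‖ ≤ q ^ (2 * e - k)) ∧
        ‖x‖ * ‖x - ρ ^ 2 * a‖ ≤ q ^ (2 * e - k - i) ∧ ‖x - ρ ^ 2 * a‖ ≤ q ^ (2 * e - k) := by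
    -- Within the range of `x`, bounding `x - ρ ^ 2 * a` is the same as bounding `a`.
    have e3 : ‖x‖ ≤ q ^ (2 * e - k) →
        (‖a‖ ≤ q ^ (2 * e - k) ↔ ‖x - ρ ^ 2 * a‖ ≤ q ^ (2 * e - k)) := by
      intro hx
      have hra : ‖ρ ^ 2 * a‖ = ‖a‖ := by rw [norm_mul, norm_pow, hρ1, one_pow, one_mul]
      rw [← hra]
      refine ⟨fun hy => norm_sub_le_of_le hx hy, fun hy => ?_⟩
      rw [← sub_sub_cancel x (ρ ^ 2 * a)]
      exact norm_sub_le_of_le hx hy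
    unfold LevelCond
    rw [show 2 * e - k - i + i = 2 * e - k by ring,
      show 2 * e + j - i - (2 * e - k - i) = j + k by ring]
    constructor
    · rintro ⟨h1, h2, h3, h4⟩
      exact ⟨⟨h4, h1⟩, h3, (e3 h1).mp h2⟩
    · rintro ⟨⟨h4, h1⟩, h3, h2⟩
      exact ⟨h1, (e3 h1).mpr h2, h3, h4⟩
  rw [if_congr hc rfl rfl]
  by_cases c1 : ‖x + a‖ ≤ q ^ (j + k) ∧ ‖x‖ ≤ q ^ (2 * e - k)
  · by_cases c2 : ‖x‖ * ‖x - ρ ^ 2 * a‖ ≤ q ^ (2 * e - k - i)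
    · by_cases c3 : ‖x - ρ ^ 2 * a‖ ≤ q ^ (2 * e - k)
      · rw [if_pos c1, if_pos c2, if_pos c3, if_pos ⟨c1, c2, c3⟩]
        ring
      · rw [if_pos c1, if_pos c2, if_neg c3, if_neg fun hc => c3 hc.2.2]
        simp
    · rw [if_pos c1, if_neg c2, zero_mul, mul_zero, if_neg fun hc => c2 hc.2.1]
      simp
  · rw [if_neg c1, zero_mul, if_neg fun hc => c1 hc.1]
    simp

end TorusIntegral

/-! ### Orbital integrals of the cosets and of the Hecke operator. -/

section OrbitalIntegralCoset

variable {F : Type*} [NontriviallyNormedField F] [IsUltrametricDist F] [ProperSpace F]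
  [MeasurableSpace F] [BorelSpace F] {ϖ : F} {q : ℝ} {ψ : AddChar F Circle} {ρ a : F}
  (hF : 3 < ringChar (residueField F)) (h : IsNormalizedUniformizer ϖ q)
  (hψ : Continuous ψ) (hψc : HasConductorIntegers ψ) (hρ : IsPrimitiveRoot ρ 3)
  (hrel : IsRelevant ψ hρ (xiOne ρ a))
  {e : ℤ} (he : ‖a‖ = q ^ e)
  (μH : Measure (HGroup F)) [μH.IsHaarMeasure] (hμH : μH (integralH F) = 1)
  (μS : Measure (stab hρ (xiOne ρ a))) [μS.IsHaarMeasure]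
  (hμS : μS {h | h.1.1 ∈ integralSL2 F} = 1)
  (ν : Measure (StabQuot hρ (xiOne ρ a))) (hν : IsQuotientMeasure hρ (xiOne ρ a) μH μS ν)

include hF hψ hψc he hμH hμS hν in
/-- The orbital integral of `ω(c)φ_∘`. -/
lemma integral_orbitalIntegrand_toGL (c : IwasawaCoord F) :
    Integrable (orbitalIntegrand ψ hρ hrel (weilGL ψ ρ (c.toGL h.ne_zero) (phiCirc F))) ν ∧
    ∫ s, orbitalIntegrand ψ hρ hrel (weilGL ψ ρ (c.toGL h.ne_zero) (phiCirc F)) s ∂ν =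
      (ψ (-c.x - c.y) : ℂ) * ((q : ℂ) ^ (-(2 * (c.i + c.j))) * levelSum q ψ ρ a e c.i c.j) := by
  set Θ := torusIntegrand q ψ ρ (xiOne ρ a) c.i c.j with hΘ
  set g : HGroup F → ℂ := fun x => (ψ (-c.x - c.y) : ℂ) * Θ (x * hMk 1 (unipOf c.x c.y c.z))
    with hg
  have hgm : Measurable g := measurable_const.mul
    ((measurable_torusIntegrand hψ _ _ _).comp (measurable_mul_const _))
  -- Right translation by the unipotent part of `c` is a shear, so it does not affect the integral
  -- over `N`.
  have hmp := measurePreserving_shear (F := F) c.x c.y (g := fun x _ => c.z + x * c.y)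
    (measurable_const.add (measurable_fst.mul_const _))
  have hgt : ∀ k x y z, g (hMk (slTorus h.ne_zero k) (unipOf x y z)) = (ψ (-c.x - c.y) : ℂ) *
      Θ (hMk (slTorus h.ne_zero k) (unipOf (c.x + x) (c.y + y) (z + (c.z + x * c.y)))) := by
    intro k x y z
    rw [hg]
    simp only
    rw [hMk_mul, mul_one, unipOf_mul, add_comm x, add_comm y, ← add_assoc]
  have hint : ∀ k, Integrable (fun p : F × F × F =>
      g (hMk (slTorus h.ne_zero k) (unipOf p.1 p.2.1 p.2.2))) (haarF3 F) := by
    intro k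
    simp only [hgt]
    have hi := integrable_torusIntegrand hF h hψ hρ he c.i c.j k
    exact ((hmp.integrable_comp hi.aestronglyMeasurable).mpr hi).const_mul _
  have key := integral_stabQuot hρ h μH hμH μS hμS ν hν
    (f := orbitalIntegrand ψ hρ hrel (weilGL ψ ρ (c.toGL h.ne_zero) (phiCirc F))) (g := g)
    (fun x => weilGL_toGL_mul hF h hψ hψc hρ c (xiOne ρ a) x) hgm (by
      intro x κ hκ
      have : hMk κ 1 * hMk 1 (unipOf c.x c.y c.z) = hMk 1 (unipOf c.x c.y c.z) * hMk κ 1 := by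
        rw [hMk_mul, hMk_mul, mul_one, one_mul, mul_one, one_mul]
      simp only [hg]
      rw [mul_assoc, this, ← mul_assoc, hΘ, torusIntegrand_mul_integral hρ _ _ _ _ hκ])
    (Finset.Icc (-(c.i + c.j)) (2 * e + c.i)) (by
      intro k hk x y z
      rw [hgt, hΘ, torusIntegrand_slTorus_eq_zero hF h hρ he hk, mul_zero])
    (fun k _ => hint k)
  refine ⟨key.1, key.2.trans ?_⟩
  have hq : (q : ℂ) ≠ 0 := by exact_mod_cast h.pos.ne'
  -- The powers combine as `q^(-2k) q^k q^(i+k) = q^i`, so the weight no longer depends on `k`.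
  have hval : ∀ k ∈ Finset.Icc (-(c.i + c.j)) (2 * e + c.i), (q : ℂ) ^ (-(2 * k)) *
      ∫ p : F × F × F, g (hMk (slTorus h.ne_zero k) (unipOf p.1 p.2.1 p.2.2)) ∂haarF3 F =
      (ψ (-c.x - c.y) : ℂ) * ((q : ℂ) ^ (-(2 * (c.i + c.j))) * ((q : ℂ) ^ c.i *
        levelIntegral q ψ ρ a e c.i c.j (2 * e - k - c.i))) := by
    intro k hk
    have hi := integrable_torusIntegrand (ψ := ψ) hF h hψ hρ he c.i c.j k
    simp only [hgt]
    rw [integral_const_mul]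
    have := integral_map (μ := haarF3 F) hmp.measurable.aemeasurable
      (f := fun p : F × F × F => Θ (hMk (slTorus h.ne_zero k) (unipOf p.1 p.2.1 p.2.2)))
      (by rw [hmp.map_eq]; exact hi.aestronglyMeasurable)
    rw [hmp.map_eq, integral_torusIntegrand hF h hψ hψc hρ he hk] at this
    rw [← this, show c.i + k = c.i + (2 * k - k) by ring, show -(2 * k) = -k - k by ring,
      zpow_add₀ hq c.i, zpow_sub₀ hq, zpow_sub₀ hq, show 2 * k = k + k by ring, zpow_add₀ hq k k,
      _root_.zpow_neg (q : ℂ) k]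
    field_simp
  rw [Finset.sum_congr rfl hval, ← Finset.mul_sum, ← Finset.mul_sum, ← Finset.mul_sum, levelSum]
  congr 3
  -- The substitution `κ = 2e - k - i` reverses the range of torus exponents onto that of levels.
  refine Finset.sum_bij' (fun k _ => 2 * e - k - c.i) (fun k _ => 2 * e - k - c.i) ?_ ?_ ?_ ?_ ?_
  · intro k hk
    rw [Finset.mem_Icc] at hk ⊢
    omega
  · intro k hk
    rw [Finset.mem_Icc] at hk ⊢
    omega
  · intro k _
    ring
  · intro k _
    ring
  · intro k _
    rfl

include hF hψ hψc he hμH hμS hν hrel h in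
/-- The orbital integrals of `ω(t)φ_∘` vanish for `t` off the dominant chamber. -/
lemma levelSum_eq_zero_of_neg (i j : ℤ) (hij : i < 0 ∨ j < 0) : levelSum q ψ ρ a e i j = 0 := by
  have hq : (q : ℂ) ≠ 0 := by exact_mod_cast h.pos.ne'
  have hcase : ∀ x y : F, ‖x‖ ≤ q ^ (-i) → ‖y‖ ≤ q ^ (-j) → ψ (-x - y) ≠ 1 →
      levelSum q ψ ρ a e i j = 0 := by
    intro x y hx hy hxy
    -- With these bounds the unipotent factor lies in `t K t⁻¹`, so it does not change the vector.
    -- Yet it multiplies the orbital integral by `ψ(-x-y) ≠ 1`, which forces that integral to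
    -- vanish.
    have hw : weilGL ψ ρ ((⟨i, j, x, y, 0⟩ : IwasawaCoord F).toGL h.ne_zero) (phiCirc F) =
        weilGL ψ ρ ((⟨i, j, 0, 0, 0⟩ : IwasawaCoord F).toGL h.ne_zero) (phiCirc F) := by
      obtain ⟨κ, hκ, e1⟩ := (mk_unip_torus_eq_iff h i j i j 0 0 0 x y 0).mpr
        ⟨rfl, rfl, by simpa using hx, by simpa using hy, by simpa using (zpow_pos h.pos _).le⟩
      have := weil_mk_mul_integral hF h hψc hρ (unipGL 0 0 0 * torusGL h.ne_zero i j) κ hκ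
      rw [← e1] at this
      exact this
    have h1 := (integral_orbitalIntegrand_toGL hF h hψ hψc hρ hrel he μH hμH μS hμS ν hν
      ⟨i, j, x, y, 0⟩).2
    rw [hw, (integral_orbitalIntegrand_toGL hF h hψ hψc hρ hrel he μH hμH μS hμS ν hν
      ⟨i, j, 0, 0, 0⟩).2] at h1
    simp only [neg_zero, sub_zero, AddChar.map_zero_eq_one, Circle.coe_one, one_mul] at h1
    by_contra hL
    have h2 : (q : ℂ) ^ (-(2 * (i + j))) * levelSum q ψ ρ a e i j ≠ 0 :=
      mul_ne_zero (zpow_ne_zero _ hq) hL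
    have h3 : (ψ (-x - y) : ℂ) = 1 := mul_right_cancel₀ h2 (by rw [← h1, one_mul])
    exact hxy (by rwa [Circle.coe_eq_one] at h3)
  have hex : ∀ i : ℤ, i < 0 → ∃ x : F, ‖x‖ ≤ q ^ (-i) ∧ ψ (-x) ≠ 1 := by
    intro i hi
    obtain ⟨x, hx, hx1⟩ := hψc.exists_ne_one (y := ϖ ^ i) (by
      rw [h.norm_zpow]
      exact one_lt_zpow₀ h.one_lt (by omega))
    exact ⟨-x, by rwa [norm_neg, ← h.norm_zpow], by rwa [neg_neg]⟩
  rcases hij with hi | hj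
  · obtain ⟨x, hx, hx1⟩ := hex i hi
    exact hcase x 0 hx (by simpa using (zpow_pos h.pos _).le) (by simpa using hx1)
  · obtain ⟨y, hy, hy1⟩ := hex j hj
    exact hcase 0 y (by simpa using (zpow_pos h.pos _).le) hy (by simpa using hy1)

include hF h hψ hψc he hμH hμS hν in
/-- The orbital integral of `ω(f_{m,n})φ_∘`. -/
lemma integral_orbitalIntegrand_weilConv (μG : Measure PGL(3, F)) [μG.IsHaarMeasure]
    (hμG : μG (integralPGL F) = 1) (m n : ℕ) (hmn : 1 ≤ m + n) :
    Integrable (orbitalIntegrand ψ hρ hrel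
      (weilConv ψ ρ μG (heckeFun ϖ m n) (phiCirc F))) ν ∧
    orbitalIntegral ψ hρ hrel ν (weilConv ψ ρ μG (heckeFun ϖ m n) (phiCirc F)) =
      orbitalValue ψ ρ a e m n := by
  obtain ⟨C, hC, hconv⟩ := exists_isHeckeReps hF h hψc hρ μG hμG m n
  have hneg := levelSum_eq_zero_of_neg hF h hψ hψc hρ hrel he μH hμH μS hμS ν hν
  have hc := integral_orbitalIntegrand_toGL hF h hψ hψc hρ hrel he μH hμH μS hμS ν hν
  have hsum : orbitalIntegrand ψ hρ hrel (weilConv ψ ρ μG (heckeFun ϖ m n) (phiCirc F)) =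
      fun s => ∑ c ∈ C, orbitalIntegrand ψ hρ hrel
        (weilGL ψ ρ (c.toGL h.ne_zero) (phiCirc F)) s := by
    funext s
    induction s using Quotient.inductionOn with
    | h g =>
      simp only [orbitalIntegrand, Quotient.lift_mk, hconv, Finset.sum_mul]
  rw [orbitalIntegral, hsum]
  refine ⟨integrable_finsetSum _ fun c _ => (hc c).1, ?_⟩
  rw [integral_finsetSum _ fun c _ => (hc c).1, Finset.sum_congr rfl fun c _ => (hc c).2,
    hC.sum_theta_inv_mul h hψc _ hneg]
  exact sum_levelSum_mul_cellIntegral h hψ hψc hρ he hneg m n hmn _ (by omega)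

end OrbitalIntegralCoset

/-! ### Translation of exponents back into absolute values. -/

section TableOfValues

variable {F : Type*} [NontriviallyNormedField F] [IsUltrametricDist F] [ProperSpace F]
  [MeasurableSpace F] [BorelSpace F] {ϖ : F} {q : ℝ} {a : F}

lemma IsNormalizedUniformizer.norm_zpow_mul (h : IsNormalizedUniformizer ϖ q) {e : ℤ}
    (he : ‖a‖ = q ^ e) (k : ℤ) : ‖ϖ ^ (-k) * a‖ = q ^ (k + e) := by
  rw [norm_mul, h.norm_zpow, neg_neg, he, zpow_add₀ h.pos.ne']

lemma orbitalValue_eq (h : IsNormalizedUniformizer ϖ q) (ψ : AddChar F Circle) (ρ : F) {e : ℤ}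
    (he : ‖a‖ = q ^ e) (m n : ℕ) : orbitalValue ψ ρ a e m n =
      if ‖ϖ ^ (-(n : ℤ)) * a‖ = 1 ∧ m = 0 then 1
      else if ‖ϖ ^ (-(n : ℤ)) * a‖ = q ∧ m = 0 then 3
      else if ‖ϖ ^ (-1 : ℤ) * a‖ = q ^ 2 ∧ m = 0 ∧ n = 1 then
        1 + (ψ (-a) : ℂ) + (ψ (ρ ^ 2 * a) : ℂ)
      else if ‖ϖ ^ (-(n : ℤ)) * a‖ = q ^ 2 ∧ m = 0 ∧ 1 < n then 1
      else if ‖ϖ ^ (-(n : ℤ)) * a‖ = 1 ∧ m = 1 then 2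
      else if ‖ϖ ^ (-(n : ℤ)) * a‖ = q ∧ m = 1 ∧ 0 < n then 2
      else if q ^ 3 ≤ ‖ϖ ^ (-(2 * m + n : ℤ)) * a‖ ∧ m + n = 1 then
        1 + (ψ (-a) : ℂ) + (ψ (ρ ^ 2 * a) : ℂ)
      else 0 := by
  have e0 : ∀ k : ℤ, q ^ k = 1 ↔ k = 0 := fun k => by rw [← zpow_zero q, h.zpow_inj]
  have e1 : ∀ k : ℤ, q ^ k = q ↔ k = 1 := fun k => by
    conv_lhs => rw [← zpow_one q, ← _root_.zpow_mul, one_mul]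
    rw [h.zpow_inj]
  have e2 : ∀ k : ℤ, q ^ k = q ^ 2 ↔ k = 2 := fun k => by
    rw [← zpow_natCast q 2, h.zpow_inj]
    rfl
  have e3 : ∀ k : ℤ, q ^ 3 ≤ q ^ k ↔ 3 ≤ k := fun k => by
    rw [← zpow_natCast q 3, h.zpow_le_zpow_iff]
    rfl
  simp only [h.norm_zpow_mul he, e0, e1, e2, e3, orbitalValue]

end TableOfValues

end

end PGL3Orbital

theorem proposition7
    {F : Type*} [NontriviallyNormedField F] [IsUltrametricDist F] [ProperSpace F]
    [MeasurableSpace F] [BorelSpace F]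
    -- residual characteristic greater than three, normalized absolute value
    (hF : 3 < ringChar (residueField F))
    (ϖ : F) (hϖ : IsUniformizer ϖ) (hnorm : ‖ϖ‖ = (residueCard F : ℝ)⁻¹)
    -- primitive cube root of unity, additive character of conductor the ring of integers
    (ρ : F) (hρ : IsPrimitiveRoot ρ 3)
    (ψ : AddChar F Circle) (hψ : Continuous ψ) (hψc : HasConductorIntegers ψ)
    -- normalized Haar measure on `PGL₃(F)`
    (μG : Measure PGL(3, F)) [μG.IsHaarMeasure] (hμG : μG (integralPGL F) = 1)
    -- normalized Haar measure on `H = SL₂(F) × N`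
    (μH : Measure (HGroup F)) [μH.IsHaarMeasure] (hμH : μH (integralH F) = 1)
    (a : F) (ha : a ≠ 0)
    -- normalized Haar measure on the stabilizer of `ξ₁(a)`, and the quotient measure
    (μS : Measure (stab hρ (xiOne ρ a))) [μS.IsHaarMeasure]
    (hμS : μS {h | h.1.1 ∈ integralSL2 F} = 1)
    (ν : Measure (StabQuot hρ (xiOne ρ a)))
    (hν : IsQuotientMeasure hρ (xiOne ρ a) μH μS ν)
    (m n : ℕ) (hmn : 1 ≤ m + n) :
    Integrable (orbitalIntegrand ψ hρ (xiOne_relevant hF ψ hρ ha)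
      (weilConv ψ ρ μG (heckeFun ϖ m n) (phiCirc F))) ν ∧
    orbitalIntegral ψ hρ (xiOne_relevant hF ψ hρ ha) ν
        (weilConv ψ ρ μG (heckeFun ϖ m n) (phiCirc F)) =
      if ‖ϖ ^ (-(n : ℤ)) * a‖ = 1 ∧ m = 0 then 1
      else if ‖ϖ ^ (-(n : ℤ)) * a‖ = residueCard F ∧ m = 0 then 3
      else if ‖ϖ ^ (-1 : ℤ) * a‖ = (residueCard F : ℝ) ^ 2 ∧ m = 0 ∧ n = 1 then
        1 + (ψ (-a) : ℂ) + (ψ (ρ ^ 2 * a) : ℂ)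
      else if ‖ϖ ^ (-(n : ℤ)) * a‖ = (residueCard F : ℝ) ^ 2 ∧ m = 0 ∧ 1 < n then 1
      else if ‖ϖ ^ (-(n : ℤ)) * a‖ = 1 ∧ m = 1 then 2
      else if ‖ϖ ^ (-(n : ℤ)) * a‖ = residueCard F ∧ m = 1 ∧ 0 < n then 2
      else if (residueCard F : ℝ) ^ 3 ≤ ‖ϖ ^ (-(2 * m + n : ℤ)) * a‖ ∧ m + n = 1 then
        1 + (ψ (-a) : ℂ) + (ψ (ρ ^ 2 * a) : ℂ)
      else 0 := by
  have h := isNormalizedUniformizer hϖ hnorm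
  obtain ⟨e, he⟩ := h.exists_zpow a ha
  rw [← orbitalValue_eq h ψ ρ he m n]
  exact integral_orbitalIntegrand_weilConv hF h hψ hψc hρ (xiOne_relevant hF ψ hρ ha) he μH hμH μS
    hμS ν hν μG hμG m n hmn
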